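/- Let $d\ge 1$, let $\Omega\in\mathbb R^d$ be irrational ($k\cdot\Omega\neq0$ for $k\in\mathbb Z^d\setminus\{0\}$), and consider on $\mathbb T^d=\mathbb R^d/\mathbb Z^d$ the foliation-preserving maps $$F_{\alpha,\varepsilon}(x)=x+\alpha\Omega+\varepsilon f_\varepsilon(x)\,\Omega ,\qquad \alpha\in\mathbb R,\ \varepsilon\ge 0 .$$ Let $\alpha_0\ne0$ be such that $\alpha_0\Omega$ is resonant ($k\cdot\alpha_0\Omega\in\mathbb Z$ for some $k\in\mathbb Z^d\setminus\{0\}$), and let $A\in \mathrm{SL}(d,\mathbb Z)$, $\omega\in\mathbb R^{d-1}$, $L=(L_1,L_2)\in\mathbb Z^{d-1}\times\mathbb Z$ satisfy $A\alpha_0\Omega=(\omega,0)+L$ with $\omega\cdot m\neq 0$ for $m\in\mathbb Z^{d-1}\setminus\{0\}$. Assume that the intrinsic frequency $\omega$ is Diophantine: for some $\nu,\tau>0$, $|k\cdot\omega-N|\ge\nu|k|^{-\tau}$ for all $k\in\mathbb Z^{d-1}\setminus\{0\}$, $N\in\mathbb Z$, where $|\cdot|$ is the supremum norm. *Resonant normal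 form.* Define recursively, for $j\ge1$, functions $p_j,h_j$ on $\mathbb T^d$ and $P_j$ on $\mathbb T$ as follows. The function $p_j$ is the coefficient of $\varepsilon^j\Omega$ in the expansion at $\varepsilon=0^+$ of $F_{\alpha_0,\varepsilon}\circ H_\varepsilon-H_\varepsilon\circ N_\varepsilon$, where $$H_\varepsilon=\mathrm{Id}+\sum_{1\le i<j}\varepsilon^ih_i\,\Omega,\qquad N_\varepsilon(x)=x+\alpha_0\Omega+\sum_{1\le i<j}\varepsilon^iP_i\big((Ax)_d\big)\,\Omega .$$ If $c(m,l)$, $(m,l)\in\mathbb Z^{d-1}\times\mathbb Z$, are the Fourier coefficients of $p_j\circ A^{-1}$, then $$P_j(x_2)=\sum_{l\in\mathbb Z}c(0,l)e^{2\pi i l x_2},\qquad h_j(x)=\sum_{m\ne0,\;l\in\mathbb Z}\frac{c(m,l)}{e^{2\pi i m\cdot\omega}-1}\,e^{2\pi i (m,l)\cdot Ax} .$$ Let $n\ge1$ be the first order with $P_n\not\equiv0$ (assumed to exist), and put $\eta(x_2,0)=\alpha_0^{-1}L_2P_n(x_2)$. Assume the non-degeneracy condition (H1): there is $x_2^*$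 with $\eta(x_2^*,0)=0$ and $\partial_{x_2}\eta(x_2^*,0)\neq0$. *Regularity.* Let $\ell,q\in\mathbb N$ with $\ell\ge1$ and $q\ge n(d+\tau)$. For some $\varepsilon_1>0$ let $f_\varepsilon(x)$, $0\le\varepsilon<\varepsilon_1$, be $\mathbb Z^d$-periodic in $x$, $\mathscr C^n$ in $\varepsilon$ (one-sided at $0$), and either real analytic, $\mathscr C^\infty$, or $\mathscr C^p$ in $x$ with finite $p\ge q+\ell+4$, in the sense that the mixed derivatives of order $\le n$ in $\varepsilon$ and of order $\le p$ in $x$ (of every order in $x$ in the first two cases) exist and are jointly continuous, and that the $\varepsilon$-derivatives of order $\le n$ have the stated regularity in $x$. Then for every $C>0$ there is $\varepsilon_0>0$ such that, for all $(\alpha,\varepsilon)$ with $0<\varepsilon<\varepsilon_0$ and $|\alpha-\alpha_0|\le C\varepsilon^{n+1}$, the map $F_{\alpha,\varepsilon}$ has a $(d-1)$-dimensional invariant torus of class $\mathscr C^\ell$: there is an injective $\mathscr C^\ell$ immersion $\mathbb T^{d-1}\to\mathbb T^d$ whose image $\mathcal T$ satisfies $F_{\alpha,\varepsilon}(\mathcal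 T)=\mathcal T$. (So in the analytic and smooth cases there are invariant tori of any prescribed finite regularity $\ell$, with $\varepsilon_0$ depending on $\ell$; in the $\mathscr C^p$ case the regularity obtained is less than that of the map.) -/

import Mathlib

noncomputable section

namespace FoliationTorus

/-- The frequency vector `Ω` is irrational: `Ω · k ≠ 0` for every nonzero integer vector `k`. -/
def IsIrrational {d : ℕ} (Ω : Fin d → ℝ) : Prop :=
  ∀ k : Fin d → ℤ, k ≠ 0 → ∑ i, (k i : ℝ) * Ω i ≠ 0

/-- The frequency vector `v` is resonant: `k · v ∈ ℤ` for some nonzero integer vector `k`. -/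
def IsResonant {d : ℕ} (v : Fin d → ℝ) : Prop :=
  ∃ k : Fin d → ℤ, k ≠ 0 ∧ ∃ N : ℤ, ∑ i, (k i : ℝ) * v i = N

/-- Diophantine condition of type `(ν, τ)`; `‖k‖` is the supremum norm. -/
def IsDiophantine {s : ℕ} (ν τ : ℝ) (ω : Fin s → ℝ) : Prop :=
  ∀ k : Fin s → ℤ, k ≠ 0 → ∀ N : ℤ, ν * ‖k‖ ^ (-τ) ≤ |∑ i, (k i : ℝ) * ω i - N|

/-- The linear action on `ℝ^d` of an integer matrix of determinant one. -/
def act {d : ℕ} (A : Matrix.SpecialLinearGroup (Fin d) ℤ) (x : Fin d → ℝ) : Fin d → ℝ :=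
  ((A : Matrix (Fin d) (Fin d) ℤ).map (fun z : ℤ => (z : ℝ))).mulVec x

/-- `A v = (ω, 0) + L`, where `ω · m ≠ 0` for nonzero integer `m`: the vector `ω ∈ ℝ^{d-1}` is the
intrinsic frequency of the resonant vector `v ∈ ℝ^d`. Here and below `d = r + 1`. -/
structure IsIntrinsicFrequency {r : ℕ} (A : Matrix.SpecialLinearGroup (Fin (r + 1)) ℤ)
    (ω : Fin r → ℝ) (L : Fin (r + 1) → ℤ) (v : Fin (r + 1) → ℝ) : Prop where
  irrational : IsIrrational ω
  eq : ∀ i, act A v i = Fin.snoc (α := fun _ => ℝ) ω 0 i + (L i : ℝ)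

/-- `(f_ε)`, `0 ≤ ε < ε₁`, is a family of functions on the torus `ℝ^d / ℤ^d` (written as
`ℤ^d`-periodic functions on `ℝ^d`) that is `C^N` in `ε` and `C^p` in `x`: the mixed derivatives of
order at most `N` in `ε` (one-sided at `0`) and at most `p` in `x` exist and are jointly
continuous. The exponent `p` is a natural number, `∞` (smooth) or `ω` (real analytic). -/
structure IsTorusFamily {d : ℕ} (N : ℕ) (p : WithTop ℕ∞) (ε₁ : ℝ)
    (f : ℝ → (Fin d → ℝ) → ℝ) : Prop where
  periodic : ∀ ε ∈ Set.Ico 0 ε₁, ∀ (x : Fin d → ℝ) (m : Fin d → ℤ),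
    f ε (fun i => x i + (m i : ℝ)) = f ε x
  contDiffOn_param : ∀ x, ContDiffOn ℝ N (fun ε => f ε x) (Set.Ico 0 ε₁)
  contDiff_space : ∀ i ≤ N, ∀ ε ∈ Set.Ico 0 ε₁,
    ContDiff ℝ p (fun x => iteratedDerivWithin i (fun e => f e x) (Set.Ico 0 ε₁) ε)
  continuousOn_mixed : ∀ i ≤ N, ∀ j : ℕ, (j : WithTop ℕ∞) ≤ p →
    ContinuousOn (fun z : ℝ × (Fin d → ℝ) =>
      iteratedFDeriv ℝ j
        (fun x => iteratedDerivWithin i (fun e => f e x) (Set.Ico 0 ε₁) z.1) z.2)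
      (Set.Ico 0 ε₁ ×ˢ Set.univ)

/-- The foliation preserving map `T_φ(x) = x + φ(x) Ω` (lifted to `ℝ^d`). -/
def T {d : ℕ} (Ω : Fin d → ℝ) (φ : (Fin d → ℝ) → ℝ) (x : Fin d → ℝ) : Fin d → ℝ :=
  x + φ x • Ω

/-- The function `φ ⋆ ψ` with `T_φ ∘ T_ψ = T_{φ ⋆ ψ}`. -/
def comp {d : ℕ} (Ω : Fin d → ℝ) (φ ψ : (Fin d → ℝ) → ℝ) (x : Fin d → ℝ) : ℝ :=
  ψ x + φ (T Ω ψ x)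

/-- The family `F_{α,ε}(x) = x + α Ω + ε f_ε(x) Ω`. -/
def F {d : ℕ} (Ω : Fin d → ℝ) (f : ℝ → (Fin d → ℝ) → ℝ) (α ε : ℝ) :
    (Fin d → ℝ) → (Fin d → ℝ) :=
  T Ω (fun x => α + ε * f ε x)

/-- The character `y ↦ e^{2πi k·y}`. -/
def character {d : ℕ} (k : Fin d → ℤ) (y : Fin d → ℝ) : ℂ :=
  Complex.exp (2 * Real.pi * Complex.I * ((∑ i, (k i : ℝ) * y i : ℝ) : ℂ))

/-- The `k`-th Fourier coefficient of `p ∘ A⁻¹`. -/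
def fourierCoeffIn {d : ℕ} (A : Matrix.SpecialLinearGroup (Fin d) ℤ)
    (p : (Fin d → ℝ) → ℝ) (k : Fin d → ℤ) : ℂ :=
  ∫ y in Set.Icc (0 : Fin d → ℝ) 1, (p (act A⁻¹ y) : ℂ) * character (-k) y

/-- The resonant part `x₂ ↦ ∑_l c(0,l) e^{2πi l x₂}` of `p`, where `c(m,l)` are the Fourier
coefficients of `p ∘ A⁻¹`. -/
def resonantPart {r : ℕ} (A : Matrix.SpecialLinearGroup (Fin (r + 1)) ℤ)
    (p : (Fin (r + 1) → ℝ) → ℝ) (x₂ : ℝ) : ℝ :=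
  (∑' l : ℤ, fourierCoeffIn A p (Fin.snoc (α := fun _ => ℤ) 0 l) *
    Complex.exp (2 * Real.pi * Complex.I * l * x₂)).re

/-- The solution, without resonant Fourier modes, of `h(x + α₀ Ω) - h(x) = p(x)` up to the resonant
part of `p`: the Fourier coefficients of `h ∘ A⁻¹` are `c(m,l) / (e^{2πi m·ω} - 1)` for
`m ≠ 0` and `0` for `m = 0`, where `c(m,l)` are those of `p ∘ A⁻¹`. -/
def cohomologySolution {r : ℕ} (A : Matrix.SpecialLinearGroup (Fin (r + 1)) ℤ)
    (ω : Fin r → ℝ) (p : (Fin (r + 1) → ℝ) → ℝ) (x : Fin (r + 1) → ℝ) : ℝ :=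
  (∑' k : Fin (r + 1) → ℤ,
    if Fin.init (α := fun _ => ℤ) k = 0 then 0
    else fourierCoeffIn A p k / (character (Fin.init (α := fun _ => ℤ) k) ω - 1) *
      character k (act A x)).re

/-- The averaging procedure at `α = α₀`. Suppose the orders `i < j` have been treated: there are
functions `h_i` on the torus and `P_i` on the circle such that
`H_ε = Id + ∑_{i<j} ε^i h_i Ω` conjugates `F_{α₀,ε}` to
`N_ε(x) = x + α₀ Ω + ∑_{i<j} ε^i P_i((A x)₂) Ω` up to order `ε^{j-1}`.
Then `orderTerm j` is the coefficient of `ε^j` (along `Ω`) in `F_{α₀,ε} ∘ H_ε - H_ε ∘ N_ε`,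
equivalently in `H_ε⁻¹ ∘ F_{α₀,ε} ∘ H_ε - N_ε`;
its resonant part is `P_j`, and `h_j` is the solution of the cohomology equation for the rest.
For `j = 0` all these functions vanish. -/
def orderTerm {r : ℕ} (Ω : Fin (r + 1) → ℝ) (f : ℝ → (Fin (r + 1) → ℝ) → ℝ) (α₀ : ℝ)
    (A : Matrix.SpecialLinearGroup (Fin (r + 1)) ℤ) (ω : Fin r → ℝ) :
    ℕ → (Fin (r + 1) → ℝ) → ℝ
  | j => fun x =>
    let p : Fin j → (Fin (r + 1) → ℝ) → ℝ := fun i => orderTerm Ω f α₀ A ω i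
    let φF : ℝ → (Fin (r + 1) → ℝ) → ℝ := fun ε y => α₀ + ε * f ε y
    let φH : ℝ → (Fin (r + 1) → ℝ) → ℝ := fun ε y =>
      ∑ i : Fin j, ε ^ (i : ℕ) * cohomologySolution A ω (p i) y
    let φN : ℝ → (Fin (r + 1) → ℝ) → ℝ := fun ε y =>
      α₀ + ∑ i : Fin j, ε ^ (i : ℕ) * resonantPart A (p i) (act A y (Fin.last r))
    iteratedDerivWithin j
      (fun ε => comp Ω (φF ε) (φH ε) x - comp Ω (φH ε) (φN ε) x) (Set.Ici 0) 0 / (j.factorial : ℝ)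
  termination_by j => j
  decreasing_by exact i.isLt

/-- The term `P_j` of order `ε^j` in the resonant normal form, a function of the resonant angle. -/
def normalFormTerm {r : ℕ} (Ω : Fin (r + 1) → ℝ) (f : ℝ → (Fin (r + 1) → ℝ) → ℝ) (α₀ : ℝ)
    (A : Matrix.SpecialLinearGroup (Fin (r + 1)) ℤ) (ω : Fin r → ℝ) (j : ℕ) : ℝ → ℝ :=
  resonantPart A (orderTerm Ω f α₀ A ω j)

/-- `n` is the first order `≥ 1` at which the resonant normal form has a nonzero term. -/
structure IsFirstOrder {r : ℕ} (Ω : Fin (r + 1) → ℝ) (f : ℝ → (Fin (r + 1) → ℝ) → ℝ) (α₀ : ℝ)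
    (A : Matrix.SpecialLinearGroup (Fin (r + 1)) ℤ) (ω : Fin r → ℝ) (n : ℕ) : Prop where
  one_le : 1 ≤ n
  before : ∀ j, 1 ≤ j → j < n → ∀ t, normalFormTerm Ω f α₀ A ω j t = 0
  ne_zero : ∃ t, normalFormTerm Ω f α₀ A ω n t ≠ 0

/-- The function `η(·, 0)`. In the coordinates `(x₁, x₂) = A x` the resonant normal form has second
component `x₂ + ε^n η(x₂, ε) + …`, and `(A Ω)₂ = L₂ / α₀`. -/
def eta {r : ℕ} (Ω : Fin (r + 1) → ℝ) (f : ℝ → (Fin (r + 1) → ℝ) → ℝ) (α₀ : ℝ)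
    (A : Matrix.SpecialLinearGroup (Fin (r + 1)) ℤ) (ω : Fin r → ℝ) (L : Fin (r + 1) → ℤ)
    (n : ℕ) (x₂ : ℝ) : ℝ :=
  α₀⁻¹ * (L (Fin.last r) : ℝ) * normalFormTerm Ω f α₀ A ω n x₂

/-- The preimage in `ℝ^d` of the image of `K` in `ℝ^d / ℤ^d`. -/
def torusSet {r d : ℕ} (K : (Fin r → ℝ) → (Fin d → ℝ)) : Set (Fin d → ℝ) :=
  {x | ∃ (s : Fin r → ℝ) (m : Fin d → ℤ), ∀ i, x i = K s i + (m i : ℝ)}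

/-- `K` is the lift of a `C^ℓ` embedding (injective immersion) `𝕋^r → 𝕋^d` whose image is invariant
under the map of `𝕋^d` with lift `G`. -/
structure IsInvariantTorus {r d : ℕ} (ℓ : ℕ) (G : (Fin d → ℝ) → (Fin d → ℝ))
    (K : (Fin r → ℝ) → (Fin d → ℝ)) : Prop where
  contDiff : ContDiff ℝ ℓ K
  descends : ∃ B : Matrix (Fin d) (Fin r) ℤ, ∀ (s : Fin r → ℝ) (m : Fin r → ℤ) (i : Fin d),
    K (fun j => s j + (m j : ℝ)) i = K s i + ((B.mulVec m i : ℤ) : ℝ)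
  injective : ∀ s s' : Fin r → ℝ, (∃ m : Fin d → ℤ, ∀ i, K s i = K s' i + (m i : ℝ)) →
    ∃ m : Fin r → ℤ, ∀ j, s j = s' j + (m j : ℝ)
  immersion : ∀ s, Function.Injective (fderiv ℝ K s)
  invariant : G '' torusSet K = torusSet K

end FoliationTorus

end

/-!
The map `F_{α,ε}` is studied through two changes of variables along the foliation.

*Averaging.* Taking `h_j = cohomologySolution p_j` removes the nonresonant part of the term `p_j` of
order `ε^j`. The divisors `e^{2πi m·ω} - 1` are bounded below by a multiple of `|m|^{-τ}`, so that
a solution `h_j` of class `C^s` exists once `p_j` is of class `C^{s+σ}` for some `σ > τ + d/2`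
(`contDiff_cohomologySolution`; the Fourier coefficients are controlled by Bessel's inequality, and
products of square summable sequences are summable). Here `σ = ⌊τ + d⌋` is a possible loss, and `n`
steps cost `nσ ≤ q` derivatives. The point of `averaging_step` is that `p_j`, which is defined
pointwise as a Taylor coefficient in `ε`, is the leading coefficient of an expansion in powers of
`ε` with remainders estimated in `C^k` (`HasExpansion.exists_leading`,
`iteratedDerivWithin_of_isOrder`). The outcome is `exists_resonant_normal_form`: with
`φ = ∑_{i ≤ n} ε^i h_i`,
`φ(x) + ε f_ε(x + φ(x) Ω) - φ(x + α₀ Ω) = ε^n P_n((A x)_d) + O(ε^{n+1})`.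

*Graph transform.* In the coordinates `A x = (s, y)` and near the zero `x₂` of `P = P_n`, the map is
`(s, y) ↦ (s + ω + μ t β, y + μ t β₂)` up to integers, where `μ = ε^n`, `A Ω = (β, β₂)`,
`β₂ = L₂ / α₀`, and the displacement `t` is `P' (x₂) (y - x₂)` up to terms that are quadratic in
`y - x₂` or of order `ε`. A torus which is a graph `y = x₂ + u(s)` is invariant if
`u(s + ω + μ t β) = u + μ β₂ t` and `t = P'(x₂) u + R(s, u, t)`. If `β₂ P'(x₂) > 0` the torus is
repelling, and the first equation is solved for `u` on the right; the factor
`(1 + μ β₂ P'(x₂))⁻¹` makes the iteration a contraction in `C^0` that preserves a ball of `C^{ℓ+1}`.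
Both the contraction and the perturbation are of size `μ`, so the radius `ρ` of the ball may be
chosen before `ε` (`exists_invariant_graph`). The limit is of class `C^ℓ`, since one derivative is
enough to pass to the limit in the derivatives (`CkBound.of_tendstoUniformly`). If
`β₂ P'(x₂) < 0` the torus is attracting and the same equations, with the signs of `ω`, `β`, `β₂`
reversed, describe the motion backwards from the graph; this is the parameter `χ` of
`exists_isInvariantTorus_of_normalForm`.
-/

noncomputable section

namespace FoliationTorus

/-! ### Uniform bounds on derivatives -/

section CkBound

variable {E F G H : Type} [NormedAddCommGroup E] [NormedSpace ℝ E] [NormedAddCommGroup F]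
  [NormedSpace ℝ F] [NormedAddCommGroup G] [NormedSpace ℝ G] [NormedAddCommGroup H]
  [NormedSpace ℝ H]

/-- `f` is of class `C^k` and its derivatives of order at most `k` are bounded by `M`. -/
def CkBound (k : ℕ) (M : ℝ) (f : E → F) : Prop :=
  ContDiff ℝ k f ∧ ∀ j ≤ k, ∀ x, ‖iteratedFDeriv ℝ j f x‖ ≤ M

namespace CkBound

theorem norm_le {k : ℕ} {M : ℝ} {f : E → F} (h : CkBound k M f) (x : E) : ‖f x‖ ≤ M := by
  simpa using h.2 0 (Nat.zero_le _) x

theorem nonneg {k : ℕ} {M : ℝ} {f : E → F} (h : CkBound k M f) : 0 ≤ M :=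
  (norm_nonneg _).trans (h.norm_le 0)

theorem zero_iff {M : ℝ} {f : E → F} : CkBound 0 M f ↔ Continuous f ∧ ∀ x, ‖f x‖ ≤ M := by
  simp [CkBound, contDiff_zero]

theorem succ_iff {k : ℕ} {M : ℝ} {f : E → F} :
    CkBound (k + 1) M f ↔
      Differentiable ℝ f ∧ (∀ x, ‖f x‖ ≤ M) ∧ CkBound k M (fderiv ℝ f) := by
  have key : ContDiff ℝ ((k + 1 : ℕ) : WithTop ℕ∞) f ↔
      Differentiable ℝ f ∧ ContDiff ℝ k (fderiv ℝ f) := by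
    push_cast
    rw [contDiff_succ_iff_fderiv]
    simp
  constructor
  · rintro ⟨h1, h2⟩
    refine ⟨(key.1 h1).1, fun x => by simpa using h2 0 (Nat.zero_le _) x, (key.1 h1).2, ?_⟩
    intro j hj x
    rw [norm_iteratedFDeriv_fderiv]
    exact h2 (j + 1) (by omega) x
  · rintro ⟨h1, h2, h3⟩
    refine ⟨key.2 ⟨h1, h3.1⟩, ?_⟩
    rintro (_ | j) hj x
    · simpa using h2 x
    · rw [← norm_iteratedFDeriv_fderiv]
      exact h3.2 j (by omega) x

theorem differentiable {k : ℕ} {M : ℝ} {f : E → F} (h : CkBound (k + 1) M f) :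
    Differentiable ℝ f := (succ_iff.1 h).1

theorem fderiv {k : ℕ} {M : ℝ} {f : E → F} (h : CkBound (k + 1) M f) :
    CkBound k M (fderiv ℝ f) := (succ_iff.1 h).2.2

theorem continuous {k : ℕ} {M : ℝ} {f : E → F} (h : CkBound k M f) : Continuous f :=
  h.1.continuous

theorem mono {k l : ℕ} {M N : ℝ} {f : E → F} (h : CkBound k M f) (hl : l ≤ k) (hM : M ≤ N) :
    CkBound l N f :=
  ⟨h.1.of_le (by exact_mod_cast hl), fun j hj x => (h.2 j (hj.trans hl) x).trans hM⟩

theorem mono_const {k : ℕ} {M N : ℝ} {f : E → F} (h : CkBound k M f) (hM : M ≤ N) :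
    CkBound k N f := h.mono le_rfl hM

theorem mono_order {k l : ℕ} {M : ℝ} {f : E → F} (h : CkBound k M f) (hl : l ≤ k) :
    CkBound l M f := h.mono hl le_rfl

theorem congr {k : ℕ} {M : ℝ} {f g : E → F} (h : CkBound k M f) (hfg : ∀ x, g x = f x) :
    CkBound k M g := by
  rwa [show g = f from funext hfg]

theorem const (k : ℕ) (c : F) : CkBound k ‖c‖ (fun _ : E => c) := by
  induction k generalizing F with
  | zero => exact zero_iff.2 ⟨continuous_const, fun _ => le_rfl⟩
  | succ k ih =>
    refine succ_iff.2 ⟨differentiable_const c, fun _ => le_rfl, ?_⟩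
    have := (ih (0 : E →L[ℝ] F)).mono_const (N := ‖c‖) (by simp)
    exact this.congr fun x => by simp

theorem zero (k : ℕ) : CkBound k 0 (fun _ : E => (0 : F)) := by
  simpa using const (E := E) k (0 : F)

theorem add {k : ℕ} {M N : ℝ} {f g : E → F} (hf : CkBound k M f) (hg : CkBound k N g) :
    CkBound k (M + N) (fun x => f x + g x) := by
  refine ⟨hf.1.add hg.1, fun j hj x => ?_⟩
  have h1 : ContDiff ℝ j f := hf.1.of_le (by exact_mod_cast hj)
  have h2 : ContDiff ℝ j g := hg.1.of_le (by exact_mod_cast hj)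
  have : iteratedFDeriv ℝ j (fun x => f x + g x) x
      = iteratedFDeriv ℝ j f x + iteratedFDeriv ℝ j g x :=
    iteratedFDeriv_add_apply h1.contDiffAt h2.contDiffAt
  rw [this]
  exact (norm_add_le _ _).trans (add_le_add (hf.2 j hj x) (hg.2 j hj x))

theorem clm_comp (L : F →L[ℝ] G) {k : ℕ} {M : ℝ} {f : E → F} (hf : CkBound k M f) :
    CkBound k (‖L‖ * M) (fun x => L (f x)) := by
  refine ⟨L.contDiff.comp hf.1, fun j hj x => ?_⟩
  refine (L.norm_iteratedFDeriv_comp_left (f := f) (n := j)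
    (hf.1.of_le (by exact_mod_cast hj)).contDiffAt le_rfl).trans ?_
  gcongr
  exact hf.2 j hj x

theorem const_smul {k : ℕ} {M : ℝ} {f : E → F} (c : ℝ) (hf : CkBound k M f) :
    CkBound k (|c| * M) (fun x => c • f x) := by
  refine ((hf.clm_comp (c • ContinuousLinearMap.id ℝ F)).mono_const ?_).congr fun x => by simp
  refine mul_le_mul_of_nonneg_right ?_ hf.nonneg
  rw [norm_smul, Real.norm_eq_abs]
  exact mul_le_of_le_one_right (abs_nonneg _) ContinuousLinearMap.norm_id_le

theorem const_mul {k : ℕ} {M : ℝ} {f : E → ℝ} (c : ℝ) (hf : CkBound k M f) :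
    CkBound k (|c| * M) (fun x => c * f x) := hf.const_smul c

theorem neg {k : ℕ} {M : ℝ} {f : E → F} (hf : CkBound k M f) :
    CkBound k M (fun x => -f x) := by
  simpa using hf.const_smul (-1)

theorem sub {k : ℕ} {M N : ℝ} {f g : E → F} (hf : CkBound k M f) (hg : CkBound k N g) :
    CkBound k (M + N) (fun x => f x - g x) := by
  simpa [sub_eq_add_neg] using hf.add hg.neg

theorem bilin (B : F →L[ℝ] G →L[ℝ] H) {k : ℕ} {M N : ℝ} {f : E → F} {g : E → G}
    (hf : CkBound k M f) (hg : CkBound k N g) :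
    CkBound k (2 ^ k * ‖B‖ * M * N) (fun x => B (f x) (g x)) := by
  have hM := hf.nonneg
  have hN := hg.nonneg
  induction k generalizing F G H with
  | zero =>
    refine zero_iff.2 ⟨by have := hf.continuous; have := hg.continuous; fun_prop, fun x => ?_⟩
    simp only [pow_zero, one_mul]
    exact (B.le_opNorm₂ _ _).trans (by gcongr; exacts [hf.norm_le x, hg.norm_le x])
  | succ k ih =>
    refine succ_iff.2 ⟨fun x => ?_, fun x => ?_, ?_⟩
    · exact ((B.hasFDerivAt_of_bilinear (hf.differentiable x).hasFDerivAt
        (hg.differentiable x).hasFDerivAt)).differentiableAt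
    · calc ‖B (f x) (g x)‖ ≤ ‖B‖ * ‖f x‖ * ‖g x‖ := B.le_opNorm₂ _ _
        _ ≤ ‖B‖ * M * N := by gcongr; exacts [hf.norm_le x, hg.norm_le x]
        _ ≤ 2 ^ (k + 1) * ‖B‖ * M * N := by
          rw [mul_assoc, mul_assoc, mul_assoc]
          exact le_mul_of_one_le_left (by positivity) (one_le_pow₀ (by norm_num))
    · have h1 := ih (B.precompR E) (hf.mono_order (Nat.le_succ k)) hg.fderiv
      have h2 := ih (B.precompL E) hf.fderiv (hg.mono_order (Nat.le_succ k))
      refine ((h1.add h2).mono_const ?_).congr fun x =>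
        B.fderiv_of_bilinear (hf.differentiable x) (hg.differentiable x)
      have e1 := B.norm_precompR_le E
      have e2 := B.norm_precompL_le E
      calc _ ≤ 2 ^ k * ‖B‖ * M * N + 2 ^ k * ‖B‖ * M * N := by gcongr
        _ = _ := by ring

theorem mul {k : ℕ} {M N : ℝ} {f g : E → ℝ} (hf : CkBound k M f) (hg : CkBound k N g) :
    CkBound k (2 ^ k * M * N) (fun x => f x * g x) := by
  have := bilin (ContinuousLinearMap.mul ℝ ℝ) hf hg
  simpa using this

theorem smul_const {k : ℕ} {M : ℝ} {f : E → ℝ} (hf : CkBound k M f) (v : F) :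
    CkBound k (M * ‖v‖) (fun x => f x • v) := by
  refine ((hf.clm_comp ((ContinuousLinearMap.id ℝ ℝ).smulRight v)).mono_const
    (le_of_eq ?_)).congr fun x => by simp
  rw [ContinuousLinearMap.norm_smulRight_apply]
  simp [mul_comm]

theorem apply_const {k : ℕ} {M : ℝ} {L : E → F →L[ℝ] G} (hL : CkBound k M L) (v : F) :
    CkBound k (M * ‖v‖) (fun x => L x v) := by
  refine (hL.clm_comp (ContinuousLinearMap.apply ℝ G v)).mono_const ?_
  rw [mul_comm]
  refine mul_le_mul_of_nonneg_left ?_ hL.nonneg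
  refine ContinuousLinearMap.opNorm_le_bound _ (norm_nonneg _) fun L => ?_
  rw [mul_comm]
  exact L.le_opNorm v

theorem smulRight {k : ℕ} {M N : ℝ} {ω : E → F →L[ℝ] ℝ} {g : E → G} (hω : CkBound k M ω)
    (hg : CkBound k N g) : CkBound k (2 ^ k * M * N) (fun x => (ω x).smulRight (g x)) := by
  refine (bilin (ContinuousLinearMap.smulRightL ℝ F G) hω hg).mono_const ?_
  have e := ContinuousLinearMap.norm_smulRightL_le (𝕜 := ℝ) (E := F) (Fₗ := G)
  have hM := hω.nonneg
  have hN := hg.nonneg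
  calc _ ≤ 2 ^ k * 1 * M * N := by gcongr
    _ = _ := by ring

theorem lipschitz {k : ℕ} {M : ℝ} {f : E → F} (h : CkBound (k + 1) M f) (x y : E) :
    ‖f x - f y‖ ≤ M * ‖x - y‖ :=
  Convex.norm_image_sub_le_of_norm_fderiv_le (𝕜 := ℝ) (fun z _ => h.differentiable z)
    (fun z _ => h.fderiv.norm_le z) convex_univ (Set.mem_univ y) (Set.mem_univ x)

/-- The sharp form of the chain rule for a composition with a map close to a translation: the
bounds on `u` are multiplied by a factor that is as close to one as the map is to the
translation. -/
theorem comp_near_translation (k : ℕ) (b : E) : ∃ C : ℝ, 0 ≤ C ∧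
    ∀ (F : Type) [NormedAddCommGroup F] [NormedSpace ℝ F] (u : E → F) (w : E → ℝ) (c : E)
      (M δ : ℝ), δ ≤ 1 → CkBound k M u → CkBound k δ w →
      CkBound k (M * (1 + C * δ)) (fun x => u (x + c + w x • b)) := by
  induction k with
  | zero =>
    refine ⟨0, le_rfl, fun F _ _ u w c M δ _ hu hw => ?_⟩
    have h1 := hu.continuous
    have h2 := hw.continuous
    exact zero_iff.2 ⟨by fun_prop, fun x => by simpa using hu.norm_le _⟩
  | succ k ih =>
    obtain ⟨C, hC, ih⟩ := ih
    refine ⟨C + 2 ^ k * (1 + C) * ‖b‖, by positivity, fun F _ _ u w c M δ hδ hu hw => ?_⟩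
    have hM := hu.nonneg
    have hδ0 := hw.nonneg
    have hle : M ≤ M * (1 + (C + 2 ^ k * (1 + C) * ‖b‖) * δ) :=
      le_mul_of_one_le_right hM (by simp only [le_add_iff_nonneg_right]; positivity)
    have hd : ∀ x, HasFDerivAt (fun x => u (x + c + w x • b))
        ((_root_.fderiv ℝ u (x + c + w x • b)).comp
          (ContinuousLinearMap.id ℝ E + (_root_.fderiv ℝ w x).smulRight b)) x := by
      intro x
      have h1 : HasFDerivAt (fun x => x + c + w x • b)
          (ContinuousLinearMap.id ℝ E + (_root_.fderiv ℝ w x).smulRight b) x :=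
        ((hasFDerivAt_id x).add_const c).add
          ((hw.differentiable x).hasFDerivAt.smul_const b)
      exact (hu.differentiable _).hasFDerivAt.comp x h1
    refine succ_iff.2 ⟨fun x => (hd x).differentiableAt, fun x => (hu.norm_le _).trans hle, ?_⟩
    have h1 := ih (E →L[ℝ] F) (_root_.fderiv ℝ u) w c M δ hδ hu.fderiv
      (hw.mono_order (Nat.le_succ k))
    have h2 := h1.apply_const b
    refine ((h1.add (hw.fderiv.smulRight h2)).mono_const ?_).congr fun x => ?_
    · calc M * (1 + C * δ) + 2 ^ k * δ * (M * (1 + C * δ) * ‖b‖)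
          ≤ M * (1 + C * δ) + 2 ^ k * δ * (M * (1 + C * 1) * ‖b‖) := by gcongr
        _ = _ := by ring
    · rw [(hd x).fderiv]
      ext v
      simp

end CkBound

/-- The directional derivative of `g` along the constant vector `v`. -/
def dirDeriv (v : E) (g : E → F) : E → F := fun x => fderiv ℝ g x v

theorem CkBound.dirDeriv {k : ℕ} {M : ℝ} {g : E → F} (h : CkBound (k + 1) M g) (v : E) :
    CkBound k (M * ‖v‖) (dirDeriv v g) := h.fderiv.apply_const v

theorem CkBound.iterate_dirDeriv {k : ℕ} {M : ℝ} {g : E → F} (v : E) (j : ℕ)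
    (h : CkBound (k + j) M g) : CkBound k (M * ‖v‖ ^ j) ((FoliationTorus.dirDeriv v)^[j] g) := by
  induction j generalizing M g with
  | zero => simpa using h
  | succ j ih =>
    rw [Function.iterate_succ_apply]
    have := ih (M := M * ‖v‖) (g := FoliationTorus.dirDeriv v g) (h.dirDeriv v)
    rwa [mul_assoc, ← pow_succ'] at this

theorem fderiv_dirDeriv {g : E → F} (v : E) (hg : ContDiff ℝ 2 g) :
    fderiv ℝ (dirDeriv v g) = dirDeriv v (fderiv ℝ g) := by
  funext x
  ext w
  have h1 : ContDiff ℝ 1 (fderiv ℝ g) := hg.fderiv_right (by norm_num)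
  have h2 := ((h1.differentiable (by norm_num)) x).hasFDerivAt
  have h3 : HasFDerivAt (dirDeriv v g)
      ((ContinuousLinearMap.apply ℝ F v).comp (fderiv ℝ (fderiv ℝ g) x)) x :=
    (ContinuousLinearMap.apply ℝ F v).hasFDerivAt.comp x h2
  rw [h3.fderiv]
  have h4 := (hg.contDiffAt (x := x)).isSymmSndFDerivAt (by simp)
  simpa [dirDeriv] using h4 w v

theorem fderiv_iterate_dirDeriv {g : E → F} (v : E) (j : ℕ) (hg : ContDiff ℝ (j + 1 : ℕ) g) :
    fderiv ℝ ((dirDeriv v)^[j] g) = (dirDeriv v)^[j] (fderiv ℝ g) := by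
  induction j generalizing g with
  | zero => rfl
  | succ j ih =>
    rw [Function.iterate_succ_apply, Function.iterate_succ_apply, ih, fderiv_dirDeriv]
    · exact hg.of_le (by exact_mod_cast (by omega : 2 ≤ j + 1 + 1))
    · exact (hg.fderiv_right (m := (j + 1 : ℕ)) (by norm_cast)).clm_apply contDiff_const

/-- The remainder of order `j` in the Taylor expansion of `t ↦ g (z + t v)` at `t = 0`, evaluated
at `z = θ x`, `t = φ x`. -/
def taylorRem (v : F) (j : ℕ) (g : F → G) (θ : E → F) (φ : E → ℝ) (x : E) : G :=
  g (θ x + φ x • v) -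
    ∑ b ∈ Finset.range j, (φ x ^ b / (b.factorial : ℝ)) • ((dirDeriv v)^[b] g) (θ x)

/-- Differentiating the weights `t^b / b!` of a Taylor polynomial shifts its coefficients. For
`j = 0` the truncated `j - 1` is harmless, both sums being empty. -/
theorem sum_deriv_taylor (w : ℕ → G) (j : ℕ) (t : ℝ) :
    ∑ b ∈ Finset.range j, ((b * t ^ (b - 1)) / (b.factorial : ℝ)) • w b =
      ∑ b ∈ Finset.range (j - 1), (t ^ b / (b.factorial : ℝ)) • w (b + 1) := by
  cases j with
  | zero => simp
  | succ j =>
    rw [Finset.sum_range_succ']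
    simp only [Nat.add_sub_cancel, Nat.cast_zero, zero_mul, zero_div, zero_smul, add_zero]
    refine Finset.sum_congr rfl fun b _ => ?_
    rw [Nat.factorial_succ]
    have : (b.factorial : ℝ) ≠ 0 := by positivity
    push_cast
    congr 1
    field_simp

theorem norm_taylorRem_le (v : F) (j : ℕ) {g : F → G} {M : ℝ} (hg : CkBound j M g) (z : F)
    (t : ℝ) :
    ‖g (z + t • v) -
      ∑ b ∈ Finset.range j, (t ^ b / (b.factorial : ℝ)) • ((dirDeriv v)^[b] g) z‖
      ≤ M * ‖v‖ ^ j * |t| ^ j := by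
  induction j generalizing g M t with
  | zero => simpa using hg.norm_le _
  | succ j ih =>
    have hM := hg.nonneg
    have hd : ∀ s : ℝ, HasDerivAt (fun s : ℝ => g (z + s • v) -
        ∑ b ∈ Finset.range (j + 1), (s ^ b / (b.factorial : ℝ)) • ((dirDeriv v)^[b] g) z)
        (dirDeriv v g (z + s • v) -
          ∑ b ∈ Finset.range j, (s ^ b / (b.factorial : ℝ)) •
            ((dirDeriv v)^[b] (dirDeriv v g)) z) s := by
      intro s
      have h0 : HasDerivAt (fun s : ℝ => ∑ b ∈ Finset.range (j + 1),
          (s ^ b / (b.factorial : ℝ)) • ((dirDeriv v)^[b] g) z)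
          (∑ b ∈ Finset.range (j + 1),
            ((b * s ^ (b - 1)) / (b.factorial : ℝ)) • ((dirDeriv v)^[b] g) z) s :=
        HasDerivAt.fun_sum fun b _ => ((hasDerivAt_pow b s).div_const _).smul_const _
      rw [sum_deriv_taylor (fun b => ((dirDeriv v)^[b] g) z)] at h0
      refine HasDerivAt.sub ?_ h0
      have h1 : HasDerivAt (fun s : ℝ => z + s • v) v s := by
        simpa using ((hasDerivAt_id s).smul_const v).const_add z
      exact (hg.differentiable _).hasFDerivAt.comp_hasDerivAt s h1
    have := Convex.norm_image_sub_le_of_norm_hasDerivWithin_le (s := Set.Icc (-|t|) |t|)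
      (C := M * ‖v‖ * ‖v‖ ^ j * |t| ^ j) (x := 0) (y := t)
      (fun s _ => (hd s).hasDerivWithinAt) (fun s hs => (ih (hg.dirDeriv v) s).trans (by
        have := abs_le.2 hs
        gcongr)) (convex_Icc _ _) (by simp) ⟨neg_abs_le t, le_abs_self t⟩
    have h0 : ∑ b ∈ Finset.range (j + 1),
        ((0 : ℝ) ^ b / (b.factorial : ℝ)) • ((dirDeriv v)^[b] g) z = g z := by
      rw [Finset.sum_range_succ']
      simp
    rw [h0, zero_smul, add_zero, sub_self, sub_zero, sub_zero, Real.norm_eq_abs] at this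
    refine this.trans (le_of_eq ?_)
    ring

/-- Composition with the perturbation `x ↦ θ x + φ x • v` of `θ`: Taylor's formula along `v` with a
remainder that is small in `C^k`. The proof uses that the derivative of the remainder of order `j`
of `g` is composed of the remainders of order `j` of `fderiv ℝ g` and of order `j - 1` of
`dirDeriv v g`. -/
theorem CkBound.taylorRem (v : F) {D : ℝ} (hD : 0 ≤ D) (k : ℕ) : ∀ j : ℕ, ∃ C : ℝ, 0 ≤ C ∧
    ∀ (G : Type) [NormedAddCommGroup G] [NormedSpace ℝ G] (g : F → G) (θ : E → F) (φ : E → ℝ)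
      (M δ : ℝ), δ ≤ 1 → CkBound (k + j) M g → Differentiable ℝ θ →
      CkBound (k - 1) D (_root_.fderiv ℝ θ) → CkBound k δ φ →
      CkBound k (C * M * δ ^ j) (FoliationTorus.taylorRem v j g θ φ) := by
  induction k with
  | zero =>
    refine fun j => ⟨‖v‖ ^ j, by positivity, fun G _ _ g θ φ M δ hδ hg hθ hθ' hφ => ?_⟩
    rw [zero_add] at hg
    have hM := hg.nonneg
    refine zero_iff.2 ⟨?_, fun x => ?_⟩
    · have h1 := hg.continuous
      have h2 := hθ.continuous
      have h3 := hφ.continuous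
      have h4 : ∀ b ∈ Finset.range j, Continuous ((FoliationTorus.dirDeriv v)^[b] g) := by
        intro b hb
        have : CkBound (0 + b) M g := hg.mono_order (by simp at hb; omega)
        exact (this.iterate_dirDeriv v b).continuous
      unfold FoliationTorus.taylorRem
      refine Continuous.sub (by fun_prop) (continuous_finsetSum _ fun b hb => ?_)
      have := h4 b hb
      fun_prop
    · refine (norm_taylorRem_le v j hg (θ x) (φ x)).trans ?_
      rw [mul_comm M]
      gcongr
      exact hφ.norm_le x
  | succ k ih =>
    intro j
    obtain ⟨C₁, hC₁, h₁⟩ := ih j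
    obtain ⟨C₂, hC₂, h₂⟩ := ih (j - 1)
    refine ⟨‖v‖ ^ j + 2 ^ k * C₁ * D + 2 ^ k * ‖v‖ * C₂, by positivity,
      fun G _ _ g θ φ M δ hδ hg hθ hθ' hφ => ?_⟩
    have hM := hg.nonneg
    have hδ0 := hφ.nonneg
    have hg1 : CkBound (k + j + 1) M g := hg.mono_order (by omega)
    have r₁ := h₁ (F →L[ℝ] G) (_root_.fderiv ℝ g) θ φ M δ hδ hg1.fderiv hθ
      (hθ'.mono_order (by omega)) (hφ.mono_order (Nat.le_succ k))
    have r₂ := h₂ G (FoliationTorus.dirDeriv v g) θ φ (M * ‖v‖) δ hδ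
      ((hg1.dirDeriv v).mono_order (by omega)) hθ
      (hθ'.mono_order (by omega)) (hφ.mono_order (Nat.le_succ k))
    have s₁ := bilin (ContinuousLinearMap.compL ℝ E F G) r₁ hθ'
    have s₂ := hφ.fderiv.smulRight r₂
    have hd : ∀ x, HasFDerivAt (FoliationTorus.taylorRem v j g θ φ)
        (ContinuousLinearMap.compL ℝ E F G
            (FoliationTorus.taylorRem v j (_root_.fderiv ℝ g) θ φ x) (_root_.fderiv ℝ θ x) +
          (_root_.fderiv ℝ φ x).smulRight
            (FoliationTorus.taylorRem v (j - 1) (FoliationTorus.dirDeriv v g) θ φ x)) x := by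
      intro x
      have hφ' := (hφ.differentiable x).hasFDerivAt
      have hw : ∀ b ∈ Finset.range j, HasFDerivAt ((FoliationTorus.dirDeriv v)^[b] g)
          (((FoliationTorus.dirDeriv v)^[b] (_root_.fderiv ℝ g)) (θ x)) (θ x) := by
        intro b hb
        have hb' : b < j := Finset.mem_range.1 hb
        have e : CkBound (1 + b) M g := hg.mono_order (by omega)
        rw [← fderiv_iterate_dirDeriv v b (e.mono_order (l := b + 1) (by omega)).1]
        exact ((e.iterate_dirDeriv v b).differentiable (k := 0) _).hasFDerivAt
      have h0 : HasFDerivAt (fun x => g (θ x + φ x • v))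
          ((_root_.fderiv ℝ g (θ x + φ x • v)).comp
            (_root_.fderiv ℝ θ x + (_root_.fderiv ℝ φ x).smulRight v)) x :=
        (hg1.differentiable _).hasFDerivAt.comp x
          ((hθ x).hasFDerivAt.add (hφ'.smul_const v))
      have h3 := h0.sub (HasFDerivAt.fun_sum fun b hb =>
        ((hφ'.pow b).mul_const ((b.factorial : ℝ)⁻¹)).smul ((hw b hb).comp x (hθ x).hasFDerivAt))
      simp only [← div_eq_mul_inv] at h3
      refine h3.congr_fderiv ?_
      ext y
      have := sum_deriv_taylor (fun b => ((FoliationTorus.dirDeriv v)^[b] g) (θ x)) j (φ x)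
      have e1 : ∀ b, (FoliationTorus.dirDeriv v)^[b] (FoliationTorus.dirDeriv v g) =
        (FoliationTorus.dirDeriv v)^[b + 1] g := fun b => rfl
      simp only [FoliationTorus.taylorRem, e1, ← this]
      have e2 : ∀ z, FoliationTorus.dirDeriv v g z = _root_.fderiv ℝ g z v := fun z => rfl
      have e3 : ∀ b : ℕ, (b.factorial : ℝ)⁻¹ * (b * φ x ^ (b - 1)) * _root_.fderiv ℝ φ x y =
        _root_.fderiv ℝ φ x y * (b * φ x ^ (b - 1) / b.factorial) := fun b => by ring
      simp only [e2]
      simp [Finset.sum_add_distrib, smul_sub, Finset.smul_sum, smul_smul, e3]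
      abel
    refine succ_iff.2 ⟨fun x => (hd x).differentiableAt, fun x => ?_, ?_⟩
    · refine (norm_taylorRem_le v j (hg.mono_order (by omega)) (θ x) (φ x)).trans ?_
      have : |φ x| ≤ δ := hφ.norm_le x
      calc M * ‖v‖ ^ j * |φ x| ^ j ≤ M * ‖v‖ ^ j * δ ^ j := by gcongr
        _ = ‖v‖ ^ j * M * δ ^ j := by ring
        _ ≤ _ := by
          gcongr
          rw [add_assoc]
          exact le_add_of_nonneg_right (by positivity)
    · refine ((s₁.add s₂).mono_const ?_).congr fun x => (hd x).fderiv
      have e₁ := ContinuousLinearMap.norm_compL_le ℝ E F G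
      have e₃ : δ * δ ^ (j - 1) ≤ δ ^ j := by
        cases j with
        | zero => simpa using hδ
        | succ j => simp [pow_succ']
      calc _ ≤ 2 ^ k * 1 * (C₁ * M * δ ^ j) * D + 2 ^ k * δ * (C₂ * (M * ‖v‖) * δ ^ (j - 1)) := by
            gcongr
        _ = 2 ^ k * (C₁ * M * δ ^ j) * D + 2 ^ k * (C₂ * (M * ‖v‖)) * (δ * δ ^ (j - 1)) := by ring
        _ ≤ 2 ^ k * (C₁ * M * δ ^ j) * D + 2 ^ k * (C₂ * (M * ‖v‖)) * δ ^ j := by gcongr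
        _ ≤ ‖v‖ ^ j * M * δ ^ j
            + (2 ^ k * (C₁ * M * δ ^ j) * D + 2 ^ k * (C₂ * (M * ‖v‖)) * δ ^ j) :=
          le_add_of_nonneg_left (by positivity)
        _ = _ := by ring

/-- The interpolation inequality bounding a first derivative by the function and its second
derivatives. -/
theorem CkBound.norm_fderiv_le {f : E → F} {M A : ℝ} (hf : CkBound 2 M f) (hA : ∀ x, ‖f x‖ ≤ A)
    {t : ℝ} (ht : 0 < t) (x : E) : ‖_root_.fderiv ℝ f x‖ ≤ 2 * A / t + M * t := by
  have hM := hf.nonneg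
  have hA0 : 0 ≤ A := (norm_nonneg _).trans (hA x)
  refine ContinuousLinearMap.opNorm_le_of_unit_norm (by positivity) fun v hv => ?_
  have h := norm_taylorRem_le v 2 hf x t
  simp only [Finset.sum_range_succ, Finset.sum_range_zero, zero_add, pow_zero, pow_one,
    Nat.factorial, Nat.cast_one, div_one, one_smul, Function.iterate_zero_apply, hv, one_pow,
    mul_one, sq_abs, Function.iterate_one, Nat.succ_eq_add_one] at h
  have e : FoliationTorus.dirDeriv v f x = _root_.fderiv ℝ f x v := rfl
  rw [e] at h
  have h1 : ‖t • _root_.fderiv ℝ f x v‖ ≤ M * t ^ 2 + 2 * A := by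
    have e2 : t • _root_.fderiv ℝ f x v =
        -(f (x + t • v) - (f x + t • _root_.fderiv ℝ f x v)) + (f (x + t • v) - f x) := by abel
    rw [e2]
    refine (norm_add_le _ _).trans (add_le_add (by rwa [norm_neg]) ?_)
    have := norm_sub_le (f (x + t • v)) (f x)
    linarith [hA (x + t • v), hA x]
  rw [norm_smul, Real.norm_eq_abs, abs_of_pos ht] at h1
  rw [show 2 * A / t + M * t = (M * t ^ 2 + 2 * A) / t by field_simp; ring, le_div_iff₀ ht]
  linarith

/-- A uniform limit of functions with uniform `C^{k+1}` bounds is of class `C^k`, with the same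
bounds. -/
theorem CkBound.of_tendstoUniformly [CompleteSpace F] (k : ℕ) {M : ℝ} {u : ℕ → E → F} {v : E → F}
    (hu : ∀ n, CkBound (k + 1) M (u n)) (hv : TendstoUniformly u v Filter.atTop) :
    CkBound k M v := by
  have hbd : ∀ x, ‖v x‖ ≤ M := fun x =>
    le_of_tendsto (hv.tendsto_at x).norm (Filter.Eventually.of_forall fun n => (hu n).norm_le x)
  induction k generalizing F with
  | zero =>
    exact zero_iff.2 ⟨hv.continuous (Filter.Frequently.of_forall fun n => (hu n).continuous), hbd⟩
  | succ k ih =>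
    have hc : UniformCauchySeqOn (fun n => _root_.fderiv ℝ (u n)) Filter.atTop Set.univ := by
      rw [Metric.uniformCauchySeqOn_iff]
      intro ε hε
      have hM := (hu 0).nonneg
      -- the interpolation inequality is applied with a small step `t` and then a small distance
      set t : ℝ := ε / (4 * (M + M + 1)) with ht
      have ht0 : 0 < t := by positivity
      have hA0 : 0 < ε * t / 8 := by positivity
      have h1 := (Metric.uniformCauchySeqOn_iff.1
        (tendstoUniformlyOn_univ.2 hv).uniformCauchySeqOn) _ hA0
      obtain ⟨N, hN⟩ := h1
      refine ⟨N, fun m hm n hn x _ => ?_⟩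
      have h2 : CkBound 2 (M + M) (fun x => u m x - u n x) :=
        ((hu m).sub (hu n)).mono_order (by omega)
      have h3 := h2.norm_fderiv_le (A := ε * t / 8)
        (fun y => by rw [← dist_eq_norm]; exact (hN m hm n hn y trivial).le) ht0 x
      have h4 : _root_.fderiv ℝ (fun x => u m x - u n x) x
          = _root_.fderiv ℝ (u m) x - _root_.fderiv ℝ (u n) x :=
        fderiv_fun_sub ((hu m).differentiable x) ((hu n).differentiable x)
      rw [dist_eq_norm, ← h4]
      refine h3.trans_lt ?_
      have h5 : 2 * (ε * t / 8) / t = ε / 4 := by field_simp; norm_num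
      have h6 : (M + M) * t ≤ ε / 4 := by
        rw [ht, mul_div_assoc', div_le_div_iff₀ (by positivity) (by norm_num)]
        nlinarith
      linarith
    have hcx : ∀ x, ∃ g, Filter.Tendsto (fun n => _root_.fderiv ℝ (u n) x) Filter.atTop (nhds g) :=
      fun x => cauchySeq_tendsto_of_complete (hc.cauchySeq (Set.mem_univ x))
    choose g hg using hcx
    have hun : TendstoUniformly (fun n => _root_.fderiv ℝ (u n)) g Filter.atTop :=
      tendstoUniformlyOn_univ.1 (hc.tendstoUniformlyOn_of_tendsto fun x _ => hg x)
    have hd : ∀ x, HasFDerivAt v (g x) x := hasFDerivAt_of_tendstoUniformly hun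
      (fun n x => ((hu n).differentiable x).hasFDerivAt) (fun x => hv.tendsto_at x)
    have hgb : ∀ x, ‖g x‖ ≤ M := fun x => le_of_tendsto (hg x).norm
      (Filter.Eventually.of_forall fun n => (hu n).fderiv.norm_le x)
    refine succ_iff.2 ⟨fun x => (hd x).differentiableAt, hbd, ?_⟩
    exact (ih (fun n => (hu n).fderiv) hun hgb).congr fun x => (hd x).fderiv

/-- A `C^k` function invariant under translations that move every point into a fixed compact set
has bounded derivatives. -/
theorem CkBound.exists_of_invariant {k : ℕ} {f : E → F} (hf : ContDiff ℝ k f) {K : Set E}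
    (hK : IsCompact K) (h : ∀ x, ∃ a, x + a ∈ K ∧ ∀ y, f (y + a) = f y) :
    ∃ M, CkBound k M f := by
  have h1 : ∀ j : ℕ, ∃ M, j ≤ k → ∀ x ∈ K, ‖iteratedFDeriv ℝ j f x‖ ≤ M := by
    intro j
    by_cases hj : j ≤ k
    · obtain ⟨M, hM⟩ := hK.exists_bound_of_continuousOn
        (hf.continuous_iteratedFDeriv (m := j) (by exact_mod_cast hj)).continuousOn
      exact ⟨M, fun _ => hM⟩
    · exact ⟨0, fun h => absurd h hj⟩
  choose M hM using h1
  refine ⟨∑ j ∈ Finset.range (k + 1), |M j|, hf, fun j hj x => ?_⟩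
  obtain ⟨a, ha, hfa⟩ := h x
  have e : iteratedFDeriv ℝ j f x = iteratedFDeriv ℝ j f (x + a) := by
    rw [← iteratedFDeriv_comp_add_right]
    simp only [hfa]
  rw [e]
  refine ((hM j hj _ ha).trans (le_abs_self _)).trans ?_
  exact Finset.single_le_sum (f := fun j => |M j|) (fun i _ => abs_nonneg _)
    (Finset.mem_range.2 (by omega))

end CkBound

/-! ### Invariant graphs over near-translations -/

theorem exists_tendstoUniformly_of_geometric {E : Type*} (f : ℕ → E → ℝ) {A q : ℝ} (hq0 : 0 ≤ q)
    (hq : q < 1) (hf : ∀ n s, |f (n + 1) s - f n s| ≤ A * q ^ n) :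
    ∃ g : E → ℝ, TendstoUniformly f g Filter.atTop := by
  have h1 : ∀ s n, dist (f n s) (f (n + 1) s) ≤ A * q ^ n := fun s n => by
    rw [dist_comm]; exact hf n s
  choose g hg using fun s => cauchySeq_tendsto_of_complete (cauchySeq_of_le_geometric q A hq (h1 s))
  refine ⟨g, ?_⟩
  rw [Metric.tendstoUniformly_iff]
  intro ε hε
  have h2 : Filter.Tendsto (fun n => A * q ^ n / (1 - q)) Filter.atTop (nhds 0) := by
    simpa using ((tendsto_pow_atTop_nhds_zero_of_lt_one hq0 hq).const_mul A).div_const (1 - q)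
  filter_upwards [h2.eventually_lt_const hε] with n hn s
  rw [dist_comm]
  exact (dist_le_of_le_geometric_of_tendsto q A hq (h1 s) (hg s) n).trans_lt hn

section Graph

variable {E : Type} [NormedAddCommGroup E] [NormedSpace ℝ E]

/-- One step of the graph transform for the pair `(u, t)`, where `u` is the height of the graph
and `t` the (rescaled) displacement along the foliation. -/
def graphStep (c b : E) (γ g μ : ℝ) (R : E → ℝ → ℝ → ℝ) (x : (E → ℝ) × (E → ℝ)) :
    (E → ℝ) × (E → ℝ) :=
  (fun s => (1 + μ * (g * γ))⁻¹ *
      (x.1 (s + c + (μ * x.2 s) • b) - (μ * g) * R s (x.1 s) (x.2 s)),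
    fun s => γ * x.1 s + R s (x.1 s) (x.2 s))

/-- The graph transform at an expanding zero of a slow normal motion. The height `u` of the graph
and the displacement `t` solve `u (s + c + μ t b) = u + μ g t`, `t = γ u + R (s, u, t)`, where
`g * γ > 0` is the normal expansion rate in units of `μ`. The solution is found in a ball of
`C^{ℓ+1}` whose radius `ρ` does not depend on `μ`, by an iteration contracting the `C^0` norm. -/
theorem exists_invariant_graph (ℓ : ℕ) (b : E) : ∃ C : ℝ, 0 ≤ C ∧
    ∀ (c : E) (γ g ρ κ μ : ℝ) (R : E → ℝ → ℝ → ℝ), 0 < μ → 0 < ρ → 0 ≤ κ →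
      μ * ((|γ| + 1) * ρ) ≤ 1 → κ * (1 + 2 * (|γ| + 1)) ≤ 1 → 0 < g * γ →
      C * (|γ| + 1) * ρ + |g| * κ ≤ g * γ →
      2 * (|γ| + 1) * ‖b‖ * ρ + |g| * κ * (1 + 2 * (|γ| + 1)) < g * γ →
      (∀ u t : E → ℝ, CkBound (ℓ + 1) ρ u → CkBound (ℓ + 1) ((|γ| + 1) * ρ) t →
        CkBound (ℓ + 1) (κ * ρ) (fun s => R s (u s) (t s))) →
      (∀ s a a' e e', |a| ≤ ρ → |a'| ≤ ρ → |e| ≤ (|γ| + 1) * ρ → |e'| ≤ (|γ| + 1) * ρ →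
        |R s a e - R s a' e'| ≤ κ * (|a - a'| + |e - e'|)) →
      ∃ u t : E → ℝ, CkBound ℓ ρ u ∧ CkBound ℓ ((|γ| + 1) * ρ) t ∧
        (∀ z, (∀ s a e, R (s + z) a e = R s a e) →
          ∀ s, u (s + z) = u s ∧ t (s + z) = t s) ∧
        (∀ s, t s = γ * u s + R s (u s) (t s)) ∧
        ∀ s, u (s + c + (μ * t s) • b) = u s + μ * g * t s := by
  obtain ⟨C, hC, hcomp⟩ := CkBound.comp_near_translation (ℓ + 1) b
  refine ⟨C, hC, fun c γ g ρ κ μ R hμ hρ hκ hμρ hκ1 hgγ hs1 hs2 hR hL => ?_⟩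
  set M : ℝ := |γ| + 1 with hM
  have hM1 : 1 ≤ M := by rw [hM]; linarith [abs_nonneg γ]
  set lam : ℝ := g * γ with hlam
  have hden : 0 < 1 + μ * lam := by positivity
  have hκle : κ ≤ 1 := by nlinarith
  set Γ := graphStep c b γ g μ R with hΓ
  -- the graph transform preserves the ball: `hs1` says that the expansion beats both the distortion
  -- by the composition and the perturbation
  have hball : ∀ x : (E → ℝ) × (E → ℝ), CkBound (ℓ + 1) ρ x.1 ∧ CkBound (ℓ + 1) (M * ρ) x.2 →
      CkBound (ℓ + 1) ρ (Γ x).1 ∧ CkBound (ℓ + 1) (M * ρ) (Γ x).2 := by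
    rintro ⟨u, t⟩ ⟨hu, ht⟩
    have h0 := hR u t hu ht
    have h1 : CkBound (ℓ + 1) (μ * (M * ρ)) (fun s => μ * t s) := by
      simpa [abs_of_pos hμ] using ht.const_mul μ
    have h2 := hcomp ℝ u _ c ρ _ hμρ hu h1
    constructor
    · have h3 := ((h2.sub (h0.const_mul (μ * g))).const_mul (1 + μ * lam)⁻¹)
      refine h3.mono_const ?_
      rw [abs_of_pos (inv_pos.2 hden), inv_mul_le_iff₀ hden, abs_mul, abs_of_pos hμ]
      have := mul_le_mul_of_nonneg_left hs1 (by positivity : 0 ≤ μ * ρ)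
      linarith
    · refine ((hu.const_mul γ).add h0).mono_const ?_
      rw [hM]
      nlinarith
  -- contraction rate in the norm `max (|u|, |t| / (2 M))`, whose weight absorbs the
  -- term `γ u` of `t`
  set q : ℝ := max (1 / 2)
    ((1 + μ * (2 * M * ‖b‖ * ρ + |g| * κ * (1 + 2 * M))) / (1 + μ * lam)) with hq
  have hq0 : 0 ≤ q := le_max_of_le_left (by norm_num)
  have hq1 : q < 1 := by
    refine max_lt (by norm_num) ((div_lt_one hden).2 ?_)
    nlinarith
  have hcontr : ∀ x y : (E → ℝ) × (E → ℝ),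
      CkBound (ℓ + 1) ρ x.1 ∧ CkBound (ℓ + 1) (M * ρ) x.2 →
      CkBound (ℓ + 1) ρ y.1 ∧ CkBound (ℓ + 1) (M * ρ) y.2 → ∀ N,
      (∀ s, |x.1 s - y.1 s| ≤ N ∧ |x.2 s - y.2 s| ≤ 2 * M * N) →
      ∀ s, |(Γ x).1 s - (Γ y).1 s| ≤ q * N ∧ |(Γ x).2 s - (Γ y).2 s| ≤ 2 * M * (q * N) := by
    rintro ⟨u, t⟩ ⟨u', t'⟩ ⟨hu, ht⟩ ⟨hu', ht'⟩ N hN s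
    have hN0 : 0 ≤ N := (abs_nonneg _).trans (hN s).1
    have hu0 := (hN s).1
    have ht0 := (hN s).2
    simp only at hu ht hu' ht' hu0 ht0
    have hRl : |R s (u s) (t s) - R s (u' s) (t' s)| ≤ κ * (N + 2 * M * N) :=
      (hL s _ _ _ _ (hu.norm_le s) (hu'.norm_le s) (ht.norm_le s) (ht'.norm_le s)).trans (by
        gcongr)
    constructor
    · have h1 : |u (s + c + (μ * t s) • b) - u' (s + c + (μ * t' s) • b)|
          ≤ ρ * (μ * (2 * M * N) * ‖b‖) + N := by
        have e1 := hu.lipschitz (s + c + (μ * t s) • b) (s + c + (μ * t' s) • b)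
        have e2 := (hN (s + c + (μ * t' s) • b)).1
        have e3 : s + c + (μ * t s) • b - (s + c + (μ * t' s) • b)
            = (μ * (t s - t' s)) • b := by
          rw [add_sub_add_left_eq_sub, ← sub_smul, mul_sub]
        rw [e3, norm_smul, Real.norm_eq_abs, Real.norm_eq_abs, abs_mul, abs_of_pos hμ] at e1
        refine (abs_sub_le _ (u (s + c + (μ * t' s) • b)) _).trans (add_le_add (e1.trans ?_) e2)
        gcongr
      have h2 : (Γ (u, t)).1 s - (Γ (u', t')).1 s = (1 + μ * lam)⁻¹ *
          ((u (s + c + (μ * t s) • b) - u' (s + c + (μ * t' s) • b)) -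
            (μ * g) * (R s (u s) (t s) - R s (u' s) (t' s))) := by
        simp only [hΓ, graphStep, hlam]; ring
      rw [h2, abs_mul, abs_of_pos (inv_pos.2 hden)]
      have h3 : |(u (s + c + (μ * t s) • b) - u' (s + c + (μ * t' s) • b)) -
            (μ * g) * (R s (u s) (t s) - R s (u' s) (t' s))|
          ≤ (1 + μ * (2 * M * ‖b‖ * ρ + |g| * κ * (1 + 2 * M))) * N := by
        refine (abs_sub _ _).trans ?_
        rw [abs_mul, abs_mul, abs_of_pos hμ]
        have := mul_le_mul_of_nonneg_left hRl (by positivity : 0 ≤ μ * |g|)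
        linarith
      calc _ ≤ (1 + μ * lam)⁻¹ *
            ((1 + μ * (2 * M * ‖b‖ * ρ + |g| * κ * (1 + 2 * M))) * N) := by gcongr
        _ = ((1 + μ * (2 * M * ‖b‖ * ρ + |g| * κ * (1 + 2 * M))) / (1 + μ * lam)) * N := by
          rw [div_eq_inv_mul]; ring
        _ ≤ q * N := by gcongr; exact le_max_right _ _
    · have h2 : (Γ (u, t)).2 s - (Γ (u', t')).2 s =
          γ * (u s - u' s) + (R s (u s) (t s) - R s (u' s) (t' s)) := by
        simp only [hΓ, graphStep]; ring
      rw [h2]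
      refine (abs_add_le _ _).trans ?_
      rw [abs_mul]
      have hq2 : 1 / 2 ≤ q := le_max_left _ _
      have e1 : |γ| * |u s - u' s| ≤ |γ| * N := by gcongr
      have e2 : κ * (1 + 2 * M) * N ≤ 1 * N := by gcongr
      have e3 : 2 * M * (1 / 2 * N) ≤ 2 * M * (q * N) := by gcongr
      have e4 : M * N = |γ| * N + N := by rw [hM]; ring
      linarith
  -- the iterates of the graph transform, starting from zero
  let x : ℕ → (E → ℝ) × (E → ℝ) := fun n => Γ^[n] (fun _ => 0, fun _ => 0)
  have hx1 : ∀ n, x (n + 1) = Γ (x n) := fun n => Function.iterate_succ_apply' _ _ _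
  have hxb : ∀ n, CkBound (ℓ + 1) ρ (x n).1 ∧ CkBound (ℓ + 1) (M * ρ) (x n).2 := by
    intro n
    induction n with
    | zero =>
      exact ⟨(CkBound.zero (E := E) (F := ℝ) (ℓ + 1)).mono_const hρ.le,
        (CkBound.zero (E := E) (F := ℝ) (ℓ + 1)).mono_const (by positivity)⟩
    | succ n ih => rw [hx1]; exact hball _ ih
  have hxd : ∀ n s, |(x (n + 1)).1 s - (x n).1 s| ≤ q ^ n * ρ ∧
      |(x (n + 1)).2 s - (x n).2 s| ≤ 2 * M * (q ^ n * ρ) := by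
    intro n
    induction n with
    | zero =>
      intro s
      have e1 := (hxb 1).1.norm_le s
      have e2 := (hxb 1).2.norm_le s
      have e3 : (x 0).1 s = 0 := rfl
      have e4 : (x 0).2 s = 0 := rfl
      rw [Real.norm_eq_abs] at e1 e2
      have e5 : 0 ≤ M * ρ := by positivity
      rw [zero_add, e3, e4, pow_zero, one_mul, sub_zero, sub_zero]
      exact ⟨e1, by linarith⟩
    | succ n ih =>
      intro s
      have := hcontr _ _ (hxb (n + 1)) (hxb n) _ ih s
      rw [← hx1, ← hx1] at this
      rw [pow_succ', mul_assoc]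
      exact this
  obtain ⟨u, hu⟩ := exists_tendstoUniformly_of_geometric (fun n => (x n).1) (A := ρ) hq0 hq1
    fun n s => by rw [mul_comm]; exact (hxd n s).1
  obtain ⟨t, ht⟩ := exists_tendstoUniformly_of_geometric (fun n => (x n).2) (A := 2 * M * ρ) hq0
    hq1 fun n s => by
      have := (hxd n s).2
      rwa [mul_comm (q ^ n), ← mul_assoc] at this
  have hub : CkBound ℓ ρ u := CkBound.of_tendstoUniformly ℓ (fun n => (hxb n).1) hu
  have htb : CkBound ℓ (M * ρ) t := CkBound.of_tendstoUniformly ℓ (fun n => (hxb n).2) ht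
  have hRlim : ∀ s, Filter.Tendsto (fun n => R s ((x n).1 s) ((x n).2 s)) Filter.atTop
      (nhds (R s (u s) (t s))) := by
    intro s
    rw [tendsto_iff_dist_tendsto_zero]
    have h1 : Filter.Tendsto (fun n => κ * (|(x n).1 s - u s| + |(x n).2 s - t s|))
        Filter.atTop (nhds 0) := by
      have e1 := ((hu.tendsto_at s).sub_const (u s)).abs
      have e2 := ((ht.tendsto_at s).sub_const (t s)).abs
      simpa using (e1.add e2).const_mul κ
    refine squeeze_zero (fun _ => dist_nonneg) (fun n => ?_) h1
    exact hL s _ _ _ _ ((hxb n).1.norm_le s) (hub.norm_le s) ((hxb n).2.norm_le s) (htb.norm_le s)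
  have hulim : ∀ s, Filter.Tendsto (fun n => (x n).1 (s + c + (μ * (x n).2 s) • b)) Filter.atTop
      (nhds (u (s + c + (μ * t s) • b))) := by
    intro s
    have e1 : Filter.Tendsto (fun n => s + c + (μ * (x n).2 s) • b) Filter.atTop
        (nhds (s + c + (μ * t s) • b)) :=
      (((ht.tendsto_at s).const_mul μ).smul_const b).const_add _
    exact hu.tendsto_comp hub.continuous.continuousAt e1
  refine ⟨u, t, hub, htb, fun z hz => ?_, fun s => ?_, fun s => ?_⟩
  · have hper : ∀ n s, (x n).1 (s + z) = (x n).1 s ∧ (x n).2 (s + z) = (x n).2 s := by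
      intro n
      induction n with
      | zero => exact fun s => ⟨rfl, rfl⟩
      | succ n ih =>
        intro s
        rw [hx1]
        simp only [hΓ, graphStep]
        rw [(ih s).1, (ih s).2, hz, show s + z + c + (μ * (x n).2 s) • b =
          s + c + (μ * (x n).2 s) • b + z by abel, (ih _).1]
        exact ⟨rfl, rfl⟩
    exact fun s => ⟨tendsto_nhds_unique (hu.tendsto_at (s + z))
      (by simpa only [(hper _ s).1] using hu.tendsto_at s),
      tendsto_nhds_unique (ht.tendsto_at (s + z))
      (by simpa only [(hper _ s).2] using ht.tendsto_at s)⟩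
  · refine tendsto_nhds_unique ((ht.tendsto_at s).comp (Filter.tendsto_add_atTop_nat 1))
      ((((hu.tendsto_at s).const_mul γ).add (hRlim s)).congr fun n => ?_)
    simp only [Function.comp_apply, hx1]
    rfl
  · have h2 : t s = γ * u s + R s (u s) (t s) :=
      tendsto_nhds_unique ((ht.tendsto_at s).comp (Filter.tendsto_add_atTop_nat 1))
        ((((hu.tendsto_at s).const_mul γ).add (hRlim s)).congr fun n => by
          simp only [Function.comp_apply, hx1]
          rfl)
    have h1 : u s = (1 + μ * lam)⁻¹ * (u (s + c + (μ * t s) • b) - (μ * g) * R s (u s) (t s)) :=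
      tendsto_nhds_unique ((hu.tendsto_at s).comp (Filter.tendsto_add_atTop_nat 1))
        ((((hulim s).sub ((hRlim s).const_mul (μ * g))).const_mul (1 + μ * lam)⁻¹).congr
          fun n => by
            simp only [Function.comp_apply, hx1]
            rfl)
    have h3 : (1 + μ * lam) * u s = u (s + c + (μ * t s) • b) - (μ * g) * R s (u s) (t s) := by
      rw [h1, ← mul_assoc, mul_inv_cancel₀ hden.ne', one_mul, ← h1]
    have h4 : μ * g * t s = μ * g * (γ * u s + R s (u s) (t s)) := by rw [← h2]
    rw [h4, hlam] at *
    linarith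

end Graph

/-! ### Fourier series on the torus -/

/-- `f` is `ℤ^d`-periodic. -/
def IsPeriodic {d : ℕ} {F : Type*} (f : (Fin d → ℝ) → F) : Prop :=
  ∀ (x : Fin d → ℝ) (m : Fin d → ℤ), f (fun i => x i + (m i : ℝ)) = f x

theorem norm_intCast {d : ℕ} (k : Fin d → ℤ) : ‖fun i => (k i : ℝ)‖ = ‖k‖ := by
  rw [Pi.norm_def, Pi.norm_def]
  congr 1

theorem norm_character {d : ℕ} (k : Fin d → ℤ) (y : Fin d → ℝ) : ‖character k y‖ = 1 := by
  rw [character, ← Complex.norm_exp_ofReal_mul_I (2 * Real.pi * ∑ i, (k i : ℝ) * y i)]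
  congr 2
  push_cast
  ring

theorem character_add {d : ℕ} (k : Fin d → ℤ) (x y : Fin d → ℝ) :
    character k (x + y) = character k x * character k y := by
  rw [character, character, character, ← Complex.exp_add]
  congr 1
  simp only [Pi.add_apply, mul_add, Finset.sum_add_distrib, Complex.ofReal_add]

theorem character_intCast {d : ℕ} (k m : Fin d → ℤ) :
    character k (fun i => (m i : ℝ)) = 1 := by
  rw [character, Complex.exp_eq_one_iff]
  refine ⟨∑ i, k i * m i, ?_⟩
  push_cast
  ring

theorem isPeriodic_character {d : ℕ} (k : Fin d → ℤ) : IsPeriodic (character k) := by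
  intro x m
  have := character_add k x (fun i => (m i : ℝ))
  rw [character_intCast, mul_one] at this
  exact this

theorem mFourier_eq_character {d : ℕ} (k : Fin d → ℤ) (y : Fin d → ℝ) :
    UnitAddTorus.mFourier k (fun i => (y i : UnitAddCircle)) = character k y := by
  simp only [UnitAddTorus.mFourier, ContinuousMap.coe_mk, fourier_coe_apply, character]
  rw [← Complex.exp_sum]
  congr 1
  push_cast
  rw [Finset.mul_sum]
  refine Finset.sum_congr rfl fun i _ => ?_
  simp
  ring

/-- The exponential of an imaginary linear form has derivatives bounded by the powers of the norm
of the linear form. -/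
theorem norm_iteratedFDeriv_exp_le {E : Type*} [NormedAddCommGroup E] [NormedSpace ℝ E]
    (l : E →L[ℝ] ℝ) (j : ℕ) (x : E) :
    ‖iteratedFDeriv ℝ j (fun x => Complex.exp (Complex.I * (l x : ℂ))) x‖ ≤ ‖l‖ ^ j := by
  have hs : ContDiff ℝ ⊤ (fun x => Complex.exp (Complex.I * (l x : ℂ))) := by
    have h1 : ContDiff ℝ ⊤ (fun x => (l x : ℂ)) := Complex.ofRealCLM.contDiff.comp l.contDiff
    exact Complex.contDiff_exp.comp (contDiff_const.mul h1)
  induction j generalizing x with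
  | zero => simp [Complex.norm_exp]
  | succ j ih =>
    set L : ℂ →L[ℝ] E →L[ℝ] ℂ := (ContinuousLinearMap.smulRightL ℝ E ℂ l).comp
      (ContinuousLinearMap.mul ℝ ℂ Complex.I) with hL
    have hd : fderiv ℝ (fun x => Complex.exp (Complex.I * (l x : ℂ))) =
        fun x => L (Complex.exp (Complex.I * (l x : ℂ))) := by
      funext x
      have h1 : HasFDerivAt (fun x => (l x : ℂ)) (Complex.ofRealCLM.comp l) x :=
        Complex.ofRealCLM.hasFDerivAt.comp x l.hasFDerivAt
      have h2 := ((h1.const_mul Complex.I).cexp).fderiv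
      rw [h2]
      ext v
      simp [hL]
      ring
    have hLn : ‖L‖ ≤ ‖l‖ := by
      refine ContinuousLinearMap.opNorm_le_bound _ (norm_nonneg _) fun z => ?_
      refine ContinuousLinearMap.opNorm_le_bound _ (by positivity) fun v => ?_
      have : L z v = l v • (Complex.I * z) := by simp [hL]
      rw [this, norm_smul, norm_mul, Complex.norm_I, one_mul]
      calc _ ≤ ‖l‖ * ‖v‖ * ‖z‖ := by gcongr; exact l.le_opNorm v
        _ = _ := by ring
    rw [← norm_iteratedFDeriv_fderiv, hd]
    refine (L.norm_iteratedFDeriv_comp_left (n := j) (hs.of_le le_top).contDiffAt le_rfl).trans ?_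
    rw [pow_succ']
    exact mul_le_mul hLn (ih x) (norm_nonneg _) (norm_nonneg _)

/-- The sum `∑ ‖k‖^a` over `ℤ^d` converges for `a < -d`. -/
theorem summable_norm_rpow_int {d : ℕ} {a : ℝ} (ha : a < -(d : ℝ)) :
    Summable fun k : Fin d → ℤ => ‖k‖ ^ a := by
  set b := Pi.basisFun ℝ (Fin d) with hb
  set L : Submodule ℤ (Fin d → ℝ) := Submodule.span ℤ (Set.range b) with hL
  have hr : Module.finrank ℤ L = d := by
    rw [ZLattice.rank ℝ L]; simp
  have h := ZLattice.summable_norm_rpow L a (by rw [hr]; exact ha)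
  have hmem : ∀ k : Fin d → ℤ, (fun i => (k i : ℝ)) ∈ L := by
    intro k
    have : (fun i => (k i : ℝ)) = ∑ i, k i • b i := by
      funext j
      simp [hb, Finset.sum_apply, Pi.single_apply]
    rw [this]
    exact Submodule.sum_mem _ fun i _ => Submodule.smul_mem _ _
      (Submodule.subset_span ⟨i, rfl⟩)
  have hinj : Function.Injective (fun k : Fin d → ℤ => (⟨_, hmem k⟩ : L)) := by
    intro k k' hk
    have := congrArg Subtype.val hk
    funext i
    exact Int.cast_injective (congrFun this i)
  refine (h.comp_injective hinj).congr fun k => ?_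
  simp only [Function.comp_apply, ← norm_intCast k]
  rfl

/-- The Fourier coefficients of a `ℤ^d`-periodic function. -/
def boxCoeff {d : ℕ} (f : (Fin d → ℝ) → ℂ) (k : Fin d → ℤ) : ℂ :=
  ∫ y in Set.Icc (0 : Fin d → ℝ) 1, f y * character (-k) y

theorem continuous_character {d : ℕ} (k : Fin d → ℤ) : Continuous (character k) := by
  unfold character
  fun_prop

/-- A periodic function descends to the torus, where its Fourier coefficients in the sense of
Mathlib are the integrals over the unit box. -/
theorem IsPeriodic.exists_torus_function {d : ℕ} {f : (Fin d → ℝ) → ℂ} (hf : IsPeriodic f)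
    (hc : Continuous f) :
    ∃ F : C(UnitAddTorus (Fin d), ℂ), (∀ y : Fin d → ℝ, F (fun i => (y i : UnitAddCircle)) = f y) ∧
      ∀ k, UnitAddTorus.mFourierCoeff F k = boxCoeff f k := by
  have hq : IsOpenQuotientMap (Pi.map fun (_ : Fin d) (x : ℝ) => (x : UnitAddCircle)) :=
    IsOpenQuotientMap.piMap fun _ => QuotientAddGroup.isOpenQuotientMap_mk
  have hlift : ∀ a b : Fin d → ℝ, (Pi.map fun (_ : Fin d) (x : ℝ) => (x : UnitAddCircle)) a =
      (Pi.map fun (_ : Fin d) (x : ℝ) => (x : UnitAddCircle)) b → f a = f b := by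
    intro a b hab
    have h1 : ∀ i, ∃ m : ℤ, a i = b i + m := by
      intro i
      have h2 : ((a i : ℝ) : UnitAddCircle) = ((b i : ℝ) : UnitAddCircle) := congrFun hab i
      have h3 : ((a i - b i : ℝ) : UnitAddCircle) = 0 := by
        rw [AddCircle.coe_sub, h2, sub_self]
      obtain ⟨n, hn⟩ := (AddCircle.coe_eq_zero_iff (1 : ℝ)).1 h3
      refine ⟨n, ?_⟩
      rw [zsmul_eq_mul, mul_one] at hn
      linarith
    choose m hm using h1
    rw [← hf b m]
    congr 1
    funext i
    exact hm i
  let π : C(Fin d → ℝ, UnitAddTorus (Fin d)) := ⟨_, hq.continuous⟩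
  have hπ : Topology.IsQuotientMap π := hq.isQuotientMap
  have hy : ∀ y : Fin d → ℝ, hπ.lift ⟨f, hc⟩ hlift (fun i => (y i : UnitAddCircle)) = f y :=
    fun y => congrArg (fun g : C(Fin d → ℝ, ℂ) => g y) (hπ.lift_comp ⟨f, hc⟩ hlift)
  refine ⟨hπ.lift ⟨f, hc⟩ hlift, hy, fun k => ?_⟩
  rw [UnitAddTorus.mFourierCoeff_eq_integral _ k 0, boxCoeff]
  have h1 : {x : Fin d → ℝ | ∀ i, x i ∈ Set.Ioc ((0 : Fin d → ℝ) i) ((0 : Fin d → ℝ) i + 1)} =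
      Set.univ.pi fun i => Set.Ioc ((0 : Fin d → ℝ) i) ((1 : Fin d → ℝ) i) := by
    ext x; simp
  rw [h1, MeasureTheory.volume_pi,
    MeasureTheory.setIntegral_congr_set MeasureTheory.Measure.univ_pi_Ioc_ae_eq_Icc]
  simp only [mFourier_eq_character, hy, smul_eq_mul, mul_comm]

section

attribute [local instance] instMeasureSpaceUnitAddCircle instIsProbabilityMeasureUnitAddCircleVolume

/-- Bessel's inequality. -/
theorem IsPeriodic.summable_sq_boxCoeff {d : ℕ} {f : (Fin d → ℝ) → ℂ} (hf : IsPeriodic f)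
    (hc : Continuous f) : Summable fun k => ‖boxCoeff f k‖ ^ 2 := by
  obtain ⟨F, -, hF⟩ := hf.exists_torus_function hc
  have := (UnitAddTorus.hasSum_sq_mFourierCoeff (ContinuousMap.toLp 2 _ ℂ F)).summable
  simpa only [UnitAddTorus.mFourierCoeff_toLp, hF] using this

end

theorem IsPeriodic.hasSum_boxCoeff {d : ℕ} {f : (Fin d → ℝ) → ℂ} (hf : IsPeriodic f)
    (hc : Continuous f) (hs : Summable (boxCoeff f)) (y : Fin d → ℝ) :
    HasSum (fun k => boxCoeff f k * character k y) (f y) := by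
  obtain ⟨F, hFy, hF⟩ := hf.exists_torus_function hc
  have h0 : UnitAddTorus.mFourierCoeff F = boxCoeff f := funext hF
  have h1 := UnitAddTorus.hasSum_mFourier_series_apply_of_summable (f := F) (by rwa [h0])
    (fun i => (y i : UnitAddCircle))
  simpa only [hF, hFy, mFourier_eq_character, smul_eq_mul] using h1

/-- The integral of a derivative over the unit box vanishes, by the divergence theorem: the faces
cancel in pairs. -/
theorem IsPeriodic.integral_fderiv {r : ℕ} {G : (Fin (r + 1) → ℝ) → ℂ} (hG : IsPeriodic G)
    (hc : ContDiff ℝ 1 G) (i : Fin (r + 1)) :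
    ∫ y in Set.Icc (0 : Fin (r + 1) → ℝ) 1, fderiv ℝ G y (Pi.single i 1) = 0 := by
  have hd := hc.differentiable (by norm_num)
  have h := MeasureTheory.integral_divergence_of_hasFDerivAt_off_countable'
    (0 : Fin (r + 1) → ℝ) 1 zero_le_one (fun j y => if j = i then G y else 0)
    (fun j y => if j = i then fderiv ℝ G y else 0) ∅ Set.countable_empty
    (fun j => by
      by_cases hj : j = i
      · simp only [hj, if_true]; exact hc.continuous.continuousOn
      · simp only [hj, if_false]; exact continuousOn_const)
    (fun y _ j => by
      by_cases hj : j = i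
      · simp only [hj, if_true]; exact (hd y).hasFDerivAt
      · simp only [hj, if_false]; exact hasFDerivAt_const _ _)
    (by
      have : Continuous fun y => fderiv ℝ G y (Pi.single i 1) :=
        (hc.continuous_fderiv (by norm_num)).clm_apply continuous_const
      refine (this.continuousOn.integrableOn_compact isCompact_Icc).congr_fun (fun y _ => ?_)
        measurableSet_Icc
      rw [Finset.sum_eq_single i (fun j _ hj => by simp [hj]) (by simp)]
      simp)
  have e : ∀ y : Fin (r + 1) → ℝ, ∑ j, (if j = i then fderiv ℝ G y else 0)
      (Pi.single j (1 : ℝ)) = fderiv ℝ G y (Pi.single i 1) := by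
    intro y
    rw [Finset.sum_eq_single i (fun j _ hj => by simp [hj]) (by simp)]
    simp
  simp only [e] at h
  rw [h]
  refine Finset.sum_eq_zero fun j _ => ?_
  by_cases hj : j = i
  · subst hj
    simp only [if_true, Pi.zero_apply, Pi.one_apply]
    rw [sub_eq_zero]
    refine MeasureTheory.setIntegral_congr_fun measurableSet_Icc fun x _ => ?_
    rw [← hG (j.insertNth 0 x) (Pi.single j 1)]
    congr 1
    funext a
    refine Fin.succAboveCases j ?_ (fun b => ?_) a <;> simp
  · simp [hj]

/-- Integration by parts: differentiation multiplies Fourier coefficients by the frequency. -/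
theorem IsPeriodic.boxCoeff_fderiv {r : ℕ} {f : (Fin (r + 1) → ℝ) → ℂ} (hf : IsPeriodic f)
    (hc : ContDiff ℝ 1 f) (i : Fin (r + 1)) (k : Fin (r + 1) → ℤ) :
    boxCoeff (fun x => fderiv ℝ f x (Pi.single i 1)) k =
      2 * Real.pi * Complex.I * k i * boxCoeff f k := by
  have hd := hc.differentiable (by norm_num)
  have hχ : ContDiff ℝ 1 (character (-k)) := by
    have h0 : ContDiff ℝ 1 fun y : Fin (r + 1) → ℝ => ∑ j, (((-k) j : ℤ) : ℝ) * y j :=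
      ContDiff.sum fun j _ => contDiff_const.mul (contDiff_apply ℝ ℝ j)
    have h1 := Complex.ofRealCLM.contDiff.comp h0
    exact (contDiff_const.mul h1).cexp
  have hχd : ∀ y, fderiv ℝ (character (-k)) y (Pi.single i 1) =
      -(2 * Real.pi * Complex.I * k i) * character (-k) y := by
    intro y
    have h1 : HasDerivAt (fun t : ℝ => character (-k) (y + t • Pi.single i 1))
        (fderiv ℝ (character (-k)) y (Pi.single i 1)) 0 := by
      have h2 : HasDerivAt (fun t : ℝ => y + t • (Pi.single i 1 : Fin (r + 1) → ℝ))
          (Pi.single i 1) 0 := by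
        simpa using ((hasDerivAt_id (0 : ℝ)).smul_const (Pi.single i 1)).const_add y
      have h3 := (hχ.differentiable (by norm_num) (y + (0 : ℝ) • Pi.single i 1)).hasFDerivAt
      have h4 := h3.comp_hasDerivAt 0 h2
      rw [zero_smul, add_zero] at h4
      exact h4
    have h5 : HasDerivAt (fun t : ℝ => character (-k) (y + t • Pi.single i 1))
        (-(2 * Real.pi * Complex.I * k i) * character (-k) y) 0 := by
      have h6 : (fun t : ℝ => character (-k) (y + t • Pi.single i 1)) =
          fun t : ℝ => character (-k) y * Complex.exp (-(2 * Real.pi * Complex.I * k i) * t) := by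
        funext t
        rw [character_add]
        congr 1
        rw [character]
        congr 1
        rw [Finset.sum_eq_single i (fun j _ hj => by simp [hj]) (by simp)]
        simp
        ring
      rw [h6]
      have h7 : HasDerivAt (fun t : ℝ => -(2 * Real.pi * Complex.I * k i) * (t : ℂ))
          (-(2 * Real.pi * Complex.I * k i)) 0 := by
        simpa using (Complex.ofRealCLM.hasDerivAt (x := (0 : ℝ))).const_mul
          (-(2 * Real.pi * Complex.I * k i))
      have h8 := h7.cexp.const_mul (character (-k) y)
      simpa [mul_comm] using h8
    exact h1.unique h5
  have hper : IsPeriodic fun y => f y * character (-k) y := fun x m => by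
    simp only [hf x m, isPeriodic_character (-k) x m]
  have h0 := hper.integral_fderiv (hc.mul hχ) i
  have hfd : ∀ y, fderiv ℝ (fun y => f y * character (-k) y) y (Pi.single i 1) =
      fderiv ℝ f y (Pi.single i 1) * character (-k) y -
        2 * Real.pi * Complex.I * k i * (f y * character (-k) y) := by
    intro y
    have h1 := ((hd y).hasFDerivAt.mul (hχ.differentiable (by norm_num) y).hasFDerivAt).fderiv
    have h2 : fderiv ℝ (fun y => f y * character (-k) y) y = _ := h1
    rw [h2]
    simp [hχd]
    ring
  simp only [hfd] at h0
  have hcf : Continuous fun y => fderiv ℝ f y (Pi.single i 1) :=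
    (hc.continuous_fderiv (by norm_num)).clm_apply continuous_const
  rw [MeasureTheory.integral_sub, MeasureTheory.integral_const_mul, sub_eq_zero] at h0
  · exact h0
  · exact ((hcf.mul (continuous_character _)).continuousOn).integrableOn_compact isCompact_Icc
  · exact ((continuous_const.mul
      (hc.continuous.mul (continuous_character _))).continuousOn).integrableOn_compact isCompact_Icc

theorem isPeriodic_dirDeriv {d : ℕ} {F : Type} [NormedAddCommGroup F] [NormedSpace ℝ F]
    {f : (Fin d → ℝ) → F} (hf : IsPeriodic f) (v : Fin d → ℝ) : IsPeriodic (dirDeriv v f) := by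
  intro x m
  have h : (fun y => f (y + fun i => (m i : ℝ))) = f := funext fun y => hf y m
  have h2 := fderiv_comp_add_right (𝕜 := ℝ) (f := f) (x := x) (fun i => (m i : ℝ))
  rw [h] at h2
  rw [dirDeriv, dirDeriv, h2]
  rfl

theorem contDiff_dirDeriv {E F : Type} [NormedAddCommGroup E] [NormedSpace ℝ E]
    [NormedAddCommGroup F] [NormedSpace ℝ F] {f : E → F} {s : ℕ} (hf : ContDiff ℝ (s + 1 : ℕ) f)
    (v : E) : ContDiff ℝ s (dirDeriv v f) :=
  (hf.fderiv_right (m := (s : WithTop ℕ∞)) (by norm_cast)).clm_apply contDiff_const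

theorem IsPeriodic.boxCoeff_iterate_dirDeriv {r : ℕ} (s : ℕ) {f : (Fin (r + 1) → ℝ) → ℂ}
    (hf : IsPeriodic f) (hc : ContDiff ℝ s f) (i : Fin (r + 1)) (k : Fin (r + 1) → ℤ) :
    boxCoeff ((dirDeriv (Pi.single i 1))^[s] f) k =
      (2 * Real.pi * Complex.I * k i) ^ s * boxCoeff f k := by
  induction s generalizing f with
  | zero => simp
  | succ s ih =>
    rw [Function.iterate_succ_apply, ih (isPeriodic_dirDeriv hf _) (contDiff_dirDeriv hc _)]
    have := hf.boxCoeff_fderiv (hc.of_le (by norm_cast; omega)) i k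
    rw [show boxCoeff (dirDeriv (Pi.single i 1) f) k = _ from this, pow_succ]
    ring

/-- Bessel's inequality for the pure derivatives of order `s` along the axes. -/
theorem IsPeriodic.summable_sq_mul_boxCoeff {r : ℕ} (s : ℕ) {f : (Fin (r + 1) → ℝ) → ℂ}
    (hf : IsPeriodic f) (hc : ContDiff ℝ s f) :
    Summable fun k => (‖k‖ ^ s * ‖boxCoeff f k‖) ^ 2 := by
  have h1 : ∀ i, IsPeriodic ((dirDeriv (Pi.single i 1))^[s] f) ∧
      Continuous ((dirDeriv (Pi.single i 1))^[s] f) := by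
    intro i
    induction s generalizing f with
    | zero => exact ⟨hf, hc.continuous⟩
    | succ s ih => exact ih (isPeriodic_dirDeriv hf _) (contDiff_dirDeriv hc _)
  have h2 : Summable fun k => ∑ i, ‖boxCoeff ((dirDeriv (Pi.single i 1))^[s] f) k‖ ^ 2 :=
    summable_sum fun i _ => (h1 i).1.summable_sq_boxCoeff (h1 i).2
  refine h2.of_nonneg_of_le (fun k => by positivity) fun k => ?_
  obtain ⟨i, hi⟩ : ∃ i, ‖k‖ ≤ ‖k i‖ := by
    obtain ⟨i, -, hi⟩ := Finset.exists_max_image Finset.univ (fun i => ‖k i‖)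
      Finset.univ_nonempty
    exact ⟨i, (pi_norm_le_iff_of_nonneg (norm_nonneg _)).2 fun j => hi j (Finset.mem_univ j)⟩
  refine le_trans ?_ (Finset.single_le_sum (f := fun i =>
    ‖boxCoeff ((dirDeriv (Pi.single i 1))^[s] f) k‖ ^ 2) (fun j _ => by positivity)
    (Finset.mem_univ i))
  rw [hf.boxCoeff_iterate_dirDeriv s hc, norm_mul, norm_pow]
  gcongr
  refine hi.trans ?_
  have h3 : ‖(2 * Real.pi * Complex.I * k i : ℂ)‖ = 2 * Real.pi * ‖k i‖ := by
    simp [abs_of_pos Real.pi_pos, Int.norm_eq_abs]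
  rw [h3]
  have := Real.pi_gt_three
  nlinarith [norm_nonneg (k i)]

/-- The Fourier coefficients of a `C^s` function on the torus are summable with any weight of order
less than `s - d / 2`. -/
theorem IsPeriodic.summable_rpow_mul_boxCoeff {r : ℕ} (s : ℕ) {f : (Fin (r + 1) → ℝ) → ℂ}
    (hf : IsPeriodic f) (hc : ContDiff ℝ s f) {a : ℝ} (ha : 2 * (a - s) < -(r + 1 : ℝ)) :
    Summable fun k => ‖k‖ ^ a * ‖boxCoeff f k‖ := by
  -- the product of two square summable sequences is summable
  have h1 := hf.summable_sq_mul_boxCoeff s hc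
  have h2 : Summable fun k : Fin (r + 1) → ℤ => ‖k‖ ^ (2 * (a - s)) :=
    summable_norm_rpow_int (by push_cast; exact ha)
  refine Summable.of_norm_bounded_eventually (h1.add h2) ?_
  have : ∀ᶠ k : Fin (r + 1) → ℤ in Filter.cofinite, k ≠ 0 := by
    rw [Filter.eventually_cofinite]; simp
  filter_upwards [this] with k hk
  have hk0 : 0 < ‖k‖ := norm_pos_iff.2 hk
  rw [Real.norm_of_nonneg (by positivity)]
  have e1 : ‖k‖ ^ (2 * (a - s)) = (‖k‖ ^ (a - s)) ^ 2 := by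
    rw [mul_comm, Real.rpow_mul hk0.le]; norm_cast
  have e2 : ‖k‖ ^ a * ‖boxCoeff f k‖ = ‖k‖ ^ (a - s) * (‖k‖ ^ s * ‖boxCoeff f k‖) := by
    rw [Real.rpow_sub hk0, Real.rpow_natCast]
    field_simp
  rw [e1, e2]
  nlinarith [two_mul_le_add_sq (‖k‖ ^ (a - s)) (‖k‖ ^ s * ‖boxCoeff f k‖),
    sq_nonneg (‖k‖ ^ (a - s)), sq_nonneg (‖k‖ ^ s * ‖boxCoeff f k‖)]

/-! ### Integer changes of coordinates -/

section Act

variable {d : ℕ} (A : Matrix.SpecialLinearGroup (Fin d) ℤ)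

/-- `act A` as a continuous linear map. -/
def actCLM : (Fin d → ℝ) →L[ℝ] (Fin d → ℝ) :=
  LinearMap.toContinuousLinearMap
    (Matrix.mulVecLin ((A : Matrix (Fin d) (Fin d) ℤ).map (fun z : ℤ => (z : ℝ))))

theorem actCLM_apply (x : Fin d → ℝ) : actCLM A x = act A x := rfl

theorem act_add (x y : Fin d → ℝ) : act A (x + y) = act A x + act A y :=
  map_add (actCLM A) x y

theorem act_smul (c : ℝ) (x : Fin d → ℝ) : act A (c • x) = c • act A x :=
  map_smul (actCLM A) c x

theorem act_intCast (m : Fin d → ℤ) :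
    act A (fun i => (m i : ℝ)) =
      fun i => (((A : Matrix (Fin d) (Fin d) ℤ).mulVec m i : ℤ) : ℝ) := by
  funext i
  simp [act, Matrix.mulVec, dotProduct]

theorem act_mul (B : Matrix.SpecialLinearGroup (Fin d) ℤ) (x : Fin d → ℝ) :
    act (A * B) x = act A (act B x) := by
  simp only [act, Matrix.mulVec_mulVec, Matrix.SpecialLinearGroup.coe_mul]
  congr 1
  exact Matrix.map_mul (f := Int.castRingHom ℝ)

theorem act_one (x : Fin d → ℝ) : act (1 : Matrix.SpecialLinearGroup (Fin d) ℤ) x = x := by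
  simp [act]

theorem act_inv_act (x : Fin d → ℝ) : act A⁻¹ (act A x) = x := by
  rw [← act_mul, inv_mul_cancel, act_one]

theorem act_act_inv (x : Fin d → ℝ) : act A (act A⁻¹ x) = x := by
  rw [← act_mul, mul_inv_cancel, act_one]

theorem IsPeriodic.comp_act {F : Type*} {f : (Fin d → ℝ) → F} (hf : IsPeriodic f) :
    IsPeriodic fun x => f (act A x) := by
  intro x m
  have h : act A (fun i => x i + (m i : ℝ)) = act A x + act A (fun i => (m i : ℝ)) :=
    act_add A x _
  simp only [h, act_intCast]
  exact hf _ _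

theorem contDiff_act {n : WithTop ℕ∞} : ContDiff ℝ n (act A) := (actCLM A).contDiff

/-- The phase of the character `k` in the coordinates `act A x`, as a linear form. -/
def phase (k : Fin d → ℤ) : (Fin d → ℝ) →L[ℝ] ℝ :=
  ∑ i, (2 * Real.pi * (k i : ℝ)) • (ContinuousLinearMap.proj i).comp (actCLM A)

theorem character_act (k : Fin d → ℤ) (x : Fin d → ℝ) :
    character k (act A x) = Complex.exp (Complex.I * (phase A k x : ℂ)) := by
  rw [character]
  congr 1
  simp only [phase, sum_apply, FunLike.coe_smul, Pi.smul_apply, ContinuousLinearMap.comp_apply,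
    ContinuousLinearMap.proj_apply, actCLM_apply, smul_eq_mul]
  push_cast
  simp only [Finset.mul_sum]
  refine Finset.sum_congr rfl fun i _ => ?_
  ring

theorem norm_phase_le (k : Fin d → ℤ) :
    ‖phase A k‖ ≤ 2 * Real.pi * d * ‖actCLM A‖ * ‖k‖ := by
  refine (norm_sum_le _ _).trans ?_
  have : ∀ i ∈ (Finset.univ : Finset (Fin d)),
      ‖(2 * Real.pi * (k i : ℝ)) • (ContinuousLinearMap.proj i).comp (actCLM A)‖ ≤
        2 * Real.pi * ‖actCLM A‖ * ‖k‖ := by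
    intro i _
    rw [norm_smul, norm_mul, Real.norm_of_nonneg (by positivity), Int.norm_cast_real]
    have h1 :
        ‖(ContinuousLinearMap.proj i : (Fin d → ℝ) →L[ℝ] ℝ).comp (actCLM A)‖ ≤ ‖actCLM A‖ := by
      refine ContinuousLinearMap.opNorm_le_bound _ (norm_nonneg _) fun x => ?_
      exact (norm_le_pi_norm (actCLM A x) i).trans ((actCLM A).le_opNorm x)
    calc _ ≤ 2 * Real.pi * ‖k‖ * ‖actCLM A‖ := by
          gcongr
          exact norm_le_pi_norm k i
      _ = _ := by ring
  refine (Finset.sum_le_sum this).trans (le_of_eq ?_)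
  simp
  ring

end Act

/-- The small divisors: `|e^{2πiθ} - 1| = 2 |sin(πθ)|` is at least four times the distance of `θ` to
the integers. -/
theorem IsDiophantine.le_norm_character_sub_one {r : ℕ} {ν τ : ℝ} {ω : Fin r → ℝ}
    (h : IsDiophantine ν τ ω) {m : Fin r → ℤ} (hm : m ≠ 0) :
    4 * (ν * ‖m‖ ^ (-τ)) ≤ ‖character m ω - 1‖ := by
  set θ : ℝ := ∑ i, (m i : ℝ) * ω i with hθ
  have h1 := h m hm (round θ)
  have h2 : character m ω = Complex.exp (Complex.I * ((2 * Real.pi * θ : ℝ) : ℂ)) := by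
    rw [character, ← hθ]
    congr 1
    push_cast
    ring
  rw [h2, Complex.norm_exp_I_mul_ofReal_sub_one, norm_mul, Real.norm_of_nonneg (by norm_num)]
  have h3 : |Real.sin (2 * Real.pi * θ / 2)| = |Real.sin (Real.pi * (θ - round θ))| := by
    rw [show 2 * Real.pi * θ / 2 = Real.pi * (θ - round θ) + (round θ : ℤ) * Real.pi by ring,
      Real.sin_add_int_mul_pi, abs_mul]
    simp
  rw [Real.norm_eq_abs, h3]
  have h4 : |θ - round θ| ≤ 1 / 2 := abs_sub_round θ
  have h5 := Real.mul_abs_le_abs_sin (x := Real.pi * (θ - round θ)) (by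
    rw [abs_mul, abs_of_pos Real.pi_pos]
    nlinarith [Real.pi_pos])
  rw [abs_mul, abs_of_pos Real.pi_pos, ← mul_assoc, div_mul_cancel₀ _ Real.pi_ne_zero] at h5
  linarith

/-! ### The cohomology equation -/

section Cohomology

theorem norm_iteratedFDeriv_mul_character_le {d : ℕ} (A : Matrix.SpecialLinearGroup (Fin d) ℤ)
    (z : ℂ) (k : Fin d → ℤ) (j : ℕ) (x : Fin d → ℝ) :
    ‖iteratedFDeriv ℝ j (fun x => z * character k (act A x)) x‖ ≤
      ‖z‖ * (2 * Real.pi * d * ‖actCLM A‖ * ‖k‖) ^ j := by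
  simp only [character_act]
  have h1 : ContDiff ℝ j (fun x => (phase A k x : ℂ)) :=
    Complex.ofRealCLM.contDiff.comp (phase A k).contDiff
  have h2 : ContDiff ℝ j (fun x => Complex.exp (Complex.I * (phase A k x : ℂ))) :=
    (contDiff_const.mul h1).cexp
  have h3 := iteratedFDeriv_const_smul_apply (a := z) (x := x) h2.contDiffAt
  have h4 : (z • fun x => Complex.exp (Complex.I * (phase A k x : ℂ))) =
      fun x => z * Complex.exp (Complex.I * (phase A k x : ℂ)) := rfl
  rw [← h4, h3, norm_smul]
  gcongr
  refine (norm_iteratedFDeriv_exp_le _ j x).trans ?_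
  gcongr
  exact norm_phase_le A k

theorem contDiff_mul_character {d : ℕ} {n : WithTop ℕ∞} (A : Matrix.SpecialLinearGroup (Fin d) ℤ)
    (z : ℂ) (k : Fin d → ℤ) : ContDiff ℝ n (fun x => z * character k (act A x)) := by
  simp only [character_act]
  have h1 : ContDiff ℝ n (fun x => (phase A k x : ℂ)) :=
    Complex.ofRealCLM.contDiff.comp (phase A k).contDiff
  exact contDiff_const.mul (contDiff_const.mul h1).cexp

/-- The terms of the series `cohomologySolution`. -/
def cohomologyTerm {r : ℕ} (A : Matrix.SpecialLinearGroup (Fin (r + 1)) ℤ)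
    (ω : Fin r → ℝ) (p : (Fin (r + 1) → ℝ) → ℝ) (k : Fin (r + 1) → ℤ) : ℂ :=
  if Fin.init (α := fun _ => ℤ) k = 0 then 0
  else fourierCoeffIn A p k / (character (Fin.init (α := fun _ => ℤ) k) ω - 1)

variable {r : ℕ} {A : Matrix.SpecialLinearGroup (Fin (r + 1)) ℤ} {ω : Fin r → ℝ}
  {L : Fin (r + 1) → ℤ} {α₀ ν τ : ℝ} {Ω : Fin (r + 1) → ℝ} {p : (Fin (r + 1) → ℝ) → ℝ} {s σ : ℕ}

theorem cohomologySolution_eq (x : Fin (r + 1) → ℝ) : cohomologySolution A ω p x =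
    (∑' k, cohomologyTerm A ω p k * character k (act A x)).re := by
  rw [cohomologySolution]
  congr 2
  funext k
  rw [cohomologyTerm]
  split_ifs <;> simp

theorem isPeriodic_complex_comp_act_inv (hp : IsPeriodic p) :
    IsPeriodic fun y => (p (act A⁻¹ y) : ℂ) := fun x m => by
  have := hp.comp_act A⁻¹ x m
  exact congrArg Complex.ofReal this

theorem contDiff_complex_comp_act_inv {n : WithTop ℕ∞} (hp : ContDiff ℝ n p) :
    ContDiff ℝ n fun y => (p (act A⁻¹ y) : ℂ) :=
  Complex.ofRealCLM.contDiff.comp (hp.comp (contDiff_act A⁻¹))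

theorem norm_cohomologyTerm_le (hν : 0 < ν) (hω : IsDiophantine ν τ ω) (hτ : 0 < τ)
    (k : Fin (r + 1) → ℤ) :
    ‖cohomologyTerm A ω p k‖ ≤ (4 * ν)⁻¹ * (‖k‖ ^ τ * ‖fourierCoeffIn A p k‖) := by
  rw [cohomologyTerm]
  split_ifs with h
  · rw [norm_zero]; positivity
  · have h1 := hω.le_norm_character_sub_one h
    have hm : 0 < ‖Fin.init (α := fun _ => ℤ) k‖ := norm_pos_iff.2 h
    have hle : ‖Fin.init (α := fun _ => ℤ) k‖ ≤ ‖k‖ :=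
      (pi_norm_le_iff_of_nonneg (norm_nonneg _)).2 fun i => norm_le_pi_norm k i.castSucc
    have hk : 0 < ‖k‖ := hm.trans_le hle
    have h2 : 4 * ν * (‖k‖ ^ τ)⁻¹ ≤ ‖character (Fin.init (α := fun _ => ℤ) k) ω - 1‖ := by
      rw [Real.rpow_neg hm.le] at h1
      calc 4 * ν * (‖k‖ ^ τ)⁻¹ ≤ 4 * ν * (‖Fin.init (α := fun _ => ℤ) k‖ ^ τ)⁻¹ := by gcongr
        _ ≤ _ := by rwa [mul_assoc]
    rw [norm_div, div_le_iff₀ (lt_of_lt_of_le (by positivity) h2)]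
    calc ‖fourierCoeffIn A p k‖
        = (4 * ν)⁻¹ * (‖k‖ ^ τ * ‖fourierCoeffIn A p k‖) * (4 * ν * (‖k‖ ^ τ)⁻¹) := by
          have : ‖k‖ ^ τ ≠ 0 := (Real.rpow_pos_of_pos hk τ).ne'
          field_simp
      _ ≤ _ := by gcongr

/-- The series solving the cohomology equation converges in `C^s` when `p` is of class `C^{s+σ}`
with `σ > τ + d / 2`. For `d = 1` all its terms vanish. -/
theorem summable_cohomologyTerm (hν : 0 < ν) (hτ : 0 < τ) (hω : IsDiophantine ν τ ω)
    (hσ : r = 0 ∨ τ + (r + 1 : ℝ) / 2 < σ) (hp : IsPeriodic p) (hpc : ContDiff ℝ (s + σ : ℕ) p)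
    {j : ℕ} (hj : j ≤ s) : Summable fun k => ‖k‖ ^ j * ‖cohomologyTerm A ω p k‖ := by
  rcases hσ with rfl | hσ
  · have : ∀ k, cohomologyTerm A ω p k = 0 := fun k => by
      rw [cohomologyTerm, if_pos (Subsingleton.elim _ _)]
    simp [this]
  · have hj' : (j : ℝ) ≤ s := by exact_mod_cast hj
    have h1 := (isPeriodic_complex_comp_act_inv (A := A) hp).summable_rpow_mul_boxCoeff (s + σ)
      (contDiff_complex_comp_act_inv hpc) (a := τ + j) (by push_cast; linarith)
    refine (h1.mul_left (4 * ν)⁻¹).of_nonneg_of_le (fun k => by positivity) fun k => ?_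
    have h2 := norm_cohomologyTerm_le (A := A) (p := p) hν hω hτ k
    have h3 : ‖k‖ ^ (τ + j) = ‖k‖ ^ τ * ‖k‖ ^ j := by
      rw [Real.rpow_add_of_nonneg (norm_nonneg _) hτ.le (Nat.cast_nonneg j), Real.rpow_natCast]
    rw [h3]
    calc ‖k‖ ^ j * ‖cohomologyTerm A ω p k‖
        ≤ ‖k‖ ^ j * ((4 * ν)⁻¹ * (‖k‖ ^ τ * ‖fourierCoeffIn A p k‖)) := by gcongr
      _ = _ := by rw [fourierCoeffIn, boxCoeff]; ring

/-- The solution of the cohomology equation loses `σ` derivatives. -/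
theorem contDiff_cohomologySolution (hν : 0 < ν) (hτ : 0 < τ) (hω : IsDiophantine ν τ ω)
    (hσ : r = 0 ∨ τ + (r + 1 : ℝ) / 2 < σ) (hp : IsPeriodic p)
    (hpc : ContDiff ℝ (s + σ : ℕ) p) : ContDiff ℝ s (cohomologySolution A ω p) := by
  have h : ContDiff ℝ ((s : ℕ∞) : WithTop ℕ∞)
      fun x => ∑' k, cohomologyTerm A ω p k * character k (act A x) := by
    refine contDiff_tsum (v := fun j k => ‖cohomologyTerm A ω p k‖ *
      (2 * Real.pi * (r + 1 : ℕ) * ‖actCLM A‖ * ‖k‖) ^ j) (fun k => contDiff_mul_character A _ k)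
      (fun j hj => ?_) (fun j k x _ => norm_iteratedFDeriv_mul_character_le A _ k j x)
    refine ((summable_cohomologyTerm (A := A) hν hτ hω hσ hp hpc (by exact_mod_cast hj)).mul_left
      ((2 * Real.pi * (r + 1 : ℕ) * ‖actCLM A‖) ^ j)).congr fun k => ?_
    rw [mul_pow _ ‖k‖]
    ring
  have h2 := Complex.reCLM.contDiff.comp h
  have e : cohomologySolution A ω p =
      Complex.reCLM ∘ fun x => ∑' k, cohomologyTerm A ω p k * character k (act A x) :=
    funext fun x => cohomologySolution_eq x
  rw [e]
  exact_mod_cast h2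

theorem isPeriodic_cohomologySolution : IsPeriodic (cohomologySolution A ω p) := by
  intro x m
  rw [cohomologySolution_eq, cohomologySolution_eq]
  congr 2
  funext k
  congr 1
  exact (isPeriodic_character k).comp_act A x m

/-- The translation by `α₀ Ω` acts on the mode `(m, l)` by the factor `e^{2πi m·ω}`, which does not
depend on `l`. -/
theorem character_act_add_resonant (hA : IsIntrinsicFrequency A ω L (α₀ • Ω))
    (k : Fin (r + 1) → ℤ) (x : Fin (r + 1) → ℝ) :
    character k (act A (x + α₀ • Ω)) =
      character (Fin.init (α := fun _ => ℤ) k) ω * character k (act A x) := by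
  have h : act A (α₀ • Ω) = Fin.snoc (α := fun _ => ℝ) ω 0 + fun i => (L i : ℝ) :=
    funext fun i => hA.eq i
  rw [act_add, h, character_add, character_add, character_intCast, mul_one, mul_comm]
  congr 1
  simp [character, Fin.sum_univ_castSucc, Fin.init]

theorem summable_resonantPart (hs : Summable (fourierCoeffIn A p)) (t : ℝ) :
    Summable fun l : ℤ => fourierCoeffIn A p (Fin.snoc (α := fun _ => ℤ) 0 l) *
      Complex.exp (2 * Real.pi * Complex.I * l * t) := by
  have hinj : Function.Injective
      fun l : ℤ => (Fin.snoc (α := fun _ => ℤ) (0 : Fin r → ℤ) l : Fin (r + 1) → ℤ) :=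
    fun a b h => by simpa using congrFun h (Fin.last r)
  refine Summable.of_norm ((hs.norm.comp_injective hinj).congr fun l => ?_)
  rw [norm_mul, show (2 * Real.pi * Complex.I * l * t : ℂ) = ((2 * Real.pi * l * t : ℝ) : ℂ) *
    Complex.I by push_cast; ring, Complex.norm_exp_ofReal_mul_I, mul_one]
  rfl

/-- The cohomology equation `h (x + α₀ Ω) - h x = p x - P ((A x)_d)`. -/
theorem cohomologySolution_shift_sub (hA : IsIntrinsicFrequency A ω L (α₀ • Ω)) (hν : 0 < ν)
    (hτ : 0 < τ) (hω : IsDiophantine ν τ ω) (hσ : r = 0 ∨ τ + (r + 1 : ℝ) / 2 < σ) (hσ1 : 1 ≤ σ)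
    (hp : IsPeriodic p) (hpc : ContDiff ℝ (s + σ : ℕ) p) (x : Fin (r + 1) → ℝ) :
    cohomologySolution A ω p (x + α₀ • Ω) - cohomologySolution A ω p x =
      p x - resonantPart A p (act A x (Fin.last r)) := by
  have hper := isPeriodic_complex_comp_act_inv (A := A) hp
  have hcd := contDiff_complex_comp_act_inv (A := A) hpc
  have hc : Summable (fourierCoeffIn A p) := by
    have h1 := hper.summable_rpow_mul_boxCoeff (s + σ) hcd (a := 0) (by
      rcases hσ with rfl | hσ
      · have : (1 : ℝ) ≤ σ := by exact_mod_cast hσ1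
        push_cast
        linarith [(Nat.cast_nonneg s : (0 : ℝ) ≤ s)]
      · push_cast
        linarith [(Nat.cast_nonneg s : (0 : ℝ) ≤ s)])
    have h2 : Summable fun k => ‖boxCoeff (fun y => (p (act A⁻¹ y) : ℂ)) k‖ := by simpa using h1
    exact Summable.of_norm h2
  have hS := summable_cohomologyTerm hν hτ hω hσ hp hpc (A := A) (Nat.zero_le s)
  have hS' : ∀ z, Summable fun k => cohomologyTerm A ω p k * character k (act A z) := fun z =>
    Summable.of_norm (by simpa [norm_mul, norm_character] using hS)
  have hp0 : HasSum (fun k => fourierCoeffIn A p k * character k (act A x)) (p x : ℂ) := by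
    have := hper.hasSum_boxCoeff hcd.continuous hc (act A x)
    simp only [act_inv_act] at this
    exact this
  have hinj : Function.Injective
      fun l : ℤ => (Fin.snoc (α := fun _ => ℤ) (0 : Fin r → ℤ) l : Fin (r + 1) → ℤ) :=
    fun a b h => by simpa using congrFun h (Fin.last r)
  have hR : HasSum (fun k => if Fin.init (α := fun _ => ℤ) k = 0 then
      fourierCoeffIn A p k * character k (act A x) else 0)
      (∑' l : ℤ, fourierCoeffIn A p (Fin.snoc (α := fun _ => ℤ) 0 l) *
        Complex.exp (2 * Real.pi * Complex.I * l * (act A x (Fin.last r) : ℝ))) := by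
    rw [← hinj.hasSum_iff]
    · refine (summable_resonantPart hc (act A x (Fin.last r))).hasSum.congr_fun fun l => ?_
      simp [character, Fin.sum_univ_castSucc, mul_assoc]
    · intro k hk
      refine if_neg fun h0 => hk ⟨k (Fin.last r), ?_⟩
      simp only
      rw [← h0, Fin.snoc_init_self]
  have hD := ((hS' (x + α₀ • Ω)).hasSum.sub (hS' x).hasSum).add hR
  have hfun : (fun k => cohomologyTerm A ω p k * character k (act A (x + α₀ • Ω)) -
      cohomologyTerm A ω p k * character k (act A x) +
      if Fin.init (α := fun _ => ℤ) k = 0 then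
      fourierCoeffIn A p k * character k (act A x) else 0) =
      fun k => fourierCoeffIn A p k * character k (act A x) := by
    funext k
    rw [character_act_add_resonant hA, cohomologyTerm]
    split_ifs with h
    · simp
    · have h1 : character (Fin.init (α := fun _ => ℤ) k) ω - 1 ≠ 0 := by
        have h2 := hω.le_norm_character_sub_one h
        have : 0 < ‖Fin.init (α := fun _ => ℤ) k‖ := norm_pos_iff.2 h
        exact norm_pos_iff.1 (lt_of_lt_of_le (by positivity) h2)
      field_simp
      ring
  rw [hfun] at hD
  have h := congrArg Complex.re (hD.unique hp0)
  rw [Complex.add_re, Complex.sub_re, Complex.ofReal_re, ← cohomologySolution_eq,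
    ← cohomologySolution_eq] at h
  rw [resonantPart, ← h]
  ring

end Cohomology

/-! ### Families depending on a parameter -/

section Param

variable {E F : Type} [NormedAddCommGroup E] [NormedSpace ℝ E] [NormedAddCommGroup F]
  [NormedSpace ℝ F]

/-- Interchange of the derivative in the parameter and the derivative in space. -/
theorem hasDerivWithinAt_fderiv {S : Set ℝ} (hS : Convex ℝ S) {G G' : ℝ → E → F}
    (h1 : ∀ e ∈ S, ∀ x, HasDerivWithinAt (fun e => G e x) (G' e x) S e)
    (h2 : ∀ e ∈ S, Differentiable ℝ (G e)) (h3 : ∀ e ∈ S, Differentiable ℝ (G' e))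
    (h4 : ContinuousOn (fun z : ℝ × E => fderiv ℝ (G' z.1) z.2) (S ×ˢ Set.univ))
    {e₀ : ℝ} (he₀ : e₀ ∈ S) (x : E) :
    HasDerivWithinAt (fun e => fderiv ℝ (G e) x) (fderiv ℝ (G' e₀) x) S e₀ := by
  rw [hasDerivWithinAt_iff_isLittleO, Asymptotics.isLittleO_iff]
  intro c hc
  have h5 := h4 (e₀, x) ⟨he₀, trivial⟩
  rw [Metric.continuousWithinAt_iff] at h5
  obtain ⟨δ, hδ, h5⟩ := h5 c hc
  filter_upwards [self_mem_nhdsWithin, mem_nhdsWithin_of_mem_nhds (Metric.ball_mem_nhds e₀ hδ)]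
    with e he heδ
  set Λ := fderiv ℝ (G' e₀) x with hΛ
  have hder : HasFDerivAt (fun ξ => G e ξ - G e₀ ξ - (e - e₀) • Λ ξ)
      (fderiv ℝ (G e) x - fderiv ℝ (G e₀) x - (e - e₀) • Λ) x :=
    (((h2 e he) x).hasFDerivAt.sub ((h2 e₀ he₀) x).hasFDerivAt).sub
      (Λ.hasFDerivAt.const_smul (e - e₀))
  refine hder.le_of_lip' (by positivity) ?_
  filter_upwards [Metric.ball_mem_nhds x hδ] with ξ hξ
  have hconv : Convex ℝ (S ∩ Metric.ball e₀ δ) := hS.inter (convex_ball _ _)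
  have hg : ∀ τ ∈ S ∩ Metric.ball e₀ δ, HasDerivWithinAt
      (fun τ => G τ ξ - G τ x - (τ - e₀) • Λ (ξ - x)) (G' τ ξ - G' τ x - Λ (ξ - x))
      (S ∩ Metric.ball e₀ δ) τ := by
    intro τ hτ
    have e1 := (h1 τ hτ.1 ξ).mono (Set.inter_subset_left (t := Metric.ball e₀ δ))
    have e2 := (h1 τ hτ.1 x).mono (Set.inter_subset_left (t := Metric.ball e₀ δ))
    have e3 : HasDerivWithinAt (fun τ : ℝ => (τ - e₀) • Λ (ξ - x)) (Λ (ξ - x))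
        (S ∩ Metric.ball e₀ δ) τ := by
      simpa using ((hasDerivWithinAt_id τ _).sub_const e₀).smul_const (Λ (ξ - x))
    exact (e1.sub e2).sub e3
  have hbd : ∀ τ ∈ S ∩ Metric.ball e₀ δ, ‖G' τ ξ - G' τ x - Λ (ξ - x)‖ ≤ c * ‖ξ - x‖ := by
    intro τ hτ
    refine Convex.norm_image_sub_le_of_norm_hasFDerivWithin_le' (𝕜 := ℝ) (s := Metric.ball x δ)
      (fun y _ => ((h3 τ hτ.1) y).hasFDerivAt.hasFDerivWithinAt) (fun y hy => ?_)
      (convex_ball _ _) (Metric.mem_ball_self hδ) hξ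
    have := h5 (x := (τ, y)) ⟨hτ.1, trivial⟩ (by
      rw [Prod.dist_eq]; exact max_lt hτ.2 hy)
    rw [dist_eq_norm] at this
    exact this.le
  have := Convex.norm_image_sub_le_of_norm_hasDerivWithin_le hg hbd hconv
    ⟨he₀, Metric.mem_ball_self hδ⟩ ⟨he, heδ⟩
  calc ‖G e ξ - G e₀ ξ - (e - e₀) • Λ ξ - (G e x - G e₀ x - (e - e₀) • Λ x)‖
      = ‖G e ξ - G e x - (e - e₀) • Λ (ξ - x) - (G e₀ ξ - G e₀ x - (e₀ - e₀) • Λ (ξ - x))‖ := by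
        congr 1
        rw [map_sub, smul_sub, sub_self, zero_smul]
        abel
    _ ≤ c * ‖ξ - x‖ * ‖e - e₀‖ := this
    _ = _ := by ring

/-- Joint differentiability in the parameter and in space: it is enough that the parameter
derivative is jointly continuous and that the space derivative exists at the point. -/
theorem hasFDerivWithinAt_uncurry {S : Set ℝ} (hS : Convex ℝ S) {G G' : ℝ → E → F}
    (h1 : ∀ e ∈ S, ∀ x, HasDerivWithinAt (fun e => G e x) (G' e x) S e)
    (h4 : ContinuousOn (fun z : ℝ × E => G' z.1 z.2) (S ×ˢ Set.univ))
    {e₀ : ℝ} (he₀ : e₀ ∈ S) {x₀ : E} {D : E →L[ℝ] F} (hD : HasFDerivAt (G e₀) D x₀) :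
    HasFDerivWithinAt (fun z : ℝ × E => G z.1 z.2)
      ((ContinuousLinearMap.fst ℝ ℝ E).smulRight (G' e₀ x₀) +
        D.comp (ContinuousLinearMap.snd ℝ ℝ E)) (S ×ˢ Set.univ) (e₀, x₀) := by
  rw [hasFDerivWithinAt_iff_isLittleO, Asymptotics.isLittleO_iff]
  intro c hc
  have h5 := h4 (e₀, x₀) ⟨he₀, trivial⟩
  rw [Metric.continuousWithinAt_iff] at h5
  obtain ⟨δ, hδ, h5⟩ := h5 (c / 2) (half_pos hc)
  have hD' := (Asymptotics.isLittleO_iff.1 (hasFDerivAt_iff_isLittleO.1 hD)) (half_pos hc)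
  have hD'' : ∀ᶠ z : ℝ × E in nhds (e₀, x₀),
      ‖G e₀ z.2 - G e₀ x₀ - D (z.2 - x₀)‖ ≤ c / 2 * ‖z.2 - x₀‖ :=
    (continuous_snd.tendsto (e₀, x₀)).eventually hD'
  filter_upwards [self_mem_nhdsWithin,
    mem_nhdsWithin_of_mem_nhds (Metric.ball_mem_nhds (e₀, x₀) hδ),
    mem_nhdsWithin_of_mem_nhds hD''] with z hz hzδ hzD
  obtain ⟨e, x⟩ := z
  have hzδ' : dist e e₀ < δ ∧ dist x x₀ < δ := by
    rw [Metric.mem_ball, Prod.dist_eq] at hzδ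
    exact max_lt_iff.1 hzδ
  have hconv : Convex ℝ (S ∩ Metric.ball e₀ δ) := hS.inter (convex_ball _ _)
  have hg : ∀ τ ∈ S ∩ Metric.ball e₀ δ, HasDerivWithinAt
      (fun τ => G τ x - τ • G' e₀ x₀) (G' τ x - G' e₀ x₀) (S ∩ Metric.ball e₀ δ) τ := by
    intro τ hτ
    have e1 := (h1 τ hτ.1 x).mono (Set.inter_subset_left (t := Metric.ball e₀ δ))
    have e3 : HasDerivWithinAt (fun τ : ℝ => τ • G' e₀ x₀) (G' e₀ x₀)
        (S ∩ Metric.ball e₀ δ) τ := by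
      simpa using (hasDerivWithinAt_id τ _).smul_const (G' e₀ x₀)
    exact e1.sub e3
  have hbd : ∀ τ ∈ S ∩ Metric.ball e₀ δ, ‖G' τ x - G' e₀ x₀‖ ≤ c / 2 := by
    intro τ hτ
    have := h5 (x := (τ, x)) ⟨hτ.1, trivial⟩ (by
      rw [Prod.dist_eq]; exact max_lt hτ.2 hzδ'.2)
    rw [dist_eq_norm] at this
    exact this.le
  have h6 := Convex.norm_image_sub_le_of_norm_hasDerivWithin_le hg hbd hconv
    ⟨he₀, Metric.mem_ball_self hδ⟩ ⟨hz.1, hzδ'.1⟩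
  have h7 : ‖e - e₀‖ ≤ ‖(e, x) - (e₀, x₀)‖ := norm_fst_le ((e, x) - (e₀, x₀))
  have h8 : ‖x - x₀‖ ≤ ‖(e, x) - (e₀, x₀)‖ := norm_snd_le ((e, x) - (e₀, x₀))
  calc _ = ‖(G e x - e • G' e₀ x₀ - (G e₀ x - e₀ • G' e₀ x₀)) +
        (G e₀ x - G e₀ x₀ - D (x - x₀))‖ := by
        congr 1
        simp [sub_smul]
        abel
    _ ≤ c / 2 * ‖e - e₀‖ + c / 2 * ‖x - x₀‖ := (norm_add_le _ _).trans (add_le_add h6 hzD)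
    _ ≤ c / 2 * ‖(e, x) - (e₀, x₀)‖ + c / 2 * ‖(e, x) - (e₀, x₀)‖ := by gcongr
    _ = _ := by ring

/-- Taylor's formula for a chain `g 0, g 1, …` of functions of a nonnegative parameter, each the
derivative of the previous one. -/
theorem norm_sub_taylor_le {V : Type} [NormedAddCommGroup V] [NormedSpace ℝ V] {S : Set ℝ}
    {T C : ℝ} (hT : Set.Icc 0 T ⊆ S) (m : ℕ) {g : ℕ → ℝ → V}
    (hg : ∀ a < m, ∀ e ∈ S, HasDerivWithinAt (g a) (g (a + 1) e) S e)
    (hC : ∀ e ∈ Set.Icc 0 T, ‖g m e‖ ≤ C) {e : ℝ} (he : e ∈ Set.Icc 0 T) :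
    ‖g 0 e - ∑ a ∈ Finset.range m, (e ^ a / (a.factorial : ℝ)) • g a 0‖ ≤ C * e ^ m := by
  induction m generalizing g e with
  | zero => simpa using hC e he
  | succ m ih =>
    have hC0 : 0 ≤ C := (norm_nonneg _).trans (hC e he)
    have hd : ∀ s ∈ Set.Icc 0 e, HasDerivWithinAt (fun s => g 0 s -
        ∑ a ∈ Finset.range (m + 1), (s ^ a / (a.factorial : ℝ)) • g a 0)
        (g 1 s - ∑ a ∈ Finset.range m, (s ^ a / (a.factorial : ℝ)) • g (a + 1) 0)
        (Set.Icc 0 e) s := by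
      intro s hs
      have hsub : Set.Icc 0 e ⊆ S := (Set.Icc_subset_Icc_right he.2).trans hT
      have h0 : HasDerivAt (fun s : ℝ => ∑ a ∈ Finset.range (m + 1),
          (s ^ a / (a.factorial : ℝ)) • g a 0)
          (∑ a ∈ Finset.range (m + 1), ((a * s ^ (a - 1)) / (a.factorial : ℝ)) • g a 0) s :=
        HasDerivAt.fun_sum fun a _ => ((hasDerivAt_pow a s).div_const _).smul_const _
      rw [sum_deriv_taylor (fun a => g a 0)] at h0
      exact ((hg 0 (Nat.succ_pos m) s (hsub hs)).mono hsub).sub h0.hasDerivWithinAt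
    have hb : ∀ s ∈ Set.Icc 0 e,
        ‖g 1 s - ∑ a ∈ Finset.range m, (s ^ a / (a.factorial : ℝ)) • g (a + 1) 0‖ ≤ C * e ^ m := by
      intro s hs
      refine (ih (g := fun a => g (a + 1)) (fun a ha => hg (a + 1) (by omega)) hC
        ⟨hs.1, hs.2.trans he.2⟩).trans ?_
      have := hs.1
      gcongr
      exact hs.2
    have := Convex.norm_image_sub_le_of_norm_hasDerivWithin_le hd hb (convex_Icc _ _)
      ⟨le_rfl, he.1⟩ ⟨he.1, le_rfl⟩
    have h0 : ∑ a ∈ Finset.range (m + 1), ((0 : ℝ) ^ a / (a.factorial : ℝ)) • g a 0 = g 0 0 := by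
      rw [Finset.sum_range_succ']
      simp
    rw [h0, sub_self, sub_zero, sub_zero, Real.norm_of_nonneg he.1] at this
    rwa [pow_succ, ← mul_assoc]

end Param

section Family

variable {d N : ℕ} {p : WithTop ℕ∞} {ε₁ : ℝ} {f : ℝ → (Fin d → ℝ) → ℝ}

/-- The derivative of order `i` in the parameter of the family `f`. -/
def paramDeriv (ε₁ : ℝ) (f : ℝ → (Fin d → ℝ) → ℝ) (i : ℕ) (e : ℝ) (x : Fin d → ℝ) : ℝ :=
  iteratedDerivWithin i (fun e => f e x) (Set.Ico 0 ε₁) e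

theorem paramDeriv_zero : paramDeriv ε₁ f 0 = f := by
  funext e x
  simp [paramDeriv]

theorem IsTorusFamily.periodic_paramDeriv (hf : IsTorusFamily N p ε₁ f) (i : ℕ) {e : ℝ}
    (he : e ∈ Set.Ico 0 ε₁) : IsPeriodic (paramDeriv ε₁ f i e) := fun x m =>
  iteratedDerivWithin_congr (fun e' he' => hf.periodic e' he' x m) he

theorem IsTorusFamily.hasDerivWithinAt (hf : IsTorusFamily N p ε₁ f) {i : ℕ} (hi : i < N)
    {e : ℝ} (he : e ∈ Set.Ico 0 ε₁) (x : Fin d → ℝ) :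
    HasDerivWithinAt (fun e => paramDeriv ε₁ f i e x) (paramDeriv ε₁ f (i + 1) e x)
      (Set.Ico 0 ε₁) e := by
  have h := (hf.contDiffOn_param x).differentiableOn_iteratedDerivWithin (m := i)
    (by exact_mod_cast hi) (uniqueDiffOn_Ico 0 ε₁)
  have h2 := (h e he).hasDerivWithinAt
  rwa [← iteratedDerivWithin_succ] at h2

theorem IsTorusFamily.hasDerivWithinAt_iteratedFDeriv (hf : IsTorusFamily N p ε₁ f) {i : ℕ}
    (hi : i < N) (j : ℕ) (hj : (j : WithTop ℕ∞) ≤ p) {e : ℝ} (he : e ∈ Set.Ico 0 ε₁)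
    (x : Fin d → ℝ) :
    HasDerivWithinAt (fun e => iteratedFDeriv ℝ j (paramDeriv ε₁ f i e) x)
      (iteratedFDeriv ℝ j (paramDeriv ε₁ f (i + 1) e) x) (Set.Ico 0 ε₁) e := by
  induction j generalizing e x with
  | zero =>
    simp only [iteratedFDeriv_zero_eq_comp, Function.comp_apply]
    exact ((continuousMultilinearCurryFin0 ℝ (Fin d → ℝ) ℝ).symm.toContinuousLinearEquiv
      |>.toContinuousLinearMap.hasFDerivAt.comp_hasDerivWithinAt e (hf.hasDerivWithinAt hi he x))
  | succ j ih =>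
    have hj' : (j : WithTop ℕ∞) < p :=
      lt_of_lt_of_le (by exact_mod_cast Nat.lt_succ_self j) hj
    have hdiff : ∀ i ≤ N, ∀ e ∈ Set.Ico 0 ε₁,
        Differentiable ℝ (iteratedFDeriv ℝ j (paramDeriv ε₁ f i e)) := fun i hi e he =>
      (hf.contDiff_space i hi e he).differentiable_iteratedFDeriv hj'
    simp only [iteratedFDeriv_succ_eq_comp_left, Function.comp_apply]
    have hcont : ContinuousOn (fun z : ℝ × (Fin d → ℝ) =>
        fderiv ℝ (iteratedFDeriv ℝ j (paramDeriv ε₁ f (i + 1) z.1)) z.2)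
        (Set.Ico 0 ε₁ ×ˢ Set.univ) := by
      have h := hf.continuousOn_mixed (i + 1) hi (j + 1) hj
      simp only [iteratedFDeriv_succ_eq_comp_left, Function.comp_apply] at h
      exact ((continuousMultilinearCurryLeftEquiv ℝ (fun _ : Fin (j + 1) => Fin d → ℝ) ℝ)
        |>.continuous.comp_continuousOn h).congr fun z _ => by
          simp
          rfl
    have := hasDerivWithinAt_fderiv (convex_Ico 0 ε₁) (fun e he x => ih hj'.le he x)
      (hdiff i hi.le) (hdiff (i + 1) hi) hcont he x
    exact ((continuousMultilinearCurryLeftEquiv ℝ (fun _ : Fin (j + 1) => Fin d → ℝ) ℝ).symm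
      |>.toContinuousLinearEquiv.toContinuousLinearMap.hasFDerivAt.comp_hasDerivWithinAt e this)

/-- The mixed derivatives of total order at most `N - m` of a family are jointly of class `C^m`. -/
theorem IsTorusFamily.contDiffOn_iteratedFDeriv (hf : IsTorusFamily N p ε₁ f)
    (hN : (N : WithTop ℕ∞) ≤ p) (m i j : ℕ) (hm : i + j + m ≤ N) :
    ContDiffOn ℝ m (fun z : ℝ × (Fin d → ℝ) => iteratedFDeriv ℝ j (paramDeriv ε₁ f i z.1) z.2)
      (Set.Ico 0 ε₁ ×ˢ Set.univ) := by
  have hle : ∀ j ≤ N, (j : WithTop ℕ∞) ≤ p := fun j hj => le_trans (by exact_mod_cast hj) hN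
  induction m generalizing i j with
  | zero => exact contDiffOn_zero.2 (hf.continuousOn_mixed i (by omega) j (hle j (by omega)))
  | succ m ih =>
    rw [Nat.cast_add, Nat.cast_one, contDiffOn_succ_iff_hasFDerivWithinAt_of_uniqueDiffOn
      ((uniqueDiffOn_Ico 0 ε₁).prod uniqueDiffOn_univ)]
    refine ⟨by simp, fun z => (ContinuousLinearMap.fst ℝ ℝ (Fin d → ℝ)).smulRight
        (iteratedFDeriv ℝ j (paramDeriv ε₁ f (i + 1) z.1) z.2) +
        (continuousMultilinearCurryLeftEquiv ℝ (fun _ : Fin (j + 1) => Fin d → ℝ) ℝ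
          (iteratedFDeriv ℝ (j + 1) (paramDeriv ε₁ f i z.1) z.2)).comp
          (ContinuousLinearMap.snd ℝ ℝ (Fin d → ℝ)), ?_, ?_⟩
    · refine ContDiffOn.add ?_ ?_
      · exact ContDiffOn.smulRight
          (f := fun _ : ℝ × (Fin d → ℝ) => ContinuousLinearMap.fst ℝ ℝ (Fin d → ℝ))
          contDiffOn_const (ih (i + 1) j (by omega))
      · refine ContDiffOn.clm_comp
          (f := fun _ : ℝ × (Fin d → ℝ) => ContinuousLinearMap.snd ℝ ℝ (Fin d → ℝ)) ?_
          contDiffOn_const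
        have hc := ContinuousLinearMap.contDiff (𝕜 := ℝ) (n := m)
          (E := ContinuousMultilinearMap ℝ (fun _ : Fin (j + 1) => Fin d → ℝ) ℝ)
          (F := (Fin d → ℝ) →L[ℝ] ContinuousMultilinearMap ℝ (fun _ : Fin j => Fin d → ℝ) ℝ)
          (continuousMultilinearCurryLeftEquiv ℝ (fun _ : Fin (j + 1) => Fin d → ℝ) ℝ
          |>.toContinuousLinearEquiv.toContinuousLinearMap)
        exact hc.comp_contDiffOn (ih i (j + 1) (by omega))
    · rintro ⟨e, x⟩ ⟨he, -⟩
      refine hasFDerivWithinAt_uncurry (convex_Ico 0 ε₁)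
        (G := fun e x => iteratedFDeriv ℝ j (paramDeriv ε₁ f i e) x)
        (G' := fun e x => iteratedFDeriv ℝ j (paramDeriv ε₁ f (i + 1) e) x)
        (fun e he x => hf.hasDerivWithinAt_iteratedFDeriv (by omega) j (hle j (by omega)) he x)
        (hf.continuousOn_mixed (i + 1) (by omega) j (hle j (by omega))) he ?_
      have hd := ((hf.contDiff_space i (by omega) e he).differentiable_iteratedFDeriv (m := j)
        (lt_of_lt_of_le (by exact_mod_cast (by omega : j < N)) hN)) x
      have e1 : continuousMultilinearCurryLeftEquiv ℝ (fun _ : Fin (j + 1) => Fin d → ℝ) ℝ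
          (iteratedFDeriv ℝ (j + 1) (paramDeriv ε₁ f i e) x) =
          fderiv ℝ (iteratedFDeriv ℝ j (paramDeriv ε₁ f i e)) x := by
        rw [iteratedFDeriv_succ_eq_comp_left]
        exact LinearIsometryEquiv.apply_symm_apply _ _
      change HasFDerivAt (iteratedFDeriv ℝ j (paramDeriv ε₁ f i e))
        (continuousMultilinearCurryLeftEquiv ℝ (fun _ : Fin (j + 1) => Fin d → ℝ) ℝ
          (iteratedFDeriv ℝ (j + 1) (paramDeriv ε₁ f i e) x)) x
      rw [e1]
      exact hd.hasFDerivAt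

/-- Provided that `N ≤ p`, the family is jointly of class `C^N`. -/
theorem IsTorusFamily.contDiffOn (hf : IsTorusFamily N p ε₁ f) (hN : (N : WithTop ℕ∞) ≤ p) :
    ContDiffOn ℝ N (fun z : ℝ × (Fin d → ℝ) => f z.1 z.2) (Set.Ico 0 ε₁ ×ˢ Set.univ) := by
  have h := hf.contDiffOn_iteratedFDeriv hN N 0 0 (by omega)
  simp only [paramDeriv_zero, iteratedFDeriv_zero_eq_comp, Function.comp_apply] at h
  exact ((continuousMultilinearCurryFin0 ℝ (Fin d → ℝ) ℝ).contDiff.comp_contDiffOn h).congr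
    fun z _ => by simp

theorem IsPeriodic.exists_mem_Icc {F : Type*} {f : (Fin d → ℝ) → F} (hf : IsPeriodic f)
    (x : Fin d → ℝ) :
    ∃ a, x + a ∈ Set.Icc (0 : Fin d → ℝ) 1 ∧ ∀ y, f (y + a) = f y := by
  refine ⟨fun i => ((-⌊x i⌋ : ℤ) : ℝ), ⟨fun i => ?_, fun i => ?_⟩, fun y => hf y _⟩
  · simpa using Int.floor_le (x i)
  · have := Int.lt_floor_add_one (x i)
    simp only [Pi.add_apply, Pi.one_apply, Int.cast_neg]
    linarith

theorem IsPeriodic.exists_ckBound {F : Type} [NormedAddCommGroup F] [NormedSpace ℝ F] {k : ℕ}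
    {f : (Fin d → ℝ) → F} (hf : IsPeriodic f) (hc : ContDiff ℝ k f) : ∃ M, CkBound k M f :=
  CkBound.exists_of_invariant hc isCompact_Icc hf.exists_mem_Icc

/-- Taylor's formula in the parameter, with a remainder estimated in `C^k`. -/
theorem IsTorusFamily.exists_taylor_bound (hf : IsTorusFamily N p ε₁ f) (hε₁ : 0 < ε₁) {k m : ℕ}
    (hk : (k : WithTop ℕ∞) ≤ p) (hm : m ≤ N) :
    ∃ C, ∀ e ∈ Set.Icc 0 (ε₁ / 2), CkBound k (C * e ^ m) (fun x => f e x -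
      ∑ a ∈ Finset.range m, (e ^ a / (a.factorial : ℝ)) • paramDeriv ε₁ f a 0 x) := by
  have hsub : Set.Icc 0 (ε₁ / 2) ⊆ Set.Ico 0 ε₁ := fun e he => ⟨he.1, by linarith [he.2]⟩
  have h0 : (0 : ℝ) ∈ Set.Ico 0 ε₁ := ⟨le_rfl, hε₁⟩
  have hb : ∀ j : ℕ, ∃ C, j ≤ k → ∀ e ∈ Set.Icc 0 (ε₁ / 2), ∀ x,
      ‖iteratedFDeriv ℝ j (paramDeriv ε₁ f m e) x‖ ≤ C := by
    intro j
    by_cases hj : j ≤ k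
    · obtain ⟨C, hC⟩ := (isCompact_Icc.prod (isCompact_Icc (a := (0 : Fin d → ℝ)) (b := 1))
        ).exists_bound_of_continuousOn ((hf.continuousOn_mixed m hm j
          (le_trans (by exact_mod_cast hj) hk)).mono (Set.prod_mono hsub (Set.subset_univ _)))
      refine ⟨C, fun _ e he x => ?_⟩
      obtain ⟨a, ha, hfa⟩ := (hf.periodic_paramDeriv m (hsub he)).exists_mem_Icc x
      have e1 : iteratedFDeriv ℝ j (paramDeriv ε₁ f m e) x =
          iteratedFDeriv ℝ j (paramDeriv ε₁ f m e) (x + a) := by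
        rw [← iteratedFDeriv_comp_add_right]
        simp only [hfa]
      rw [e1]
      exact hC (e, x + a) ⟨he, ha⟩
    · exact ⟨0, fun h => absurd h hj⟩
  choose C hC using hb
  refine ⟨∑ j ∈ Finset.range (k + 1), |C j|, fun e he => ⟨?_, fun j hj x => ?_⟩⟩
  · have h1 := hf.contDiff_space 0 (Nat.zero_le _) e (hsub he)
    simp only [iteratedDerivWithin_zero] at h1
    exact (h1.of_le hk).sub (ContDiff.sum fun a ha =>
      ((hf.contDiff_space a (by simp at ha; omega) 0 h0).of_le hk).const_smul _)
  · have hjp : (j : WithTop ℕ∞) ≤ p := le_trans (by exact_mod_cast hj) hk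
    have hcd : ∀ a ≤ N, ∀ e ∈ Set.Ico 0 ε₁, ContDiffAt ℝ j (paramDeriv ε₁ f a e) x :=
      fun a ha e he => ((hf.contDiff_space a ha e he).of_le hjp).contDiffAt
    have e1 : iteratedFDeriv ℝ j (fun x => f e x -
        ∑ a ∈ Finset.range m, (e ^ a / (a.factorial : ℝ)) • paramDeriv ε₁ f a 0 x) x =
        iteratedFDeriv ℝ j (paramDeriv ε₁ f 0 e) x - ∑ a ∈ Finset.range m,
          (e ^ a / (a.factorial : ℝ)) • iteratedFDeriv ℝ j (paramDeriv ε₁ f a 0) x := by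
      have hs : ∀ a ∈ Finset.range m, ContDiffAt ℝ j
          (fun x => (e ^ a / (a.factorial : ℝ)) • paramDeriv ε₁ f a 0 x) x := fun a ha =>
        (hcd a (by simp at ha; omega) 0 h0).const_smul _
      have e2 := iteratedFDeriv_sub_apply (hcd 0 (Nat.zero_le _) e (hsub he))
        (ContDiffAt.sum hs)
      rw [paramDeriv_zero] at e2 ⊢
      have e3 : (f e - fun x => ∑ a ∈ Finset.range m,
          (e ^ a / (a.factorial : ℝ)) • paramDeriv ε₁ f a 0 x) = fun x => f e x -
          ∑ a ∈ Finset.range m, (e ^ a / (a.factorial : ℝ)) • paramDeriv ε₁ f a 0 x := rfl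
      rw [e3] at e2
      rw [e2]
      congr 1
      rw [iteratedFDeriv_fun_sum_apply hs]
      exact Finset.sum_congr rfl fun a ha => iteratedFDeriv_const_smul_apply'
        (hcd a (by simp at ha; omega) 0 h0)
    rw [e1]
    refine (norm_sub_taylor_le hsub m
      (g := fun a e => iteratedFDeriv ℝ j (paramDeriv ε₁ f a e) x)
      (fun a ha e he => hf.hasDerivWithinAt_iteratedFDeriv (by omega) j hjp he x)
      (fun e he => hC j hj e he x) he).trans ?_
    have := he.1
    gcongr
    exact (le_abs_self _).trans (Finset.single_le_sum (f := fun j => |C j|)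
      (fun i _ => abs_nonneg _) (Finset.mem_range.2 (by omega)))

end Family

/-! ### Orders of magnitude and expansions of families -/

section Order

variable {E F G : Type} [NormedAddCommGroup E] [NormedSpace ℝ E] [NormedAddCommGroup F]
  [NormedSpace ℝ F] [NormedAddCommGroup G] [NormedSpace ℝ G]

/-- The family `g` is `O(e^m)` in `C^k` as `e → 0+`. -/
def IsOrder (k m : ℕ) (g : ℝ → E → F) : Prop :=
  ∃ C, ∀ᶠ e in nhdsWithin (0 : ℝ) (Set.Ioi 0), CkBound k (C * e ^ m) (g e)

theorem eventually_pos_lt {δ : ℝ} (hδ : 0 < δ) :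
    ∀ᶠ e in nhdsWithin (0 : ℝ) (Set.Ioi 0), 0 < e ∧ e < δ :=
  Ioo_mem_nhdsGT hδ

theorem eventually_mul_lt (C : ℝ) {δ : ℝ} (hδ : 0 < δ) :
    ∀ᶠ e in nhdsWithin (0 : ℝ) (Set.Ioi 0), C * e < δ := by
  have h : Filter.Tendsto (fun e : ℝ => C * e) (nhdsWithin 0 (Set.Ioi 0)) (nhds 0) := by
    have := ((continuous_const_mul C).tendsto (0 : ℝ)).mono_left
      (nhdsWithin_le_nhds (s := Set.Ioi (0 : ℝ)))
    simpa using this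
  exact h.eventually (gt_mem_nhds hδ)

namespace IsOrder

variable {k l m m' : ℕ} {g h : ℝ → E → F}

theorem exists_nonneg (hg : IsOrder k m g) : ∃ C, 0 ≤ C ∧
    ∀ᶠ e in nhdsWithin (0 : ℝ) (Set.Ioi 0), CkBound k (C * e ^ m) (g e) := by
  obtain ⟨C, hC⟩ := hg
  refine ⟨|C|, abs_nonneg C, ?_⟩
  filter_upwards [hC, self_mem_nhdsWithin] with e he he0
  exact he.mono_const (mul_le_mul_of_nonneg_right (le_abs_self C) (pow_nonneg (le_of_lt he0) _))

theorem congr (hg : IsOrder k m g)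
    (hgh : ∀ᶠ e in nhdsWithin (0 : ℝ) (Set.Ioi 0), ∀ x, h e x = g e x) : IsOrder k m h := by
  obtain ⟨C, hC⟩ := hg
  refine ⟨C, ?_⟩
  filter_upwards [hC, hgh] with e h1 h2
  exact h1.congr h2

theorem mono (hg : IsOrder k m g) (hl : l ≤ k) (hm : m' ≤ m) : IsOrder l m' g := by
  obtain ⟨C, hC0, hC⟩ := hg.exists_nonneg
  refine ⟨C, ?_⟩
  filter_upwards [hC, eventually_pos_lt one_pos] with e h1 h2
  exact h1.mono hl (mul_le_mul_of_nonneg_left (pow_le_pow_of_le_one h2.1.le h2.2.le hm) hC0)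

theorem of_ckBound {M : ℝ} {q : E → F} (hq : CkBound k M q) : IsOrder k 0 (fun _ => q) :=
  ⟨M, Filter.Eventually.of_forall fun e => by simpa using hq⟩

theorem add (hg : IsOrder k m g) (hh : IsOrder k m h) : IsOrder k m (fun e x => g e x + h e x) := by
  obtain ⟨C, hC⟩ := hg
  obtain ⟨D, hD⟩ := hh
  refine ⟨C + D, ?_⟩
  filter_upwards [hC, hD] with e h1 h2
  exact (h1.add h2).mono_const (by rw [add_mul])

theorem zero (k m : ℕ) : IsOrder k m (fun (_ : ℝ) (_ : E) => (0 : F)) :=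
  ⟨0, Filter.Eventually.of_forall fun e => by simpa using CkBound.zero k⟩

theorem sum {ι : Type*} {g : ι → ℝ → E → F} (s : Finset ι) (hg : ∀ i ∈ s, IsOrder k m (g i)) :
    IsOrder k m (fun e x => ∑ i ∈ s, g i e x) := by
  classical
  induction s using Finset.induction_on with
  | empty => simpa using zero k m
  | insert a s ha ih =>
    simp only [Finset.sum_insert ha]
    exact (hg a (Finset.mem_insert_self a s)).add
      (ih fun i hi => hg i (Finset.mem_insert_of_mem hi))

theorem mul {g h : ℝ → E → ℝ} (hg : IsOrder k m g) (hh : IsOrder k m' h) :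
    IsOrder k (m + m') (fun e x => g e x * h e x) := by
  obtain ⟨C, hC⟩ := hg
  obtain ⟨D, hD⟩ := hh
  refine ⟨2 ^ k * C * D, ?_⟩
  filter_upwards [hC, hD] with e h1 h2
  exact (h1.mul h2).mono_const (le_of_eq (by rw [pow_add]; ring))

theorem pow_smul (hg : IsOrder k m g) (i : ℕ) : IsOrder k (m + i) (fun e x => e ^ i • g e x) := by
  obtain ⟨C, hC⟩ := hg
  refine ⟨C, ?_⟩
  filter_upwards [hC, self_mem_nhdsWithin] with e h1 h2
  refine (h1.const_smul (e ^ i)).mono_const (le_of_eq ?_)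
  rw [abs_of_nonneg (pow_nonneg (le_of_lt h2) _), pow_add]
  ring

theorem pow_mul {g : ℝ → E → ℝ} (hg : IsOrder k m g) (i : ℕ) :
    IsOrder k (m + i) (fun e x => e ^ i * g e x) := hg.pow_smul i

theorem of_mul {g : ℝ → E → ℝ} (hg : IsOrder k (m + 1) (fun e x => e * g e x)) :
    IsOrder k m g := by
  obtain ⟨C, hC⟩ := hg
  refine ⟨C, ?_⟩
  filter_upwards [hC, self_mem_nhdsWithin] with e h1 h2
  have h2 : 0 < e := h2
  refine ((h1.const_mul e⁻¹).mono_const (le_of_eq ?_)).congr fun x => ?_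
  · rw [abs_of_pos (by positivity), pow_succ]
    field_simp
  · field_simp

/-- The remainder of order `j` in Taylor's formula along a vector, for families. -/
theorem taylorRem (v : F) {j m₁ : ℕ} {g : ℝ → F → G} {θ : ℝ → E → F} {φ : ℝ → E → ℝ}
    (hg : IsOrder (k + j) m g) (hθ : ∃ D, 0 ≤ D ∧ ∀ᶠ e in nhdsWithin (0 : ℝ) (Set.Ioi 0),
      Differentiable ℝ (θ e) ∧ CkBound (k - 1) D (fderiv ℝ (θ e)))
    (hφ : IsOrder k m₁ φ) (hm₁ : 1 ≤ m₁) :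
    IsOrder k (m + m₁ * j) (fun e => FoliationTorus.taylorRem v j (g e) (θ e) (φ e)) := by
  obtain ⟨D, hD, hθ⟩ := hθ
  obtain ⟨C, -, h1⟩ := CkBound.taylorRem (E := E) v hD k j
  obtain ⟨A, hA⟩ := hg
  obtain ⟨B, hB0, hB⟩ := hφ.exists_nonneg
  refine ⟨C * A * B ^ j, ?_⟩
  filter_upwards [hA, hB, hθ, eventually_pos_lt one_pos, eventually_mul_lt B one_pos]
    with e a1 a2 a3 a4 a5
  have hδ : B * e ^ m₁ ≤ 1 := by
    refine le_trans (mul_le_mul_of_nonneg_left ?_ hB0) a5.le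
    exact pow_le_of_le_one a4.1.le a4.2.le (by omega)
  refine (h1 G (g e) (θ e) (φ e) _ _ hδ a1 a3.1 a3.2 a2).mono_const (le_of_eq ?_)
  rw [pow_add, mul_pow, ← _root_.pow_mul]
  ring

end IsOrder

/-- The family `g` has an expansion in powers of `e` of length `m`, with remainder `O(e^m)`, in the
space of functions with bounded derivatives of order at most `k`. The definition peels off one
coefficient at a time: `g = q + e g'`. -/
def HasExpansion (k : ℕ) : ℕ → (ℝ → E → ℝ) → Prop
  | 0, g => IsOrder k 0 g
  | m + 1, g => ∃ (q : E → ℝ) (g' : ℝ → E → ℝ), (∃ M, CkBound k M q) ∧ HasExpansion k m g' ∧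
      ∀ᶠ e in nhdsWithin (0 : ℝ) (Set.Ioi 0), ∀ x, g e x = q x + e * g' e x

namespace HasExpansion

variable {k m m' : ℕ} {g h : ℝ → E → ℝ}

theorem isOrder_zero (hg : HasExpansion k m g) : IsOrder k 0 g := by
  induction m generalizing g with
  | zero => exact hg
  | succ m ih =>
    obtain ⟨q, g', ⟨M, hq⟩, hg', h⟩ := hg
    refine ((IsOrder.of_ckBound hq).add (((ih hg').pow_mul 1).mono le_rfl (Nat.zero_le _))).congr ?_
    simpa using h

theorem of_isOrder (hg : IsOrder k m g) : HasExpansion k m g := by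
  induction m generalizing g with
  | zero => exact hg
  | succ m ih =>
    refine ⟨fun _ => 0, fun e x => e⁻¹ * g e x, ⟨0, CkBound.zero k⟩, ih (IsOrder.of_mul ?_), ?_⟩
    · refine hg.congr ?_
      filter_upwards [self_mem_nhdsWithin] with e he x
      have : e ≠ 0 := ne_of_gt he
      field_simp
    · filter_upwards [self_mem_nhdsWithin] with e he x
      have : e ≠ 0 := ne_of_gt he
      field_simp
      simp

theorem of_ckBound {M : ℝ} {q : E → ℝ} (hq : CkBound k M q) (m : ℕ) :
    HasExpansion k m (fun _ => q) := by
  cases m with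
  | zero => exact IsOrder.of_ckBound hq
  | succ m => exact ⟨q, fun _ _ => 0, ⟨M, hq⟩, of_isOrder (IsOrder.zero k m), by simp⟩

theorem of_succ (hg : HasExpansion k (m + 1) g) : HasExpansion k m g := by
  induction m generalizing g with
  | zero => exact hg.isOrder_zero
  | succ m ih =>
    obtain ⟨q, g', hq, hg', h⟩ := hg
    exact ⟨q, g', hq, ih hg', h⟩

theorem congr (hg : HasExpansion k m g)
    (hgh : ∀ᶠ e in nhdsWithin (0 : ℝ) (Set.Ioi 0), ∀ x, h e x = g e x) : HasExpansion k m h := by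
  cases m with
  | zero => exact IsOrder.congr hg hgh
  | succ m =>
    obtain ⟨q, g', hq, hg', h⟩ := hg
    refine ⟨q, g', hq, hg', ?_⟩
    filter_upwards [h, hgh] with e h1 h2 x
    rw [h2, h1]

theorem add (hg : HasExpansion k m g) (hh : HasExpansion k m h) :
    HasExpansion k m (fun e x => g e x + h e x) := by
  induction m generalizing g h with
  | zero => exact IsOrder.add hg hh
  | succ m ih =>
    obtain ⟨q, g', ⟨M, hq⟩, hg', hg⟩ := hg
    obtain ⟨u, h', ⟨N, hu⟩, hh', hh⟩ := hh
    refine ⟨fun x => q x + u x, fun e x => g' e x + h' e x, ⟨_, hq.add hu⟩, ih hg' hh', ?_⟩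
    filter_upwards [hg, hh] with e h1 h2 x
    rw [h1, h2]
    ring

theorem mul (hg : HasExpansion k m g) (hh : HasExpansion k m h) :
    HasExpansion k m (fun e x => g e x * h e x) := by
  induction m generalizing g h with
  | zero => exact IsOrder.mul hg hh
  | succ m ih =>
    have hh₀ := hh.of_succ
    obtain ⟨q, g', ⟨M, hq⟩, hg', hg⟩ := hg
    obtain ⟨u, h', ⟨N, hu⟩, hh', hh⟩ := hh
    refine ⟨fun x => q x * u x, fun e x => q x * h' e x + g' e x * h e x, ⟨_, hq.mul hu⟩,
      (ih (of_ckBound hq m) hh').add (ih hg' hh₀), ?_⟩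
    filter_upwards [hg, hh] with e h1 h2 x
    rw [h1, h2]
    ring

theorem sum {ι : Type*} {g : ι → ℝ → E → ℝ} (s : Finset ι)
    (hg : ∀ i ∈ s, HasExpansion k m (g i)) : HasExpansion k m (fun e x => ∑ i ∈ s, g i e x) := by
  classical
  induction s using Finset.induction_on with
  | empty => simpa using of_isOrder (IsOrder.zero k m)
  | insert a s ha ih =>
    simp only [Finset.sum_insert ha]
    exact (hg a (Finset.mem_insert_self a s)).add
      (ih fun i hi => hg i (Finset.mem_insert_of_mem hi))

theorem pow (hg : HasExpansion k m g) (b : ℕ) : HasExpansion k m (fun e x => g e x ^ b) := by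
  induction b with
  | zero => simpa using of_ckBound (CkBound.const (E := E) k (1 : ℝ)) m
  | succ b ih => simpa [pow_succ] using ih.mul hg

theorem mul_param (hg : HasExpansion k m g) : HasExpansion k (m + 1) (fun e x => e * g e x) :=
  ⟨fun _ => 0, g, ⟨0, CkBound.zero k⟩, hg, by simp⟩

theorem mul_param_same (hg : HasExpansion k m g) (i : ℕ) :
    HasExpansion k m (fun e x => e ^ i * g e x) := by
  induction i with
  | zero => simpa using hg
  | succ i ih => simpa [pow_succ', mul_assoc] using ih.mul_param.of_succ

/-- A family that is `O(e^j)` and has an expansion of length `j + 1` is a multiple of `e^j` up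
to `O(e^{j+1})`. -/
theorem exists_leading {j : ℕ} (hg : HasExpansion k (j + 1) g) (h0 : IsOrder k j g) :
    ∃ (q : E → ℝ), (∃ M, CkBound k M q) ∧ IsOrder k (j + 1) (fun e x => g e x - e ^ j * q x) := by
  induction j generalizing g with
  | zero =>
    obtain ⟨q, g', hq, hg', h⟩ := hg
    refine ⟨q, hq, (IsOrder.pow_mul (m := 0) hg' 1).congr ?_⟩
    filter_upwards [h] with e he x
    rw [he]
    ring
  | succ j ih =>
    obtain ⟨q, g', ⟨M, hq⟩, hg', h⟩ := hg
    -- the coefficient of `e^0` is the limit of `g`, which vanishes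
    have hq0 : ∀ x, q x = 0 := by
      intro x
      obtain ⟨C, hC⟩ := (h0.mono (Nat.zero_le k) (by omega : 1 ≤ j + 1))
      obtain ⟨C', hC'⟩ := hg'.isOrder_zero
      have h1 : ∀ᶠ e in nhdsWithin (0 : ℝ) (Set.Ioi 0), |q x| ≤ (C + C') * e := by
        filter_upwards [hC, hC', h, self_mem_nhdsWithin] with e a1 a2 a3 a4
        have a4 : 0 < e := a4
        have b1 := a1.norm_le x
        have b2 := a2.norm_le x
        rw [Real.norm_eq_abs] at b1 b2
        have b3 : q x = g e x - e * g' e x := by rw [a3]; ring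
        rw [b3]
        refine (abs_sub _ _).trans ?_
        rw [abs_mul, abs_of_pos a4]
        have := mul_le_mul_of_nonneg_left b2 a4.le
        simp only [pow_one, pow_zero, mul_one] at *
        linarith
      by_contra hne
      obtain ⟨e, h2, h3⟩ := (h1.and (eventually_mul_lt (C + C') (abs_pos.2 hne))).exists
      linarith
    have h2 : ∀ᶠ e in nhdsWithin (0 : ℝ) (Set.Ioi 0), ∀ x, e * g' e x = g e x := by
      filter_upwards [h] with e he x
      rw [he, hq0, zero_add]
    obtain ⟨u, hu, h3⟩ := ih hg' (IsOrder.of_mul (h0.congr h2))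
    refine ⟨u, hu, (h3.pow_mul 1).congr ?_⟩
    filter_upwards [h2] with e he x
    rw [← he]
    ring

end HasExpansion

end Order

/-- A polynomial of degree at most `j` that is `o(e^j)` as `e → 0+` has constant term zero. -/
theorem coeff_zero_of_isLittleO (j : ℕ) (c : ℕ → ℝ)
    (h : (fun e : ℝ => ∑ a ∈ Finset.range (j + 1), c a * e ^ a)
      =o[nhdsWithin 0 (Set.Ioi 0)] fun e => e ^ j) : c 0 = 0 := by
  have h1 : (fun e : ℝ => ∑ a ∈ Finset.range (j + 1), c a * e ^ a)
      =o[nhdsWithin 0 (Set.Ioi 0)] fun _ => (1 : ℝ) := by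
    refine h.trans_isBigO (Asymptotics.IsBigO.of_bound 1 ?_)
    filter_upwards [eventually_pos_lt one_pos] with e he
    rw [norm_one, Real.norm_of_nonneg (pow_nonneg he.1.le _), mul_one]
    exact pow_le_one₀ he.1.le he.2.le
  rw [Asymptotics.isLittleO_one_iff] at h1
  have h2 : Filter.Tendsto (fun e : ℝ => ∑ a ∈ Finset.range (j + 1), c a * e ^ a)
      (nhdsWithin 0 (Set.Ioi 0)) (nhds (∑ a ∈ Finset.range (j + 1), c a * 0 ^ a)) :=
    ((continuous_finsetSum _ fun a _ => by fun_prop).tendsto (0 : ℝ)).mono_left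
      nhdsWithin_le_nhds
  have h3 := tendsto_nhds_unique h2 h1
  rw [Finset.sum_range_succ'] at h3
  simpa using h3

/-- A polynomial of degree at most `j` that is `o(e^j)` as `e → 0+` vanishes. -/
theorem coeff_eq_zero_of_isLittleO (j : ℕ) (c : ℕ → ℝ)
    (h : (fun e : ℝ => ∑ a ∈ Finset.range (j + 1), c a * e ^ a)
      =o[nhdsWithin 0 (Set.Ioi 0)] fun e => e ^ j) : ∀ a ≤ j, c a = 0 := by
  induction j generalizing c with
  | zero => intro a ha; rw [Nat.le_zero.1 ha]; exact coeff_zero_of_isLittleO 0 c h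
  | succ j ih =>
    have hc0 := coeff_zero_of_isLittleO (j + 1) c h
    have h2 : (fun e : ℝ => ∑ a ∈ Finset.range (j + 1), c (a + 1) * e ^ a)
        =o[nhdsWithin 0 (Set.Ioi 0)] fun e => e ^ j := by
      rw [Asymptotics.isLittleO_iff] at h ⊢
      intro C hC
      filter_upwards [h hC, self_mem_nhdsWithin] with e h1 h2
      have h2 : 0 < e := h2
      rw [Finset.sum_range_succ', hc0, zero_mul, add_zero] at h1
      have h3 : ∑ a ∈ Finset.range (j + 1), c (a + 1) * e ^ (a + 1) =
          e * ∑ a ∈ Finset.range (j + 1), c (a + 1) * e ^ a := by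
        rw [Finset.mul_sum]
        exact Finset.sum_congr rfl fun a _ => by ring
      rw [h3, pow_succ, norm_mul, norm_mul, Real.norm_of_nonneg h2.le, ← mul_assoc,
        mul_comm] at h1
      exact le_of_mul_le_mul_right h1 h2
    intro a ha
    cases a with
    | zero => exact hc0
    | succ a => exact ih (fun a => c (a + 1)) h2 a (by omega)

/-- A function of class `C^j` that is a multiple `q e^j` up to `O(e^{j+1})` has `j`-th Taylor
coefficient `q`. -/
theorem iteratedDerivWithin_of_isOrder {δ : ℝ} (hδ : 0 < δ) {j : ℕ} {g : ℝ → ℝ}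
    (hg : ContDiffOn ℝ j g (Set.Ico 0 δ)) {q C : ℝ}
    (h : ∀ᶠ e in nhdsWithin (0 : ℝ) (Set.Ioi 0), |g e - e ^ j * q| ≤ C * e ^ (j + 1)) :
    iteratedDerivWithin j g (Set.Ici 0) 0 / (j.factorial : ℝ) = q := by
  -- the derivatives at `0` within `[0, ∞)` and within `[0, δ)` agree
  have hset : (Set.Ici (0 : ℝ)) =ᶠ[nhds 0] Set.Ico 0 δ := by
    filter_upwards [gt_mem_nhds hδ] with e he
    exact propext ⟨fun h => ⟨h, he⟩, fun h => h.1⟩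
  have e0 : iteratedDerivWithin j g (Set.Ici 0) 0 = iteratedDerivWithin j g (Set.Ico 0 δ) 0 := by
    rw [iteratedDerivWithin, iteratedDerivWithin, iteratedFDerivWithin_congr_set hset]
  have h1 := taylor_isLittleO (convex_Ico 0 δ) ⟨le_rfl, hδ⟩ hg
  have h2 : nhdsWithin (0 : ℝ) (Set.Ioi 0) ≤ nhdsWithin 0 (Set.Ico 0 δ) := by
    rw [← nhdsWithin_Ioo_eq_nhdsGT hδ]
    exact nhdsWithin_mono _ Set.Ioo_subset_Ico_self
  have h3 := h1.mono h2
  simp only [sub_zero] at h3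
  have h4 : (fun e : ℝ => g e - e ^ j * q) =o[nhdsWithin 0 (Set.Ioi 0)] fun e => e ^ j := by
    rw [Asymptotics.isLittleO_iff]
    intro c hc
    filter_upwards [h, self_mem_nhdsWithin, eventually_mul_lt C hc] with e a1 a2 a3
    have a2 : 0 < e := a2
    rw [Real.norm_eq_abs, Real.norm_of_nonneg (pow_nonneg a2.le _)]
    refine a1.trans ?_
    rw [pow_succ', ← mul_assoc]
    gcongr
  have h5 := (h4.sub h3)
  have h6 := coeff_eq_zero_of_isLittleO j (fun a => (a.factorial : ℝ)⁻¹ *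
    iteratedDerivWithin a g (Set.Ico 0 δ) 0 - if a = j then q else 0) (by
      refine h5.congr_left fun e => ?_
      rw [taylor_within_apply]
      simp only [sub_mul, Finset.sum_sub_distrib, ite_mul, zero_mul, Finset.sum_ite_eq',
        Finset.mem_range, Nat.lt_succ_self, if_true, sub_zero, smul_eq_mul]
      rw [Finset.sum_congr rfl fun a _ => (by ring :
        (a.factorial : ℝ)⁻¹ * e ^ a * iteratedDerivWithin a g (Set.Ico 0 δ) 0 =
        (a.factorial : ℝ)⁻¹ * iteratedDerivWithin a g (Set.Ico 0 δ) 0 * e ^ a)]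
      ring) j le_rfl
  simp only [if_true] at h6
  rw [e0, div_eq_inv_mul]
  linarith

/-! ### The averaging procedure -/

theorem CkBound.translate {E F : Type} [NormedAddCommGroup E] [NormedSpace ℝ E]
    [NormedAddCommGroup F] [NormedSpace ℝ F] {k : ℕ} {M : ℝ} {g : E → F} (hg : CkBound k M g)
    (c : E) : CkBound k M (fun x => g (x + c)) := by
  obtain ⟨C₁, -, h1⟩ := CkBound.comp_near_translation (E := E) k 0
  simpa using h1 F g (fun _ => 0) c _ 0 zero_le_one hg (CkBound.zero k)

section Averaging

variable {d N : ℕ} {p : WithTop ℕ∞} {ε₁ α₀ : ℝ} {f : ℝ → (Fin d → ℝ) → ℝ} {Ω : Fin d → ℝ}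

/-- The amount by which `Id + φ Ω` fails to conjugate `F_{α₀,e}` to the translation by `α₀ Ω`. -/
def conjugacyDefect (Ω : Fin d → ℝ) (f : ℝ → (Fin d → ℝ) → ℝ) (α₀ e : ℝ) (φ : (Fin d → ℝ) → ℝ)
    (x : Fin d → ℝ) : ℝ :=
  φ x + e * f e (x + φ x • Ω) - φ (x + α₀ • Ω)

/-- The partial sum `∑_{i<j} e^i h_i`. -/
def powerSum (h : ℕ → (Fin d → ℝ) → ℝ) (j : ℕ) (e : ℝ) (x : Fin d → ℝ) : ℝ :=
  ∑ i ∈ Finset.range j, e ^ i * h i x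

variable {h : ℕ → (Fin d → ℝ) → ℝ} {j s : ℕ}

theorem powerSum_succ (e : ℝ) (x : Fin d → ℝ) :
    powerSum h (j + 1) e x = powerSum h j e x + e ^ j * h j x := Finset.sum_range_succ _ _

theorem isOrder_powerSum (h0 : ∀ x, h 0 x = 0) (hh : ∀ i < j, ∃ M, CkBound s M (h i)) :
    IsOrder s 1 (powerSum h j) := by
  refine IsOrder.sum _ fun i hi => ?_
  cases i with
  | zero => simpa [h0] using IsOrder.zero s 1
  | succ i =>
    obtain ⟨M, hM⟩ := hh _ (Finset.mem_range.1 hi)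
    exact ((IsOrder.of_ckBound hM).pow_mul (i + 1)).mono le_rfl (by omega)

theorem hasExpansion_powerSum (hh : ∀ i < j, ∃ M, CkBound s M (h i)) (m : ℕ) :
    HasExpansion s m (powerSum h j) := by
  refine HasExpansion.sum _ fun i hi => ?_
  obtain ⟨M, hM⟩ := hh _ (Finset.mem_range.1 hi)
  exact (HasExpansion.of_ckBound hM m).mul_param_same i

theorem IsTorusFamily.isOrder_zero (hf : IsTorusFamily N p ε₁ f) (hε₁ : 0 < ε₁)
    (hs : (s : WithTop ℕ∞) ≤ p) : IsOrder s 0 f := by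
  obtain ⟨C, hC⟩ := hf.exists_taylor_bound hε₁ (m := 0) hs (Nat.zero_le _)
  refine ⟨C, ?_⟩
  filter_upwards [eventually_pos_lt (half_pos hε₁)] with e he
  simpa using hC e ⟨he.1.le, he.2.le⟩

theorem eventually_ckBound_fderiv_id (k : ℕ) :
    ∃ D, 0 ≤ D ∧ ∀ᶠ _ in nhdsWithin (0 : ℝ) (Set.Ioi 0),
      Differentiable ℝ (fun x : Fin d → ℝ => x) ∧
        CkBound (k - 1) D (fderiv ℝ (fun x : Fin d → ℝ => x)) := by
  refine ⟨_, norm_nonneg (ContinuousLinearMap.id ℝ (Fin d → ℝ)), Filter.Eventually.of_forall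
    fun _ => ⟨differentiable_id, ?_⟩⟩
  exact (CkBound.const _ (ContinuousLinearMap.id ℝ (Fin d → ℝ))).congr fun x => fderiv_fun_id

/-- The composition of a family with a perturbation `Id + φ Ω` of the identity has an expansion:
expand `f` in the parameter, and then each coefficient along `Ω`. This costs `j` derivatives. -/
theorem IsTorusFamily.hasExpansion_comp (hf : IsTorusFamily N p ε₁ f) (hε₁ : 0 < ε₁)
    {φ : ℝ → (Fin d → ℝ) → ℝ} (hj : j ≤ N) (hs : ((s + j : ℕ) : WithTop ℕ∞) ≤ p)
    (hφ1 : IsOrder s 1 φ) (hφ : HasExpansion s j φ) :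
    HasExpansion s j (fun e x => f e (x + φ e x • Ω)) := by
  have h0 : (0 : ℝ) ∈ Set.Ico 0 ε₁ := ⟨le_rfl, hε₁⟩
  have hs' : (s : WithTop ℕ∞) ≤ p := le_trans (by exact_mod_cast Nat.le_add_right s j) hs
  have hrem : IsOrder (s + 0) j (fun e x => f e x -
      ∑ a ∈ Finset.range j, (e ^ a / (a.factorial : ℝ)) • paramDeriv ε₁ f a 0 x) := by
    obtain ⟨C, hC⟩ := hf.exists_taylor_bound hε₁ hs' hj
    refine ⟨C, ?_⟩
    filter_upwards [eventually_pos_lt (half_pos hε₁)] with e he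
    exact hC e ⟨he.1.le, he.2.le⟩
  have h1 := hrem.taylorRem Ω (eventually_ckBound_fderiv_id s) hφ1 le_rfl
  have h2 : ∀ a ∈ Finset.range j, HasExpansion s j fun e x =>
      e ^ a * ((a.factorial : ℝ)⁻¹ * paramDeriv ε₁ f a 0 (x + φ e x • Ω)) := by
    intro a ha
    refine HasExpansion.mul_param_same ((HasExpansion.of_ckBound
      (CkBound.const s ((a.factorial : ℝ)⁻¹)) j).mul ?_) a
    obtain ⟨M, hM⟩ := (hf.periodic_paramDeriv a h0).exists_ckBound (k := s + j)
      ((hf.contDiff_space a (by have := Finset.mem_range.1 ha; omega) 0 h0).of_le hs)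
    have h3 := (IsOrder.of_ckBound hM).taylorRem Ω (eventually_ckBound_fderiv_id s) hφ1 le_rfl
    have h4 : HasExpansion s j fun e x => ∑ b ∈ Finset.range j, φ e x ^ b *
        ((b.factorial : ℝ)⁻¹ * ((dirDeriv Ω)^[b] (paramDeriv ε₁ f a 0)) x) := by
      refine HasExpansion.sum _ fun b hb => (hφ.pow b).mul (HasExpansion.mul
        (HasExpansion.of_ckBound (CkBound.const s ((b.factorial : ℝ)⁻¹)) j)
        (HasExpansion.of_ckBound ((hM.mono_order ?_).iterate_dirDeriv Ω b) j))
      have := Finset.mem_range.1 hb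
      omega
    refine (h4.add (HasExpansion.of_isOrder (h3.mono le_rfl (by omega)))).congr
      (Filter.Eventually.of_forall fun e x => ?_)
    simp only [taylorRem, smul_eq_mul, div_eq_mul_inv, mul_assoc]
    ring
  refine ((HasExpansion.sum _ h2).add (HasExpansion.of_isOrder (h1.mono le_rfl (by omega)))).congr
    (Filter.Eventually.of_forall fun e x => ?_)
  simp only [taylorRem, smul_eq_mul, div_eq_mul_inv, mul_assoc, Finset.range_zero,
    Finset.sum_empty]
  ring

theorem IsTorusFamily.hasExpansion_conjugacyDefect (hf : IsTorusFamily N p ε₁ f) (hε₁ : 0 < ε₁)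
    (hj : j ≤ N) (hs : ((s + j : ℕ) : WithTop ℕ∞) ≤ p) (h0 : ∀ x, h 0 x = 0)
    (hh : ∀ i < j, ∃ M, CkBound s M (h i)) :
    HasExpansion s (j + 1) (fun e => conjugacyDefect Ω f α₀ e (powerSum h j e)) := by
  have h1 := (hf.hasExpansion_comp (Ω := Ω) hε₁ hj hs (isOrder_powerSum h0 hh)
    (hasExpansion_powerSum hh j)).mul_param
  have h2 : HasExpansion s (j + 1) (powerSum (fun i x => -h i (x + α₀ • Ω)) j) :=
    hasExpansion_powerSum (fun i hi => by
      obtain ⟨M, hM⟩ := hh i hi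
      exact ⟨M, (hM.translate _).neg⟩) _
  refine (((hasExpansion_powerSum hh (j + 1)).add h1).add h2).congr
    (Filter.Eventually.of_forall fun e x => ?_)
  simp only [conjugacyDefect, powerSum, mul_neg, Finset.sum_neg_distrib]
  ring

theorem IsTorusFamily.contDiffOn_conjugacyDefect (hf : IsTorusFamily N p ε₁ f)
    (hN : (N : WithTop ℕ∞) ≤ p) (hj : j ≤ N) (x : Fin d → ℝ) :
    ContDiffOn ℝ j (fun e => conjugacyDefect Ω f α₀ e (powerSum h j e) x) (Set.Ico 0 ε₁) := by
  have h1 : ∀ x, ContDiff ℝ j (fun e => powerSum h j e x) := fun x =>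
    ContDiff.sum fun i _ => (contDiff_id.pow i).mul contDiff_const
  have h2 : ContDiffOn ℝ j (fun e => f e (x + powerSum h j e x • Ω)) (Set.Ico 0 ε₁) :=
    ((hf.contDiffOn hN).of_le (by exact_mod_cast hj)).comp
      (contDiff_id.prodMk (contDiff_const.add ((h1 x).smul contDiff_const))).contDiffOn
      fun e he => ⟨he, trivial⟩
  exact ((h1 x).contDiffOn.add (contDiffOn_id.mul h2)).sub (h1 _).contDiffOn

theorem isPeriodic_powerSum (hper : ∀ i, IsPeriodic (h i)) (e : ℝ) :
    IsPeriodic (powerSum h j e) := fun x m =>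
  Finset.sum_congr rfl fun i _ => by rw [hper i x m]

theorem IsTorusFamily.isPeriodic_conjugacyDefect (hf : IsTorusFamily N p ε₁ f)
    {φ : (Fin d → ℝ) → ℝ} (hφ : IsPeriodic φ) {e : ℝ} (he : e ∈ Set.Ico 0 ε₁) :
    IsPeriodic (conjugacyDefect Ω f α₀ e φ) := by
  intro x m
  have h1 : ∀ y, φ (y + fun i => (m i : ℝ)) = φ y := fun y => hφ y m
  have h2 : ∀ y, f e (y + fun i => (m i : ℝ)) = f e y := fun y => hf.periodic e he y m
  have h3 : ∀ v, x + (fun i => (m i : ℝ)) + v = x + v + fun i => (m i : ℝ) :=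
    fun v => add_right_comm _ _ _
  change conjugacyDefect Ω f α₀ e φ (x + fun i => (m i : ℝ)) = _
  simp only [conjugacyDefect, h1, h3, h2]

end Averaging

section NormalForm

variable {r n : ℕ} {p : WithTop ℕ∞} {ε₁ α₀ ν τ : ℝ} {f : ℝ → (Fin (r + 1) → ℝ) → ℝ}
  {Ω : Fin (r + 1) → ℝ} {A : Matrix.SpecialLinearGroup (Fin (r + 1)) ℤ} {ω : Fin r → ℝ}
  {L : Fin (r + 1) → ℤ} {j s σ : ℕ}

/-- The term `h_j` of order `ε^j` in the conjugacy to the resonant normal form. -/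
def conjugacyTerm (Ω : Fin (r + 1) → ℝ) (f : ℝ → (Fin (r + 1) → ℝ) → ℝ) (α₀ : ℝ)
    (A : Matrix.SpecialLinearGroup (Fin (r + 1)) ℤ) (ω : Fin r → ℝ) (j : ℕ) :
    (Fin (r + 1) → ℝ) → ℝ :=
  cohomologySolution A ω (orderTerm Ω f α₀ A ω j)

/-- As long as the normal form terms `P_i`, `i < j`, vanish, `orderTerm j` is a Taylor coefficient
of the defect of the conjugacy to the translation by `α₀ Ω`. -/
theorem orderTerm_eq (hP : ∀ i < j, ∀ t, normalFormTerm Ω f α₀ A ω i t = 0)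
    (x : Fin (r + 1) → ℝ) :
    orderTerm Ω f α₀ A ω j x = iteratedDerivWithin j (fun e => conjugacyDefect Ω f α₀ e
      (powerSum (conjugacyTerm Ω f α₀ A ω) j e) x) (Set.Ici 0) 0 / (j.factorial : ℝ) := by
  have h1 : ∀ (i : Fin j) t, resonantPart A (orderTerm Ω f α₀ A ω i) t = 0 :=
    fun i t => hP i i.2 t
  have h2 : ∀ e y, ∑ i : Fin j, e ^ (i : ℕ) *
      cohomologySolution A ω (orderTerm Ω f α₀ A ω i) y =
      powerSum (conjugacyTerm Ω f α₀ A ω) j e y := fun e y =>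
    Fin.sum_univ_eq_sum_range (fun i => e ^ i * conjugacyTerm Ω f α₀ A ω i y) j
  rw [orderTerm]
  simp only [h1, h2, comp, T, mul_zero, Finset.sum_const_zero, add_zero, conjugacyDefect]
  congr 2
  funext e
  ring

theorem orderTerm_zero (x : Fin (r + 1) → ℝ) : orderTerm Ω f α₀ A ω 0 x = 0 := by
  rw [orderTerm_eq (fun i hi => absurd hi (Nat.not_lt_zero i))]
  simp [conjugacyDefect, powerSum]

theorem fourierCoeffIn_zero {p : (Fin (r + 1) → ℝ) → ℝ} (hp : ∀ x, p x = 0)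
    (k : Fin (r + 1) → ℤ) : fourierCoeffIn A p k = 0 := by
  simp [fourierCoeffIn, hp]

theorem normalFormTerm_zero (t : ℝ) : normalFormTerm Ω f α₀ A ω 0 t = 0 := by
  simp [normalFormTerm, resonantPart, fourierCoeffIn_zero orderTerm_zero]

theorem conjugacyTerm_zero (x : Fin (r + 1) → ℝ) : conjugacyTerm Ω f α₀ A ω 0 x = 0 := by
  simp [conjugacyTerm, cohomologySolution, fourierCoeffIn_zero orderTerm_zero]

theorem isPeriodic_conjugacyTerm (j : ℕ) : IsPeriodic (conjugacyTerm Ω f α₀ A ω j) :=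
  isPeriodic_cohomologySolution

theorem IsFirstOrder.eq_zero_of_lt (hn : IsFirstOrder Ω f α₀ A ω n) {i : ℕ} (hi : i < n) (t : ℝ) :
    normalFormTerm Ω f α₀ A ω i t = 0 := by
  cases i with
  | zero => exact normalFormTerm_zero t
  | succ i => exact hn.before _ (by omega) hi t

/-- One step of the averaging procedure: the term `p_j` is the leading coefficient of the defect,
and the solution `h_j` of the cohomology equation removes its nonresonant part, at the cost of
`σ` derivatives. -/
theorem averaging_step (hf : IsTorusFamily n p ε₁ f) (hε₁ : 0 < ε₁) (hN : (n : WithTop ℕ∞) ≤ p)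
    (hA : IsIntrinsicFrequency A ω L (α₀ • Ω)) (hν : 0 < ν) (hτ : 0 < τ)
    (hω : IsDiophantine ν τ ω) (hσ : r = 0 ∨ τ + (r + 1 : ℝ) / 2 < σ) (hσ1 : 1 ≤ σ)
    (hj1 : 1 ≤ j) (hj : j ≤ n)
    (hP : ∀ i < j, ∀ t, normalFormTerm Ω f α₀ A ω i t = 0)
    (hs : ((s + σ + j : ℕ) : WithTop ℕ∞) ≤ p)
    (hh : ∀ i < j, ∃ M, CkBound (s + σ) M (conjugacyTerm Ω f α₀ A ω i))
    (hD : IsOrder (s + σ) j fun e =>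
      conjugacyDefect Ω f α₀ e (powerSum (conjugacyTerm Ω f α₀ A ω) j e)) :
    IsPeriodic (orderTerm Ω f α₀ A ω j) ∧ ContDiff ℝ (s + σ : ℕ) (orderTerm Ω f α₀ A ω j) ∧
    (∃ M, CkBound s M (conjugacyTerm Ω f α₀ A ω j)) ∧
    IsOrder s (j + 1) fun e x =>
      conjugacyDefect Ω f α₀ e (powerSum (conjugacyTerm Ω f α₀ A ω) (j + 1) e) x -
        e ^ j * normalFormTerm Ω f α₀ A ω j (act A x (Fin.last r)) := by
  set h := conjugacyTerm Ω f α₀ A ω with hh_def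
  obtain ⟨q, ⟨M, hq⟩, hlead⟩ := (hf.hasExpansion_conjugacyDefect (Ω := Ω) (α₀ := α₀) hε₁ hj hs
    conjugacyTerm_zero hh).exists_leading hD
  have hqp : ∀ x, orderTerm Ω f α₀ A ω j x = q x := by
    intro x
    rw [orderTerm_eq hP]
    obtain ⟨C, hC⟩ := hlead
    exact iteratedDerivWithin_of_isOrder hε₁ (hf.contDiffOn_conjugacyDefect hN hj x)
      (hC.mono fun e he => he.norm_le x)
  have hqfun : orderTerm Ω f α₀ A ω j = q := funext hqp
  have hper : IsPeriodic (orderTerm Ω f α₀ A ω j) := by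
    intro x m
    rw [orderTerm_eq hP, orderTerm_eq hP]
    congr 1
    have hset : Set.Ico (0 : ℝ) ε₁ ∈ nhdsWithin (0 : ℝ) (Set.Ici 0) :=
      Ico_mem_nhdsGE hε₁
    have hcongr : (fun e => conjugacyDefect Ω f α₀ e (powerSum h j e) fun i => x i + (m i : ℝ))
        =ᶠ[nhdsWithin 0 (Set.Ici 0)] fun e => conjugacyDefect Ω f α₀ e (powerSum h j e) x := by
      filter_upwards [hset] with e he
      exact hf.isPeriodic_conjugacyDefect (isPeriodic_powerSum isPeriodic_conjugacyTerm e) he x m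
    rw [iteratedDerivWithin, iteratedDerivWithin,
      hcongr.iteratedFDerivWithin_eq (𝕜 := ℝ) (hcongr.self_of_nhdsWithin Set.self_mem_Ici)]
  have hcd : ContDiff ℝ (s + σ : ℕ) (orderTerm Ω f α₀ A ω j) := by rw [hqfun]; exact hq.1
  have hhj : ∃ M, CkBound s M (h j) := (isPeriodic_conjugacyTerm j).exists_ckBound
    (contDiff_cohomologySolution hν hτ hω hσ hper hcd)
  refine ⟨hper, hcd, hhj, ?_⟩
  have hcoh : ∀ x, h j (x + α₀ • Ω) - h j x = q x -
      normalFormTerm Ω f α₀ A ω j (act A x (Fin.last r)) := fun x => by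
    rw [← hqp]
    exact cohomologySolution_shift_sub hA hν hτ hω hσ hσ1 hper hcd x
  obtain ⟨Mj, hMj⟩ := hhj
  have hs1 : ((s + 1 : ℕ) : WithTop ℕ∞) ≤ p := le_trans (by exact_mod_cast (by omega)) hs
  have hθ : ∃ D, 0 ≤ D ∧ ∀ᶠ e in nhdsWithin (0 : ℝ) (Set.Ioi 0),
      Differentiable ℝ (fun x : Fin (r + 1) → ℝ => x + powerSum h j e x • Ω) ∧
      CkBound (s - 1) D (fderiv ℝ fun x : Fin (r + 1) → ℝ => x + powerSum h j e x • Ω) := by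
    obtain ⟨C, hC⟩ := (isOrder_powerSum conjugacyTerm_zero hh).mono
      (by omega : s + 1 ≤ s + σ) (Nat.zero_le 1)
    obtain ⟨D, hD, h1⟩ := eventually_ckBound_fderiv_id (d := r + 1) (s + 1)
    refine ⟨D + |C| * ‖Ω‖, by positivity, ?_⟩
    filter_upwards [hC, h1] with e h2 h1
    have h3 := h2.smul_const Ω
    refine ⟨h1.1.add h3.differentiable, ?_⟩
    refine ((h1.2.mono_order (Nat.sub_le s 1)).add (h3.fderiv.mono_order (Nat.sub_le s 1))
      |>.mono_const ?_).congr fun x => fderiv_fun_add (h1.1 x) (h3.differentiable x)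
    gcongr
    simpa using le_abs_self C
  -- adding `e^j h_j` to the conjugacy changes `e f_e ∘ (Id + φ Ω)` by `O(e^{j+1})` only
  have hdiff := ((hf.isOrder_zero hε₁ hs1).taylorRem (j := 1) Ω hθ
    (φ := fun e x => e ^ j * h j x) (m₁ := j)
    (((IsOrder.of_ckBound hMj).pow_mul j).mono le_rfl (by omega)) hj1).pow_mul 1
  refine ((hlead.mono (by omega : s ≤ s + σ) le_rfl).add
    (hdiff.mono le_rfl (by omega))).congr (Filter.Eventually.of_forall fun e x => ?_)
  have hc := hcoh x
  simp only [conjugacyDefect, powerSum_succ, taylorRem, Finset.sum_range_one, pow_zero,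
    Nat.factorial_zero, Nat.cast_one, div_one, one_smul, Function.iterate_zero, id_eq, pow_one,
    add_assoc, ← add_smul]
  linear_combination (-e ^ j) * hc

/-- The averaging procedure up to the order `n`. At the order `j` all functions are of class
`C^{s + (n+1-j)σ}`: each step costs `σ` derivatives, and `s` are left after the step `j = n`. -/
theorem averaging (hf : IsTorusFamily n p ε₁ f) (hε₁ : 0 < ε₁) (hN : (n : WithTop ℕ∞) ≤ p)
    (hA : IsIntrinsicFrequency A ω L (α₀ • Ω)) (hν : 0 < ν) (hτ : 0 < τ)
    (hω : IsDiophantine ν τ ω) (hσ : r = 0 ∨ τ + (r + 1 : ℝ) / 2 < σ) (hσ1 : 1 ≤ σ)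
    (hP : ∀ i < n, ∀ t, normalFormTerm Ω f α₀ A ω i t = 0)
    (hs : ((s + n * σ + 1 : ℕ) : WithTop ℕ∞) ≤ p) (hj1 : 1 ≤ j) (hj : j ≤ n) :
    (∀ i < j, ∃ M, CkBound (s + (n + 1 - j) * σ) M (conjugacyTerm Ω f α₀ A ω i)) ∧
    IsOrder (s + (n + 1 - j) * σ) j fun e =>
      conjugacyDefect Ω f α₀ e (powerSum (conjugacyTerm Ω f α₀ A ω) j e) := by
  induction j, hj1 using Nat.le_induction with
  | base =>
    refine ⟨fun i hi => ?_, ?_⟩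
    · obtain rfl : i = 0 := by omega
      exact ⟨0, (CkBound.zero _).congr conjugacyTerm_zero⟩
    · refine ((hf.isOrder_zero hε₁ (le_trans ?_ hs)).pow_mul 1).congr
        (Filter.Eventually.of_forall fun e x => ?_)
      · rw [Nat.add_sub_cancel]
        exact_mod_cast (by omega)
      · simp [conjugacyDefect, powerSum, conjugacyTerm_zero]
  | succ j hj1 ih =>
    obtain ⟨ih1, ih2⟩ := ih (by omega)
    have e1 : s + (n + 1 - j) * σ = s + (n + 1 - (j + 1)) * σ + σ := by
      rw [show n + 1 - j = n + 1 - (j + 1) + 1 by omega]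
      ring
    have e2 : s + (n + 1 - (j + 1)) * σ + σ + j ≤ s + n * σ + 1 := by
      obtain ⟨a, rfl⟩ : ∃ a, n = j + a := ⟨n - j, by omega⟩
      obtain ⟨b, rfl⟩ : ∃ b, j = 1 + b := ⟨j - 1, by omega⟩
      rw [show 1 + b + a + 1 - (1 + b + 1) = a by omega]
      have : b ≤ b * σ := Nat.le_mul_of_pos_right b hσ1
      nlinarith
    rw [e1] at ih1 ih2
    obtain ⟨-, -, h3, h4⟩ := averaging_step hf hε₁ hN hA hν hτ hω hσ hσ1 hj1 (by omega)
      (fun i hi => hP i (by omega)) (le_trans (by exact_mod_cast e2) hs) ih1 ih2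
    refine ⟨fun i hi => ?_, ?_⟩
    · rcases Nat.lt_succ_iff_lt_or_eq.1 hi with hi | rfl
      · obtain ⟨M, hM⟩ := ih1 i hi
        exact ⟨M, hM.mono_order (Nat.le_add_right _ _)⟩
      · exact h3
    · refine h4.congr (Filter.Eventually.of_forall fun e x => ?_)
      rw [hP j (by omega)]
      simp

theorem normalFormTerm_add_one (j : ℕ) (t : ℝ) :
    normalFormTerm Ω f α₀ A ω j (t + 1) = normalFormTerm Ω f α₀ A ω j t := by
  simp only [normalFormTerm, resonantPart]
  congr 2
  funext l
  congr 1
  have : 2 * Real.pi * Complex.I * l * ((t + 1 : ℝ) : ℂ) =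
      2 * Real.pi * Complex.I * l * (t : ℂ) + l * (2 * Real.pi * Complex.I) := by
    push_cast
    ring
  rw [this, Complex.exp_add, Complex.exp_int_mul_two_pi_mul_I, mul_one]

theorem exists_ckBound_of_add_one {P : ℝ → ℝ} {k : ℕ} (hP : ∀ t, P (t + 1) = P t)
    (hc : ContDiff ℝ k P) : ∃ M, CkBound k M P := by
  refine CkBound.exists_of_invariant hc (isCompact_Icc (a := (0 : ℝ)) (b := 1)) fun t =>
    ⟨-⌊t⌋, ⟨?_, ?_⟩, fun y => ?_⟩
  · linarith [Int.floor_le t]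
  · linarith [Int.lt_floor_add_one t]
  · have h : Function.Periodic P 1 := hP
    have := h.int_mul (-⌊t⌋) y
    simpa using this

/-- The resonant normal form of order `n`: the conjugacy `Id + φ_e Ω`, with
`φ_e = ∑_{i≤n} e^i h_i`, brings `F_{α₀,e}` to the map with `α₀ + e^n P_n((A x)_d)` in front of `Ω`,
up to `O(e^{n+1})`. -/
theorem exists_resonant_normal_form {q ℓ : ℕ} (hf : IsTorusFamily n p ε₁ f) (hε₁ : 0 < ε₁)
    (hA : IsIntrinsicFrequency A ω L (α₀ • Ω)) (hν : 0 < ν) (hτ : 0 < τ)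
    (hω : IsDiophantine ν τ ω) (hq : (n : ℝ) * ((r + 1 : ℝ) + τ) ≤ q)
    (hp : ((q + ℓ + 4 : ℕ) : WithTop ℕ∞) ≤ p) (hn : IsFirstOrder Ω f α₀ A ω n) :
    ∃ φ : ℝ → (Fin (r + 1) → ℝ) → ℝ, (∀ e, IsPeriodic (φ e)) ∧ IsOrder (ℓ + 3) 1 φ ∧
      (∃ M, CkBound (ℓ + 3) M (normalFormTerm Ω f α₀ A ω n)) ∧
      IsOrder (ℓ + 3) (n + 1) fun e x => conjugacyDefect Ω f α₀ e (φ e) x -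
        e ^ n * normalFormTerm Ω f α₀ A ω n (act A x (Fin.last r)) := by
  have hn1 := hn.one_le
  -- the largest integer loss compatible with `hq`; it exceeds `τ + d / 2` if `d = r + 1 ≥ 2`
  set σ : ℕ := ⌊(r + 1 : ℝ) + τ⌋₊ with hσ_def
  have hσle : (σ : ℝ) ≤ (r + 1 : ℝ) + τ := Nat.floor_le (by positivity)
  have hσlt : (r + 1 : ℝ) + τ < σ + 1 := Nat.lt_floor_add_one _
  have hσ1 : 1 ≤ σ := by
    rw [hσ_def, Nat.one_le_floor_iff]
    have : (0 : ℝ) ≤ r := Nat.cast_nonneg r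
    linarith
  have hσ : r = 0 ∨ τ + (r + 1 : ℝ) / 2 < σ := by
    rcases Nat.eq_zero_or_pos r with h | h
    · exact Or.inl h
    · right
      have : (1 : ℝ) ≤ r := by exact_mod_cast h
      linarith
  have hnσ : n * σ ≤ q := by
    have : (n : ℝ) * σ ≤ q := (mul_le_mul_of_nonneg_left hσle (Nat.cast_nonneg n)).trans hq
    exact_mod_cast this
  have hnq : n ≤ q := le_trans (Nat.le_mul_of_pos_right n hσ1) hnσ
  have hN : (n : WithTop ℕ∞) ≤ p := le_trans (by exact_mod_cast (by omega)) hp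
  have hs : ((ℓ + 3 + n * σ + 1 : ℕ) : WithTop ℕ∞) ≤ p :=
    le_trans (by exact_mod_cast (by omega)) hp
  have hs' : ((ℓ + 3 + σ + n : ℕ) : WithTop ℕ∞) ≤ p := by
    refine le_trans ?_ hs
    obtain ⟨b, rfl⟩ : ∃ b, n = 1 + b := ⟨n - 1, by omega⟩
    have : b ≤ b * σ := Nat.le_mul_of_pos_right b hσ1
    have : ℓ + 3 + σ + (1 + b) ≤ ℓ + 3 + (1 + b) * σ + 1 := by nlinarith
    exact_mod_cast this
  obtain ⟨h1, h2⟩ := averaging hf hε₁ hN hA hν hτ hω hσ hσ1 (fun i hi => hn.eq_zero_of_lt hi) hs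
    hn1 le_rfl
  rw [Nat.add_sub_cancel_left, one_mul] at h1 h2
  obtain ⟨h3, h4, h5, h6⟩ := averaging_step hf hε₁ hN hA hν hτ hω hσ hσ1 hn1 le_rfl
    (fun i hi => hn.eq_zero_of_lt hi) hs' h1 h2
  have hall : ∀ i < n + 1, ∃ M, CkBound (ℓ + 3) M (conjugacyTerm Ω f α₀ A ω i) := by
    intro i hi
    rcases Nat.lt_succ_iff_lt_or_eq.1 hi with hi | rfl
    · obtain ⟨M, hM⟩ := h1 i hi
      exact ⟨M, hM.mono_order (Nat.le_add_right _ _)⟩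
    · exact h5
  refine ⟨powerSum (conjugacyTerm Ω f α₀ A ω) (n + 1),
    isPeriodic_powerSum isPeriodic_conjugacyTerm, isOrder_powerSum conjugacyTerm_zero hall,
    exists_ckBound_of_add_one (normalFormTerm_add_one n) ?_, h6⟩
  -- the cohomology equation on the line `act A x = (0, t)` expresses `P_n` in terms of `p_n`, `h_n`
  have h7 : ∀ t, normalFormTerm Ω f α₀ A ω n t =
      orderTerm Ω f α₀ A ω n (act A⁻¹ (t • Pi.single (Fin.last r) 1)) -
        (conjugacyTerm Ω f α₀ A ω n (act A⁻¹ (t • Pi.single (Fin.last r) 1) + α₀ • Ω) -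
          conjugacyTerm Ω f α₀ A ω n (act A⁻¹ (t • Pi.single (Fin.last r) 1))) := by
    intro t
    have := cohomologySolution_shift_sub hA hν hτ hω hσ hσ1 h3 h4
      (act A⁻¹ (t • Pi.single (Fin.last r) 1))
    rw [act_act_inv] at this
    simp only [Pi.smul_apply, Pi.single_eq_same, smul_eq_mul, mul_one] at this
    rw [conjugacyTerm, this, normalFormTerm]
    ring
  obtain ⟨M, hM⟩ := h5
  have hline : ContDiff ℝ (ℓ + 3 : ℕ)
      fun t : ℝ => act A⁻¹ (t • (Pi.single (Fin.last r) 1 : Fin (r + 1) → ℝ)) :=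
    (contDiff_act A⁻¹).comp (contDiff_id.smul contDiff_const)
  rw [show normalFormTerm Ω f α₀ A ω n = _ from funext h7]
  exact ((h4.of_le (by exact_mod_cast (by omega))).comp hline).sub
    ((hM.1.comp (hline.add contDiff_const)).sub (hM.1.comp hline))

end NormalForm

/-! ### Estimates for the graph equation -/

section GraphRem

variable {S V : Type} [NormedAddCommGroup S] [NormedSpace ℝ S] [NormedAddCommGroup V]
  [NormedSpace ℝ V]

/-- On a ball of radius `R` a function is `K R`-Lipschitz close to its linearization at the
centre. -/
theorem CkBound.norm_sub_sub_fderiv_le {F : Type} [NormedAddCommGroup F] [NormedSpace ℝ F]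
    {g : V → F} {K R : ℝ} (hg : CkBound 2 K g) {x₀ x y : V} (hx : ‖x - x₀‖ ≤ R)
    (hy : ‖y - x₀‖ ≤ R) : ‖g x - g y - _root_.fderiv ℝ g x₀ (x - y)‖ ≤ K * R * ‖x - y‖ := by
  have hK := hg.nonneg
  refine Convex.norm_image_sub_le_of_norm_hasFDerivWithin_le' (𝕜 := ℝ)
    (s := Metric.closedBall x₀ R)
    (fun y _ => (hg.differentiable y).hasFDerivAt.hasFDerivWithinAt) (fun y hy => ?_)
    (convex_closedBall _ _) (by simpa [dist_eq_norm] using hy) (by simpa [dist_eq_norm] using hx)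
  refine (hg.fderiv.lipschitz y x₀).trans ?_
  gcongr
  simpa [dist_eq_norm] using hy

/-- A second difference is bounded by the product of the two increments. -/
theorem CkBound.norm_double_difference_le {F : Type} [NormedAddCommGroup F] [NormedSpace ℝ F]
    {g : V → F} {K : ℝ} (hg : CkBound 2 K g) (x x' y : V) :
    ‖(g x - g (x + y)) - (g x' - g (x' + y))‖ ≤ K * ‖y‖ * ‖x - x'‖ := by
  have hder : ∀ x, HasFDerivAt (fun x => g x - g (x + y))
      (_root_.fderiv ℝ g x - _root_.fderiv ℝ g (x + y)) x := fun x =>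
    (hg.differentiable x).hasFDerivAt.fun_sub
      ((hasFDerivAt_comp_add_right y).2 (hg.differentiable (x + y)).hasFDerivAt)
  have hbd : ∀ x, ‖_root_.fderiv ℝ g x - _root_.fderiv ℝ g (x + y)‖ ≤ K * ‖y‖ := fun x => by
    simpa using hg.fderiv.lipschitz x (x + y)
  exact Convex.norm_image_sub_le_of_norm_hasFDerivWithin_le (𝕜 := ℝ)
    (fun x _ => (hder x).hasFDerivWithinAt) (fun x _ => hbd x) convex_univ
    (Set.mem_univ x') (Set.mem_univ x)

/-- The perturbation in the equation `t = γ u + R(s, u, t)` for an invariant graph near a zero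
`x₂` of `P` with `P' x₂ = γ`. With `a` and `e` in place of `u` and `t`, the source of the point of
the graph over `s` is `z = J s + a v - (μ e) w₀ + y₀`, its resonant coordinate is
`x₂ + a - μ b₀ e`, and `z + α₀ Ω` is `J s + a v - (μ e) w₀ + z₀`. The function `φ` is the conjugacy,
`ψ` the error in the normal form and `δ` the offset `α - α₀`. -/
def graphRem (γ x₂ b₀ μ δ : ℝ) (J : S →L[ℝ] V) (v Ω w₀ z₀ y₀ : V) (P : ℝ → ℝ) (φ ψ : V → ℝ)
    (s : S) (a e : ℝ) : ℝ :=
  P (x₂ + (a - μ * b₀ * e)) - γ * a +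
    μ⁻¹ * (φ (J s + a • v - (μ * e) • w₀ + z₀) - φ (J s + a • v - (μ * e) • w₀ + z₀ + (μ * e) • Ω) +
      ψ (J s + a • v - (μ * e) • w₀ + y₀) + δ)

/-- On functions `u`, `t` of size `ρ` in `C^{k+1}` the perturbation is of size `ρ² + ε` in
`C^{k+1}`: the terms containing `P` are quadratic, the difference of the values of `φ` is of size
`ε μ`, the error `ψ` and the offset `δ` of the parameter are of size `ε μ`, and the last three are
divided by `μ`. -/
theorem exists_graphRem_ckBound (k : ℕ) (γ b₀ K M : ℝ) (hK : 0 ≤ K) (hM : 1 ≤ M)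
    (J : S →L[ℝ] V) (v Ω w₀ : V) :
    ∃ C, 0 ≤ C ∧ ∀ (P : ℝ → ℝ) (φ ψ : V → ℝ) (x₂ μ ε δ ρ : ℝ) (z₀ y₀ : V), 0 < μ → μ ≤ ε →
      ε ≤ 1 → 0 ≤ ρ → (1 + |b₀|) * M * ρ ≤ 1 → P x₂ = 0 → deriv P x₂ = γ → CkBound (k + 3) K P →
      CkBound (k + 3) (K * ε) φ → CkBound (k + 3) (K * ε * μ) ψ → |δ| ≤ K * ε * μ →
      ∀ u t : S → ℝ, CkBound (k + 1) ρ u → CkBound (k + 1) (M * ρ) t →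
        CkBound (k + 1) (C * (ρ ^ 2 + ε))
          (fun s => graphRem γ x₂ b₀ μ δ J v Ω w₀ z₀ y₀ P φ ψ s (u s) (t s)) := by
  set D := ‖J‖ + ‖v‖ + ‖w₀‖ with hD_def
  have hD : 0 ≤ D := by positivity
  obtain ⟨C₁, hC₁, h1⟩ := CkBound.taylorRem (E := S) (F := ℝ) 1 le_rfl (k + 1) 2
  obtain ⟨C₂, hC₂, h2⟩ := CkBound.taylorRem (E := S) (F := V) Ω hD (k + 1) 1
  obtain ⟨C₃, hC₃, h3⟩ := CkBound.taylorRem (E := S) (F := V) Ω hD (k + 1) 0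
  set B := (1 + |b₀|) * M with hB_def
  have hB1 : M ≤ B := by
    rw [hB_def]; nlinarith [abs_nonneg b₀]
  have hM0 : 0 ≤ M := zero_le_one.trans hM
  have hB0 : 0 ≤ B := hM0.trans hB1
  refine ⟨C₁ * K * B ^ 2 + |γ| * |b₀| * M + C₂ * K * M + C₃ * K + K, by positivity, ?_⟩
  intro P φ ψ x₂ μ ε δ ρ z₀ y₀ hμ hμε hε hρ hBρ hP0 hPγ hP hφ hψ hδ u t hu ht
  have hε0 : 0 < ε := hμ.trans_le hμε
  have hμ1 : μ ≤ 1 := hμε.trans hε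
  have hMρ1 : M * ρ ≤ 1 := (mul_le_mul_of_nonneg_right hB1 hρ).trans hBρ
  have hρ1 : ρ ≤ 1 := le_trans (le_mul_of_one_le_left hρ hM) hMρ1
  have hMρ : 0 ≤ M * ρ := mul_nonneg hM0 hρ
  have hμMρ : μ * (M * ρ) ≤ 1 := mul_le_one₀ hμ1 hMρ hMρ1
  have hθ : ∀ z : V, Differentiable ℝ (fun s => J s + u s • v - (μ * t s) • w₀ + z) ∧
      CkBound (k + 1 - 1) D (fderiv ℝ fun s => J s + u s • v - (μ * t s) • w₀ + z) := by
    intro z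
    have a1 := hu.smul_const v
    have a2 := (ht.const_mul μ).smul_const w₀
    have hd : Differentiable ℝ fun s => J s + u s • v - (μ * t s) • w₀ :=
      (J.differentiable.add a1.differentiable).sub a2.differentiable
    refine ⟨hd.add_const z, ?_⟩
    have a3 := ((CkBound.const (E := S) k J).add a1.fderiv).sub a2.fderiv
    refine (a3.mono_const ?_).congr fun s => ?_
    · rw [hD_def, abs_of_pos hμ]
      have := mul_le_mul_of_nonneg_right hμMρ (norm_nonneg w₀)
      have := mul_le_mul_of_nonneg_right hρ1 (norm_nonneg v)
      linarith
    · rw [fderiv_add_const]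
      exact ((J.hasFDerivAt.fun_add (a1.differentiable s).hasFDerivAt).fun_sub
        (a2.differentiable s).hasFDerivAt).fderiv
  have hw : CkBound (k + 1) (B * ρ) (fun s => u s - μ * b₀ * t s) := by
    refine (hu.sub (ht.const_mul (μ * b₀))).mono_const ?_
    rw [abs_mul, abs_of_pos hμ, hB_def]
    have e1 : μ * |b₀| * (M * ρ) ≤ 1 * |b₀| * (M * ρ) := by gcongr
    nlinarith [abs_nonneg b₀]
  have t1 := h1 ℝ P (fun _ => x₂) _ K _ hBρ hP (differentiable_const x₂)
    ((CkBound.zero _).congr fun s => by simp) hw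
  have t2 := ht.const_mul (γ * (μ * b₀))
  have hμt : CkBound (k + 1) (μ * (M * ρ)) (fun s => μ * t s) :=
    (ht.const_mul μ).mono_const (by rw [abs_of_pos hμ])
  have t3 := (h2 ℝ φ _ _ (K * ε) _ hμMρ (hφ.mono_order (by omega)) (hθ z₀).1 (hθ z₀).2
    hμt).const_mul μ⁻¹
  have t4 := (h3 ℝ ψ _ _ (K * ε * μ) _ zero_le_one (hψ.mono_order (by omega)) (hθ y₀).1 (hθ y₀).2
    (CkBound.zero _)).const_mul μ⁻¹
  have t5 := CkBound.const (E := S) (k + 1) (μ⁻¹ * δ)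
  refine (((((t1.sub t2).sub t3).add t4).add t5).mono_const ?_).congr fun s => ?_
  · have hμi : 0 < μ⁻¹ := inv_pos.2 hμ
    rw [abs_mul, abs_mul, abs_of_pos hμ, abs_of_pos hμi, Real.norm_eq_abs, abs_mul, abs_of_pos hμi]
    have b2 : |γ| * (μ * |b₀|) * (M * ρ) ≤ |γ| * |b₀| * M * ε := by
      calc |γ| * (μ * |b₀|) * (M * ρ) ≤ |γ| * (ε * |b₀|) * (M * 1) := by gcongr
        _ = _ := by ring
    have b3 : μ⁻¹ * (C₂ * (K * ε) * (μ * (M * ρ)) ^ 1) ≤ C₂ * K * M * ε := by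
      calc _ = C₂ * K * M * ε * ρ := by field_simp
        _ ≤ C₂ * K * M * ε * 1 := by gcongr
        _ = _ := mul_one _
    have b4 : μ⁻¹ * (C₃ * (K * ε * μ) * 0 ^ 0) = C₃ * K * ε := by
      rw [pow_zero]; field_simp
    have b5 : μ⁻¹ * |δ| ≤ K * ε := by
      calc μ⁻¹ * |δ| ≤ μ⁻¹ * (K * ε * μ) := by gcongr
        _ = _ := by field_simp
    rw [b4]
    have b6 : 0 ≤ C₁ * K * B ^ 2 * ε := by positivity
    have b7 : 0 ≤ (|γ| * |b₀| * M + C₂ * K * M + C₃ * K + K) * ρ ^ 2 := by positivity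
    nlinarith
  · simp only [graphRem, taylorRem, Finset.sum_range_succ, Finset.sum_range_zero, pow_zero, pow_one,
      Nat.factorial_zero, Nat.factorial_one, Nat.cast_one, div_one, zero_add,
      Function.iterate_zero, Function.iterate_one, id_eq, hP0, smul_eq_mul, mul_one, dirDeriv,
      fderiv_apply_one_eq_deriv, hPγ, zero_smul, add_zero, sub_zero]
    ring

set_option maxHeartbeats 800000 in
/-- For arguments of size `ρ` the perturbation is Lipschitz in the last two variables with a
constant of size `ρ + ε`. -/
theorem exists_graphRem_lipschitz (γ b₀ K M : ℝ) (hK : 0 ≤ K) (hM : 1 ≤ M)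
    (J : S →L[ℝ] V) (v Ω w₀ : V) :
    ∃ C, 0 ≤ C ∧ ∀ (P : ℝ → ℝ) (φ ψ : V → ℝ) (x₂ μ ε δ ρ : ℝ) (z₀ y₀ : V), 0 < μ → μ ≤ ε →
      ε ≤ 1 → 0 ≤ ρ → (1 + |b₀|) * M * ρ ≤ 1 → deriv P x₂ = γ → CkBound 2 K P →
      CkBound 2 (K * ε) φ → CkBound 1 (K * ε * μ) ψ →
      ∀ s a a' e e', |a| ≤ ρ → |a'| ≤ ρ → |e| ≤ M * ρ → |e'| ≤ M * ρ →
        |graphRem γ x₂ b₀ μ δ J v Ω w₀ z₀ y₀ P φ ψ s a e -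
          graphRem γ x₂ b₀ μ δ J v Ω w₀ z₀ y₀ P φ ψ s a' e'| ≤
          C * (ρ + ε) * (|a - a'| + |e - e'|) := by
  set B := (1 + |b₀|) * M with hB_def
  have hB1 : M ≤ B := by
    rw [hB_def]; nlinarith [abs_nonneg b₀]
  have hM0 : 0 ≤ M := zero_le_one.trans hM
  have hB0 : 0 ≤ B := hM0.trans hB1
  have hBb : 1 + |b₀| ≤ B := by
    rw [hB_def]; nlinarith [abs_nonneg b₀]
  set D := ‖v‖ + ‖w₀‖ with hD_def
  have hD : 0 ≤ D := by positivity
  refine ⟨K * B ^ 2 + |γ| * |b₀| + K * ‖Ω‖ * D + K * ‖Ω‖ + K * D, by positivity, ?_⟩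
  intro P φ ψ x₂ μ ε δ ρ z₀ y₀ hμ hμε hε hρ hBρ hPγ hP hφ hψ s a a' e e' ha ha' he he'
  have hε0 : 0 < ε := hμ.trans_le hμε
  have hμ1 : μ ≤ 1 := hμε.trans hε
  have hMρ1 : M * ρ ≤ 1 := (mul_le_mul_of_nonneg_right hB1 hρ).trans hBρ
  set σ := |a - a'| + |e - e'| with hσ_def
  have hσ0 : 0 ≤ σ := by positivity
  have hw : ∀ a e : ℝ, |a| ≤ ρ → |e| ≤ M * ρ →
      ‖x₂ + (a - μ * b₀ * e) - x₂‖ ≤ B * ρ := by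
    intro a e ha he
    rw [add_sub_cancel_left, Real.norm_eq_abs]
    refine (abs_sub _ _).trans ?_
    rw [abs_mul, abs_mul, abs_of_pos hμ, hB_def]
    have e1 : μ * |b₀| * |e| ≤ 1 * |b₀| * (M * ρ) := by gcongr
    nlinarith [abs_nonneg b₀]
  have q1 : |P (x₂ + (a - μ * b₀ * e)) - P (x₂ + (a' - μ * b₀ * e')) -
      γ * ((a - a') - μ * b₀ * (e - e'))| ≤ K * B ^ 2 * ρ * σ := by
    have := hP.norm_sub_sub_fderiv_le (hw a e ha he) (hw a' e' ha' he')
    have e1 : fderiv ℝ P x₂ (x₂ + (a - μ * b₀ * e) - (x₂ + (a' - μ * b₀ * e'))) =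
        γ * ((a - a') - μ * b₀ * (e - e')) := by
      rw [fderiv_eq_smul_deriv, hPγ, smul_eq_mul]
      ring
    rw [e1, Real.norm_eq_abs, Real.norm_eq_abs] at this
    refine this.trans ?_
    have e2 : |x₂ + (a - μ * b₀ * e) - (x₂ + (a' - μ * b₀ * e'))| ≤ B * σ := by
      rw [show x₂ + (a - μ * b₀ * e) - (x₂ + (a' - μ * b₀ * e')) =
        (a - a') - μ * b₀ * (e - e') by ring]
      refine (abs_sub _ _).trans ?_
      rw [abs_mul, abs_mul, abs_of_pos hμ]
      have e3 : μ * |b₀| * |e - e'| ≤ 1 * |b₀| * |e - e'| := by gcongr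
      have e4 : (1 + |b₀|) * σ ≤ B * σ := by gcongr
      nlinarith [abs_nonneg b₀, abs_nonneg (a - a'), abs_nonneg (e - e'),
        mul_nonneg (abs_nonneg b₀) (abs_nonneg (a - a'))]
    calc _ ≤ K * (B * ρ) * (B * σ) := by gcongr
      _ = _ := by ring
  have q2 : |γ * (μ * b₀ * (e - e'))| ≤ |γ| * |b₀| * ε * σ := by
    rw [abs_mul, abs_mul, abs_mul, abs_of_pos hμ]
    calc |γ| * (μ * |b₀| * |e - e'|) ≤ |γ| * (ε * |b₀| * σ) := by
          gcongr
          rw [hσ_def]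
          linarith [abs_nonneg (a - a')]
      _ = _ := by ring
  have hξ : ∀ z : V, ‖(J s + a • v - (μ * e) • w₀ + z) - (J s + a' • v - (μ * e') • w₀ + z)‖ ≤
      D * σ := by
    intro z
    rw [show (J s + a • v - (μ * e) • w₀ + z) - (J s + a' • v - (μ * e') • w₀ + z) =
      (a - a') • v - (μ * (e - e')) • w₀ by module]
    refine (norm_sub_le _ _).trans ?_
    rw [norm_smul, norm_smul, Real.norm_eq_abs, Real.norm_eq_abs, abs_mul, abs_of_pos hμ]
    have e3 : μ * |e - e'| * ‖w₀‖ ≤ 1 * |e - e'| * ‖w₀‖ := by gcongr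
    rw [hD_def, hσ_def]
    nlinarith [abs_nonneg (a - a'), abs_nonneg (e - e'), norm_nonneg v, norm_nonneg w₀,
      mul_nonneg (norm_nonneg v) (abs_nonneg (e - e')),
      mul_nonneg (norm_nonneg w₀) (abs_nonneg (a - a'))]
  set ξ := J s + a • v - (μ * e) • w₀ + z₀ with hξ_def
  set ξ' := J s + a' • v - (μ * e') • w₀ + z₀ with hξ'_def
  have q3 : |(φ ξ - φ (ξ + (μ * e) • Ω)) - (φ ξ' - φ (ξ' + (μ * e) • Ω))| ≤
      μ * (K * ‖Ω‖ * D * ε * σ) := by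
    have := hφ.norm_double_difference_le ξ ξ' ((μ * e) • Ω)
    rw [norm_smul, Real.norm_eq_abs, Real.norm_eq_abs, abs_mul, abs_of_pos hμ] at this
    refine this.trans ?_
    calc K * ε * (μ * |e| * ‖Ω‖) * ‖ξ - ξ'‖ ≤ K * ε * (μ * 1 * ‖Ω‖) * (D * σ) := by
          gcongr
          · exact he.trans hMρ1
          · exact hξ z₀
      _ = _ := by ring
  have q4 : |φ (ξ' + (μ * e') • Ω) - φ (ξ' + (μ * e) • Ω)| ≤ μ * (K * ‖Ω‖ * ε * σ) := by
    have := hφ.lipschitz (ξ' + (μ * e') • Ω) (ξ' + (μ * e) • Ω)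
    rw [show ξ' + (μ * e') • Ω - (ξ' + (μ * e) • Ω) = (μ * (e' - e)) • Ω by module, norm_smul,
      Real.norm_eq_abs, Real.norm_eq_abs, abs_mul, abs_of_pos hμ, abs_sub_comm e'] at this
    refine this.trans ?_
    calc K * ε * (μ * |e - e'| * ‖Ω‖) ≤ K * ε * (μ * σ * ‖Ω‖) := by
          gcongr
          rw [hσ_def]
          linarith [abs_nonneg (a - a')]
      _ = _ := by ring
  have q5 : |ψ (J s + a • v - (μ * e) • w₀ + y₀) - ψ (J s + a' • v - (μ * e') • w₀ + y₀)| ≤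
      μ * (K * D * ε * σ) := by
    have := hψ.lipschitz (J s + a • v - (μ * e) • w₀ + y₀) (J s + a' • v - (μ * e') • w₀ + y₀)
    rw [Real.norm_eq_abs] at this
    refine this.trans ?_
    calc K * ε * μ * _ ≤ K * ε * μ * (D * σ) := by
          gcongr
          exact hξ y₀
      _ = _ := by ring
  have hsplit : graphRem γ x₂ b₀ μ δ J v Ω w₀ z₀ y₀ P φ ψ s a e -
      graphRem γ x₂ b₀ μ δ J v Ω w₀ z₀ y₀ P φ ψ s a' e' =
      (P (x₂ + (a - μ * b₀ * e)) - P (x₂ + (a' - μ * b₀ * e')) -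
      γ * ((a - a') - μ * b₀ * (e - e'))) - γ * (μ * b₀ * (e - e')) +
      μ⁻¹ * (((φ ξ - φ (ξ + (μ * e) • Ω)) - (φ ξ' - φ (ξ' + (μ * e) • Ω))) +
        (φ (ξ' + (μ * e') • Ω) - φ (ξ' + (μ * e) • Ω)) +
        (ψ (J s + a • v - (μ * e) • w₀ + y₀) - ψ (J s + a' • v - (μ * e') • w₀ + y₀))) := by
    simp only [graphRem]
    ring
  rw [hsplit]
  have q6 : |μ⁻¹ * (((φ ξ - φ (ξ + (μ * e) • Ω)) - (φ ξ' - φ (ξ' + (μ * e) • Ω))) +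
        (φ (ξ' + (μ * e') • Ω) - φ (ξ' + (μ * e) • Ω)) +
        (ψ (J s + a • v - (μ * e) • w₀ + y₀) - ψ (J s + a' • v - (μ * e') • w₀ + y₀)))| ≤
      (K * ‖Ω‖ * D + K * ‖Ω‖ + K * D) * ε * σ := by
    rw [abs_mul, abs_of_pos (inv_pos.2 hμ), inv_mul_le_iff₀ hμ]
    refine (abs_add_three _ _ _).trans ((add_le_add (add_le_add q3 q4) q5).trans (le_of_eq ?_))
    ring
  refine ((abs_add_le _ _).trans (add_le_add ((abs_sub _ _).trans (add_le_add q1 q2)) q6)).trans ?_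
  have r1 : 0 ≤ K * B ^ 2 * ε * σ := by positivity
  have r2 : 0 ≤ (|γ| * |b₀| + K * ‖Ω‖ * D + K * ‖Ω‖ + K * D) * ρ * σ := by positivity
  nlinarith

end GraphRem

/-! ### Embedded tori in the phase space -/

/-- A perturbation of a translation by a map with Lipschitz constant less than one is onto. -/
theorem surjective_add_of_lipschitz {S : Type*} [NormedAddCommGroup S] [CompleteSpace S] (c : S)
    {w : S → S} {K : ℝ} (hK : K < 1) (hw : ∀ s s', ‖w s - w s'‖ ≤ K * ‖s - s'‖) :
    Function.Surjective fun s => s + c + w s := by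
  intro y
  have h : ContractingWith K.toNNReal fun s => y - c - w s := by
    refine ⟨by simpa using hK, LipschitzWith.of_dist_le_mul fun s s' => ?_⟩
    rw [dist_eq_norm, dist_eq_norm, sub_sub_sub_cancel_left, norm_sub_rev]
    exact (hw s s').trans (mul_le_mul_of_nonneg_right (Real.le_coe_toNNReal K) (norm_nonneg _))
  refine ⟨h.fixedPoint, ?_⟩
  have := h.fixedPoint_isFixedPt
  rw [Function.IsFixedPt] at this
  dsimp only
  nth_rewrite 1 [← this]
  abel

/-- Invariance of the image of `K` under a map with lift `G`, from a relation between the values of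
`K` at two surjective reparametrizations. -/
theorem image_torusSet_eq {r d : ℕ} {G : (Fin d → ℝ) → (Fin d → ℝ)}
    {K : (Fin r → ℝ) → (Fin d → ℝ)}
    (hG : ∀ (x : Fin d → ℝ) (m : Fin d → ℤ), G (x + fun i => (m i : ℝ)) = G x + fun i => (m i : ℝ))
    {σ₁ σ₂ : (Fin r → ℝ) → (Fin r → ℝ)} (h₁ : Function.Surjective σ₁)
    (h₂ : Function.Surjective σ₂)
    (h : ∀ s, ∃ m : Fin d → ℤ, G (K (σ₁ s)) = K (σ₂ s) + fun i => (m i : ℝ)) :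
    G '' torusSet K = torusSet K := by
  have mem : ∀ x, x ∈ torusSet K ↔ ∃ (s : Fin r → ℝ) (m : Fin d → ℤ),
      x = K s + fun i => (m i : ℝ) := fun x =>
    exists₂_congr fun s m => by rw [funext_iff]; rfl
  ext y
  constructor
  · rintro ⟨x, hx, rfl⟩
    obtain ⟨s, m, rfl⟩ := (mem x).1 hx
    obtain ⟨s, rfl⟩ := h₁ s
    obtain ⟨m', h'⟩ := h s
    refine (mem _).2 ⟨σ₂ s, m' + m, ?_⟩
    rw [hG, h', add_assoc]
    congr 1
    funext i
    simp
  · intro hy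
    obtain ⟨s, m, rfl⟩ := (mem y).1 hy
    obtain ⟨s, rfl⟩ := h₂ s
    obtain ⟨m', h'⟩ := h s
    refine ⟨K (σ₁ s) + fun i => ((m - m') i : ℝ), (mem _).2 ⟨σ₁ s, m - m', ?_⟩, ?_⟩
    · funext i
      simp
    · have := hG (K (σ₁ s)) (m - m')
      simp only [Pi.sub_apply, Int.cast_sub] at this ⊢
      rw [this, h']
      funext i
      simp

section Embedding

variable {r ℓ : ℕ} {Ω : Fin (r + 1) → ℝ} (A : Matrix.SpecialLinearGroup (Fin (r + 1)) ℤ)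

/-- The inclusion `s ↦ A⁻¹ (s, 0)` of the nonresonant directions. -/
def sliceCLM : (Fin r → ℝ) →L[ℝ] (Fin (r + 1) → ℝ) :=
  (actCLM A⁻¹).comp (LinearMap.toContinuousLinearMap
    { toFun := fun s => Fin.snoc (α := fun _ => ℝ) s 0
      map_add' := fun s s' => by
        funext i
        refine Fin.lastCases ?_ (fun j => ?_) i <;> simp
      map_smul' := fun c s => by
        funext i
        refine Fin.lastCases ?_ (fun j => ?_) i <;> simp })

/-- The resonant direction `A⁻¹ (0, 1)`. -/
def resonantDir : Fin (r + 1) → ℝ := act A⁻¹ (Pi.single (Fin.last r) 1)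

theorem act_sliceCLM (s : Fin r → ℝ) :
    act A (sliceCLM A s) = Fin.snoc (α := fun _ => ℝ) s 0 := act_act_inv A _

theorem act_resonantDir : act A (resonantDir A) = Pi.single (Fin.last r) 1 := act_act_inv A _

theorem act_slice_add_castSucc (s : Fin r → ℝ) (y : ℝ) (j : Fin r) :
    act A (sliceCLM A s + y • resonantDir A) j.castSucc = s j := by
  rw [act_add, act_smul, act_sliceCLM, act_resonantDir]
  simp

theorem act_slice_add_last (s : Fin r → ℝ) (y : ℝ) :
    act A (sliceCLM A s + y • resonantDir A) (Fin.last r) = y := by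
  rw [act_add, act_smul, act_sliceCLM, act_resonantDir]
  simp

theorem act_injective : Function.Injective (act A) :=
  Function.LeftInverse.injective (act_inv_act A)

/-- The columns of `A⁻¹` that span the nonresonant directions. -/
def sliceMatrix : Matrix (Fin (r + 1)) (Fin r) ℤ :=
  fun i j => (A⁻¹ : Matrix.SpecialLinearGroup (Fin (r + 1)) ℤ) i j.castSucc

theorem sliceCLM_intCast (m : Fin r → ℤ) :
    sliceCLM A (fun j => (m j : ℝ)) = fun i => (((sliceMatrix A).mulVec m i : ℤ) : ℝ) := by
  have h : (Fin.snoc (α := fun _ => ℝ) (fun j => (m j : ℝ)) 0 : Fin (r + 1) → ℝ) =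
      fun i => ((Fin.snoc (α := fun _ => ℤ) m 0 : Fin (r + 1) → ℤ) i : ℝ) := by
    funext i
    refine Fin.lastCases ?_ (fun j => ?_) i <;> simp
  change act A⁻¹ (Fin.snoc (α := fun _ => ℝ) (fun j => (m j : ℝ)) 0) = _
  rw [h, act_intCast]
  funext i
  simp [Matrix.mulVec, dotProduct, Fin.sum_univ_castSucc, sliceMatrix]

/-- The torus over the graph of `u` in the coordinates `A x`, moved along the foliation
by `Id + φ Ω`. -/
def torusEmbedding (Ω : Fin (r + 1) → ℝ) (φ : (Fin (r + 1) → ℝ) → ℝ) (x₂ : ℝ)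
    (u : (Fin r → ℝ) → ℝ) (s : Fin r → ℝ) : Fin (r + 1) → ℝ :=
  T Ω φ (sliceCLM A s + (x₂ + u s) • resonantDir A)

variable {φ : (Fin (r + 1) → ℝ) → ℝ} {x₂ : ℝ} {u : (Fin r → ℝ) → ℝ}

theorem slice_add_intCast (hu : ∀ s (m : Fin r → ℤ), u (s + fun j => (m j : ℝ)) = u s)
    (s : Fin r → ℝ) (m : Fin r → ℤ) :
    sliceCLM A (s + fun j => (m j : ℝ)) + (x₂ + u (s + fun j => (m j : ℝ))) • resonantDir A =
      fun i => (sliceCLM A s + (x₂ + u s) • resonantDir A) i +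
        (((sliceMatrix A).mulVec m i : ℤ) : ℝ) := by
  rw [map_add, sliceCLM_intCast, hu, add_right_comm]
  rfl

theorem act_torusEmbedding_castSucc (s : Fin r → ℝ) (j : Fin r) :
    act A (torusEmbedding A Ω φ x₂ u s) j.castSucc =
      s j + φ (sliceCLM A s + (x₂ + u s) • resonantDir A) * act A Ω j.castSucc := by
  rw [torusEmbedding, T, act_add, act_smul, Pi.add_apply, act_slice_add_castSucc]
  rfl

theorem torusEmbedding_add_intCast (hφ : IsPeriodic φ)
    (hu : ∀ s (m : Fin r → ℤ), u (s + fun j => (m j : ℝ)) = u s) (s : Fin r → ℝ)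
    (m : Fin r → ℤ) :
    torusEmbedding A Ω φ x₂ u (s + fun j => (m j : ℝ)) =
      fun i => torusEmbedding A Ω φ x₂ u s i + (((sliceMatrix A).mulVec m i : ℤ) : ℝ) := by
  rw [torusEmbedding, T, slice_add_intCast A hu, hφ]
  funext i
  simp only [torusEmbedding, T, Pi.add_apply]
  ring

/-- The map `torusEmbedding` is an embedding of the torus if `φ` is small: the first coordinates
of `A K(s)` are a small perturbation of `s`. -/
theorem isInvariantTorus_torusEmbedding {G : (Fin (r + 1) → ℝ) → (Fin (r + 1) → ℝ)} {c : ℝ}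
    (hℓ : 1 ≤ ℓ) (hφ : IsPeriodic φ) (hφc : ContDiff ℝ ℓ φ)
    (hu : ∀ s (m : Fin r → ℤ), u (s + fun j => (m j : ℝ)) = u s) (huc : ContDiff ℝ ℓ u)
    (hlip : ∀ s s', |φ (sliceCLM A s + (x₂ + u s) • resonantDir A) -
      φ (sliceCLM A s' + (x₂ + u s') • resonantDir A)| ≤ c * ‖s - s'‖)
    (hc : c * ‖fun j : Fin r => act A Ω j.castSucc‖ < 1)
    (hinv : G '' torusSet (torusEmbedding A Ω φ x₂ u) = torusSet (torusEmbedding A Ω φ x₂ u)) :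
    IsInvariantTorus ℓ G (torusEmbedding A Ω φ x₂ u) := by
  set a : (Fin r → ℝ) → ℝ := fun s => φ (sliceCLM A s + (x₂ + u s) • resonantDir A) with ha_def
  set b : Fin r → ℝ := fun j => act A Ω j.castSucc with hb_def
  have hκ : ContDiff ℝ ℓ fun s => sliceCLM A s + (x₂ + u s) • resonantDir A :=
    (sliceCLM A).contDiff.add ((contDiff_const.add huc).smul contDiff_const)
  have hac : ContDiff ℝ ℓ a := hφc.comp hκ
  have hKc : ContDiff ℝ ℓ (torusEmbedding A Ω φ x₂ u) := hκ.add (hac.smul contDiff_const)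
  have hℓ0 : (ℓ : WithTop ℕ∞) ≠ 0 := by exact_mod_cast (by omega : ℓ ≠ 0)
  refine ⟨hKc, ⟨sliceMatrix A, fun s m i =>
    congrFun (torusEmbedding_add_intCast A hφ hu s m) i⟩, ?_, ?_, hinv⟩
  · rintro s s' ⟨m, hm⟩
    have h1 : act A (torusEmbedding A Ω φ x₂ u s) = act A (torusEmbedding A Ω φ x₂ u s') +
        fun i => (((A : Matrix (Fin (r + 1)) (Fin (r + 1)) ℤ).mulVec m i : ℤ) : ℝ) := by
      rw [← act_intCast, ← act_add]
      exact congrArg (act A) (funext hm)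
    set m₁ : Fin r → ℤ := fun j =>
      (A : Matrix (Fin (r + 1)) (Fin (r + 1)) ℤ).mulVec m j.castSucc with hm₁
    set s'' : Fin r → ℝ := s' + fun j => (m₁ j : ℝ) with hs''
    have ha : a s'' = a s' := by
      rw [ha_def]
      dsimp only
      rw [hs'', slice_add_intCast A hu, hφ]
    have h2 : s - s'' = (a s'' - a s) • b := by
      funext j
      have h3 := congrFun h1 j.castSucc
      rw [Pi.add_apply, act_torusEmbedding_castSucc, act_torusEmbedding_castSucc] at h3
      change s j + a s * b j = s' j + a s' * b j + (m₁ j : ℝ) at h3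
      rw [← ha] at h3
      simp only [Pi.sub_apply, Pi.smul_apply, smul_eq_mul, hs'', Pi.add_apply]
      linarith
    have h4 : ‖s - s''‖ ≤ c * ‖b‖ * ‖s - s''‖ := by
      nth_rewrite 1 [h2]
      rw [norm_smul, Real.norm_eq_abs]
      have := mul_le_mul_of_nonneg_right (hlip s'' s) (norm_nonneg b)
      rw [norm_sub_rev] at this
      exact this.trans (le_of_eq (by ring))
    have h5 : s - s'' = 0 := by
      rw [← norm_le_zero_iff]
      by_contra h
      push Not at h
      nlinarith
    refine ⟨m₁, fun j => ?_⟩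
    have := congrFun h5 j
    simp only [hs'', Pi.sub_apply, Pi.add_apply, Pi.zero_apply] at this
    linarith
  · -- on the first coordinates the derivative of `A K` is `η ↦ η + (D a) η b`, where
    -- `|(D a) η| ≤ c ‖η‖`
    intro s
    rw [injective_iff_map_eq_zero]
    intro η hη
    have ha1 : HasFDerivAt a (fderiv ℝ a s) s := (hac.differentiable hℓ0 s).hasFDerivAt
    have hc0 : 0 ≤ c ∨ η = 0 := by
      by_contra hcon
      push Not at hcon
      have h := (abs_nonneg _).trans (hlip η 0)
      have : 0 < ‖η - 0‖ := by simpa using hcon.2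
      nlinarith [hcon.1]
    rcases hc0 with hc0 | h
    swap
    · exact h
    have ha2 : |fderiv ℝ a s η| ≤ c * ‖η‖ := by
      refine ((fderiv ℝ a s).le_opNorm η).trans (mul_le_mul_of_nonneg_right ?_ (norm_nonneg _))
      exact ha1.le_of_lip' hc0 (Filter.Eventually.of_forall fun s' => hlip s' s)
    have h1 : η + fderiv ℝ a s η • b = 0 := by
      funext j
      have h2 : HasFDerivAt (fun s => act A (torusEmbedding A Ω φ x₂ u s) j.castSucc)
          (((ContinuousLinearMap.proj j.castSucc).comp (actCLM A)).comp
            (fderiv ℝ (torusEmbedding A Ω φ x₂ u) s)) s :=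
        ((ContinuousLinearMap.proj (R := ℝ) (φ := fun _ : Fin (r + 1) => ℝ) j.castSucc).comp
          (actCLM A)).hasFDerivAt.comp s (hKc.differentiable hℓ0 s).hasFDerivAt
      have h3 : HasFDerivAt (fun s => act A (torusEmbedding A Ω φ x₂ u s) j.castSucc)
          (ContinuousLinearMap.proj (R := ℝ) (φ := fun _ : Fin r => ℝ) j +
            (b j) • fderiv ℝ a s) s := by
        simp only [act_torusEmbedding_castSucc]
        exact (ContinuousLinearMap.proj (R := ℝ) (φ := fun _ : Fin r => ℝ) j).hasFDerivAt.add
          (ha1.mul_const (b j))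
      have h4 := congrArg (fun Λ : (Fin r → ℝ) →L[ℝ] ℝ => Λ η) (h2.unique h3)
      simp only [ContinuousLinearMap.comp_apply, hη, map_zero] at h4
      simp at h4
      simp only [Pi.add_apply, Pi.smul_apply, smul_eq_mul, Pi.zero_apply]
      linarith
    rw [← norm_le_zero_iff]
    by_contra h
    push Not at h
    have h2 : ‖η‖ ≤ c * ‖b‖ * ‖η‖ := by
      nth_rewrite 1 [eq_neg_of_add_eq_zero_left h1]
      rw [norm_neg, norm_smul, Real.norm_eq_abs]
      exact (mul_le_mul_of_nonneg_right ha2 (norm_nonneg b)).trans (le_of_eq (by ring))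
    nlinarith

end Embedding

/-! ### Invariant tori near a zero of the resonant normal form -/

section Torus

variable {r ℓ : ℕ} {Ω : Fin (r + 1) → ℝ} {A : Matrix.SpecialLinearGroup (Fin (r + 1)) ℤ}
  {ω : Fin r → ℝ} {L : Fin (r + 1) → ℤ} {α₀ : ℝ}

theorem T_add_intCast {φ : (Fin (r + 1) → ℝ) → ℝ} (hφ : IsPeriodic φ) (x : Fin (r + 1) → ℝ)
    (m : Fin (r + 1) → ℤ) :
    T Ω φ (x + fun i => (m i : ℝ)) = T Ω φ x + fun i => (m i : ℝ) := by
  have : φ (x + fun i => (m i : ℝ)) = φ x := hφ x m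
  rw [T, T, this, add_right_comm]

theorem IsIntrinsicFrequency.castSucc (hA : IsIntrinsicFrequency A ω L (α₀ • Ω)) (j : Fin r) :
    α₀ * act A Ω j.castSucc = ω j + L j.castSucc := by
  have := hA.eq j.castSucc
  rwa [act_smul, Pi.smul_apply, smul_eq_mul, Fin.snoc_castSucc] at this

theorem IsIntrinsicFrequency.last (hA : IsIntrinsicFrequency A ω L (α₀ • Ω)) :
    α₀ * act A Ω (Fin.last r) = L (Fin.last r) := by
  have := hA.eq (Fin.last r)
  rwa [act_smul, Pi.smul_apply, smul_eq_mul, Fin.snoc_last, zero_add] at this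

/-- If `t` solves the equation for the displacement, then `F_{α,ε}` acts on `T_φ z` as the
translation of `z` by `(α₀ + μ t) Ω`. -/
theorem T_comp_T_eq {φ ψ g : (Fin (r + 1) → ℝ) → ℝ} {P : ℝ → ℝ} {α ε μ t : ℝ}
    (h : ∀ x, φ x + ε * g (x + φ x • Ω) - φ (x + α₀ • Ω) =
      μ * P (act A x (Fin.last r)) + ψ x) (z : Fin (r + 1) → ℝ)
    (ht : μ * t = μ * P (act A z (Fin.last r)) + (φ (z + α₀ • Ω) -
      φ (z + α₀ • Ω + (μ * t) • Ω) + ψ z + (α - α₀))) :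
    T Ω (fun x => α + ε * g x) (T Ω φ z) = T Ω φ (z + (α₀ + μ * t) • Ω) := by
  have h1 := h z
  simp only [T]
  have e1 : z + (α₀ + μ * t) • Ω = z + α₀ • Ω + (μ * t) • Ω := by module
  have e2 : φ z + (α + ε * g (z + φ z • Ω)) =
      α₀ + μ * t + φ (z + α₀ • Ω + (μ * t) • Ω) := by linarith
  rw [add_assoc, ← add_smul, e2, e1]
  module

/-- In the coordinates `A x` the translation along the foliation by `α₀ + μ t` moves the graph
of `u` over itself. The sign `σ = -1` describes the backward motion. -/
theorem slice_translate (hA : IsIntrinsicFrequency A ω L (α₀ • Ω)) (s : Fin r → ℝ)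
    (y σ a : ℝ) :
    sliceCLM A (s + σ • ω + a • σ • fun j : Fin r => act A Ω j.castSucc) +
        (y + a * (σ * act A Ω (Fin.last r))) • resonantDir A =
      sliceCLM A s + y • resonantDir A +
        σ • ((α₀ + a) • Ω - act A⁻¹ fun i => (L i : ℝ)) := by
  refine act_injective A (funext fun i => ?_)
  rw [act_add A (sliceCLM A s + y • resonantDir A), act_smul, sub_eq_add_neg, act_add A (_ • Ω),
    ← neg_one_smul ℝ (act A⁻¹ _), act_smul, act_smul, act_act_inv]
  refine Fin.lastCases ?_ (fun j => ?_) i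
  · simp only [Pi.add_apply, Pi.smul_apply, act_slice_add_last, smul_eq_mul]
    linear_combination (-σ) * hA.last
  · simp only [Pi.add_apply, Pi.smul_apply, act_slice_add_castSucc, smul_eq_mul]
    linear_combination (-σ) * hA.castSucc j

/-- A solution `(u, t)` of the graph equations gives an invariant torus. The source of the point of
the graph over `s` is the point itself if `χ = 0` and its preimage if `χ = 1`. -/
theorem image_torusSet_torusEmbedding (hA : IsIntrinsicFrequency A ω L (α₀ • Ω))
    {P : ℝ → ℝ} (hP1 : ∀ y, P (y + 1) = P y) {x₂ γ χ μ ε α : ℝ} (hχ : χ = 0 ∨ χ = 1)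
    (hμ : μ ≠ 0) {g φ ψ : (Fin (r + 1) → ℝ) → ℝ} (hg : IsPeriodic g) (hφ : IsPeriodic φ)
    (h : ∀ x, φ x + ε * g (x + φ x • Ω) - φ (x + α₀ • Ω) =
      μ * P (act A x (Fin.last r)) + ψ x) {u t : (Fin r → ℝ) → ℝ}
    (ht : ∀ s, t s = γ * u s + graphRem γ x₂ (χ * act A Ω (Fin.last r)) μ (α - α₀) (sliceCLM A)
      (resonantDir A) Ω (χ • Ω) (x₂ • resonantDir A + ((1 - χ) * α₀) • Ω)
      (x₂ • resonantDir A - (χ * α₀) • Ω) P φ ψ s (u s) (t s))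
    (hu : ∀ s, u (s + (1 - 2 * χ) • ω + (μ * t s) • (1 - 2 * χ) •
        fun j : Fin r => act A Ω j.castSucc) =
      u s + μ * ((1 - 2 * χ) * act A Ω (Fin.last r)) * t s)
    (hsurj : Function.Surjective fun s => s + (1 - 2 * χ) • ω + (μ * t s) • (1 - 2 * χ) •
      fun j : Fin r => act A Ω j.castSucc) :
    T Ω (fun x => α + ε * g x) '' torusSet (torusEmbedding A Ω φ x₂ u) =
      torusSet (torusEmbedding A Ω φ x₂ u) := by
  set τ : (Fin r → ℝ) → (Fin r → ℝ) := fun s => s + (1 - 2 * χ) • ω + (μ * t s) •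
    (1 - 2 * χ) • fun j : Fin r => act A Ω j.castSucc with hτ
  set κ : (Fin r → ℝ) → (Fin (r + 1) → ℝ) := fun s =>
    sliceCLM A s + (x₂ + u s) • resonantDir A with hκ
  have hK : ∀ s, torusEmbedding A Ω φ x₂ u s = T Ω φ (κ s) := fun s => rfl
  set l : Fin (r + 1) → ℤ :=
    ((A⁻¹ : Matrix.SpecialLinearGroup (Fin (r + 1)) ℤ) :
      Matrix (Fin (r + 1)) (Fin (r + 1)) ℤ).mulVec L with hl
  have hlL : (act A⁻¹ fun i => (L i : ℝ)) = fun i => (l i : ℝ) := act_intCast A⁻¹ L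
  have hκτ : ∀ s, κ (τ s) = κ s + (1 - 2 * χ) • ((α₀ + μ * t s) • Ω - fun i => (l i : ℝ)) := by
    intro s
    have := slice_translate hA s (x₂ + u s) (1 - 2 * χ) (μ * t s)
    rw [hlL] at this
    rw [hκ]
    dsimp only
    rw [← this, hτ]
    dsimp only
    rw [hu]
    congr 2
    ring
  have hP1' : ∀ (y : ℝ) (m : ℤ), P (y + m) = P y := fun y m => by
    have h : Function.Periodic P 1 := hP1
    simpa using h.int_mul m y
  -- the equation for the displacement at the source `z` of the point over `s`
  have hstep : ∀ s, T Ω (fun x => α + ε * g x) (T Ω φ (κ s - (χ * (α₀ + μ * t s)) • Ω)) =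
      T Ω φ (κ s - (χ * (α₀ + μ * t s)) • Ω + (α₀ + μ * t s) • Ω) := by
    intro s
    refine T_comp_T_eq h _ ?_
    have hy : x₂ + u s - χ * (α₀ + μ * t s) * act A Ω (Fin.last r) =
        x₂ + (u s - μ * (χ * act A Ω (Fin.last r)) * t s) - χ * L (Fin.last r) := by
      linear_combination (-χ) * hA.last
    have hPz : P (act A (κ s - (χ * (α₀ + μ * t s)) • Ω) (Fin.last r)) =
        P (x₂ + (u s - μ * (χ * act A Ω (Fin.last r)) * t s)) := by
      rw [sub_eq_add_neg, ← neg_smul, act_add, act_smul, Pi.add_apply, Pi.smul_apply,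
        act_slice_add_last, smul_eq_mul, neg_mul, ← sub_eq_add_neg, hy]
      rcases hχ with rfl | rfl
      · simp
      · have := hP1' (x₂ + (u s - μ * (1 * act A Ω (Fin.last r)) * t s) - 1 * L (Fin.last r))
          (L (Fin.last r))
        rw [← this]
        congr 1
        ring
    have e1 : κ s - (χ * (α₀ + μ * t s)) • Ω = sliceCLM A s + u s • resonantDir A -
        (μ * t s) • χ • Ω + (x₂ • resonantDir A - (χ * α₀) • Ω) := by
      rw [hκ]
      module
    have e2 : κ s - (χ * (α₀ + μ * t s)) • Ω + α₀ • Ω = sliceCLM A s + u s • resonantDir A -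
        (μ * t s) • χ • Ω + (x₂ • resonantDir A + ((1 - χ) * α₀) • Ω) := by
      rw [hκ]
      module
    rw [hPz, e2, e1]
    have := ht s
    rw [graphRem] at this
    nth_rewrite 1 [this]
    field_simp
    ring
  have hG : ∀ (x : Fin (r + 1) → ℝ) (m : Fin (r + 1) → ℤ),
      T Ω (fun x => α + ε * g x) (x + fun i => (m i : ℝ)) =
        T Ω (fun x => α + ε * g x) x + fun i => (m i : ℝ) :=
    T_add_intCast fun x m => by rw [hg x m]
  rcases hχ with rfl | rfl
  · refine image_torusSet_eq hG Function.surjective_id hsurj fun s => ⟨l, ?_⟩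
    have h1 := hstep s
    simp only [zero_mul, zero_smul, sub_zero] at h1
    rw [id, hK, hK, h1, ← T_add_intCast hφ, hκτ]
    congr 1
    module
  · refine image_torusSet_eq hG hsurj Function.surjective_id fun s => ⟨l, ?_⟩
    have h1 := hstep s
    rw [one_mul, sub_add_cancel] at h1
    have h2 : κ (τ s) = κ s - (α₀ + μ * t s) • Ω + fun i => (l i : ℝ) := by
      rw [hκτ]
      module
    rw [id, hK, hK, h2, T_add_intCast hφ, hG, h1]

theorem graphRem_add_intCast {γ x₂ b₀ μ δ : ℝ} {w₀ z₀ y₀ : Fin (r + 1) → ℝ} {P : ℝ → ℝ}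
    {φ ψ : (Fin (r + 1) → ℝ) → ℝ} (hφ : IsPeriodic φ) (hψ : IsPeriodic ψ) (s : Fin r → ℝ)
    (m : Fin r → ℤ) (a e : ℝ) :
    graphRem γ x₂ b₀ μ δ (sliceCLM A) (resonantDir A) Ω w₀ z₀ y₀ P φ ψ
        (s + fun j => (m j : ℝ)) a e =
      graphRem γ x₂ b₀ μ δ (sliceCLM A) (resonantDir A) Ω w₀ z₀ y₀ P φ ψ s a e := by
  have h1 : ∀ w : Fin (r + 1) → ℝ, φ (w + sliceCLM A fun j => (m j : ℝ)) = φ w := fun w => by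
    rw [sliceCLM_intCast]; exact hφ w _
  have h2 : ∀ w : Fin (r + 1) → ℝ, ψ (w + sliceCLM A fun j => (m j : ℝ)) = ψ w := fun w => by
    rw [sliceCLM_intCast]; exact hψ w _
  have e1 : ∀ a b c : Fin (r + 1) → ℝ, sliceCLM A (s + fun j => (m j : ℝ)) + a - b + c =
      sliceCLM A s + a - b + c + sliceCLM A fun j => (m j : ℝ) := fun a b c => by
    rw [map_add]; abel
  simp only [graphRem, e1]
  rw [add_right_comm (_ + z₀), h1, h1, h2]

/-- Invariant tori for maps that are conjugate to the resonant normal form up to a small error, near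
a nondegenerate zero of `P`. The choice `χ = 0` is for repelling tori and `χ = 1` for attracting
ones. -/
theorem exists_isInvariantTorus_of_normalForm (hA : IsIntrinsicFrequency A ω L (α₀ • Ω))
    (hℓ : 1 ≤ ℓ) {P : ℝ → ℝ} {K : ℝ} (hP : CkBound (ℓ + 3) K P) (hP1 : ∀ y, P (y + 1) = P y)
    {x₂ χ : ℝ} (hx₂ : P x₂ = 0) (hχ : χ = 0 ∨ χ = 1)
    (hγ : 0 < (1 - 2 * χ) * act A Ω (Fin.last r) * deriv P x₂) :
    ∃ ε₂, 0 < ε₂ ∧ ∀ (ε μ α : ℝ) (g φ ψ : (Fin (r + 1) → ℝ) → ℝ), 0 < μ → μ ≤ ε → ε < ε₂ →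
      IsPeriodic g → IsPeriodic φ → IsPeriodic ψ → CkBound (ℓ + 3) (K * ε) φ →
      CkBound (ℓ + 3) (K * ε * μ) ψ → |α - α₀| ≤ K * ε * μ →
      (∀ x, φ x + ε * g (x + φ x • Ω) - φ (x + α₀ • Ω) =
        μ * P (act A x (Fin.last r)) + ψ x) →
      ∃ κ, IsInvariantTorus ℓ (T Ω (fun x => α + ε * g x)) (κ : (Fin r → ℝ) → _) := by
  have hK := hP.nonneg
  set γ := deriv P x₂ with hγ_def
  set β : Fin r → ℝ := fun j => act A Ω j.castSucc with hβ
  set b : Fin r → ℝ := (1 - 2 * χ) • β with hb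
  set G := (1 - 2 * χ) * act A Ω (Fin.last r) with hG
  set b₀ := χ * act A Ω (Fin.last r) with hb₀
  set M := |γ| + 1 with hM
  have hM1 : 1 ≤ M := by rw [hM]; linarith [abs_nonneg γ]
  have hM0 : 0 ≤ M := zero_le_one.trans hM1
  obtain ⟨C, hC, hgraph⟩ := exists_invariant_graph ℓ b
  obtain ⟨C₁, hC₁, hR₁⟩ := exists_graphRem_ckBound ℓ γ b₀ K M hK hM1 (sliceCLM A) (resonantDir A)
    Ω (χ • Ω)
  obtain ⟨C₂, hC₂, hR₂⟩ := exists_graphRem_lipschitz γ b₀ K M hK hM1 (sliceCLM A) (resonantDir A)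
    Ω (χ • Ω)
  have hγ4 : 0 < G * γ / 4 := by linarith
  -- the order of choices: the size `κ` of the perturbation relative to the expansion rate `G γ`,
  -- then the radius `ρ`, which controls the quadratic terms, and `ε₂` at most of the order `ρ²`
  obtain ⟨κ, ⟨⟨hκ0, -⟩, hκ1⟩, hκ2⟩ := (((eventually_pos_lt one_pos).and
    (eventually_mul_lt (1 + 2 * M) one_pos)).and
    (eventually_mul_lt (|G| * (1 + 2 * M)) hγ4)).exists
  obtain ⟨ρ, ⟨⟨⟨⟨hρ0, hρ1⟩, hρ2⟩, hρ3⟩, hρ4⟩, hρ5⟩ := (((((eventually_pos_lt one_pos).and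
    (eventually_mul_lt (C * M + 2 * M * ‖b‖) hγ4)).and
    (eventually_mul_lt ((1 + |b₀|) * M) one_pos)).and
    (eventually_mul_lt (2 * (C₁ + C₂)) hκ0)).and (eventually_mul_lt (M * ‖b‖) one_pos)).exists
  set Λ := K * (‖sliceCLM A‖ + ‖resonantDir A‖) * ‖β‖ with hΛ
  obtain ⟨ε₂, ⟨hε₂0, hε₂ρ⟩, hε₂Λ⟩ := ((eventually_pos_lt (pow_pos hρ0 2)).and
    (eventually_mul_lt Λ one_pos)).exists
  refine ⟨ε₂, hε₂0, fun ε μ α g φ ψ hμ hμε hε hg hφ hψ hφC hψC hα h => ?_⟩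
  have hερ : ε ≤ ρ ^ 2 := (hε.trans hε₂ρ).le
  have hρ2le : ρ ^ 2 ≤ ρ := by nlinarith
  have hε1 : ε ≤ 1 := by linarith
  have hε0 : 0 < ε := hμ.trans_le hμε
  have hμ1 : μ ≤ 1 := hμε.trans hε1
  have hMρ : M * ρ ≤ 1 := by
    have : 0 ≤ |b₀| * M * ρ := by positivity
    linarith
  have hMρ0 : 0 ≤ M * ρ := by positivity
  have hG0 : 0 ≤ |G| * κ := by positivity
  have hCMρ : 0 ≤ C * M * ρ := by positivity
  have hMbρ : 0 ≤ M * ‖b‖ * ρ := by positivity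
  set z₀ := x₂ • resonantDir A + ((1 - χ) * α₀) • Ω with hz₀
  set y₀ := x₂ • resonantDir A - (χ * α₀) • Ω with hy₀
  obtain ⟨u, t, hu, ht, hper, hteq, hueq⟩ := hgraph ((1 - 2 * χ) • ω) γ G ρ κ μ
    (graphRem γ x₂ b₀ μ (α - α₀) (sliceCLM A) (resonantDir A) Ω (χ • Ω) z₀ y₀ P φ ψ) hμ hρ0 hκ0.le
    (mul_le_one₀ hμ1 hMρ0 hMρ) (by linarith) hγ (by nlinarith) (by nlinarith)
    (fun u t hu ht => (hR₁ P φ ψ x₂ μ ε (α - α₀) ρ z₀ y₀ hμ hμε hε1 hρ0.le hρ3.le hx₂ rfl hP hφC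
      hψC hα u t hu ht).mono_const (by
        have e1 : C₁ * (ρ ^ 2 + ε) ≤ C₁ * (2 * ρ ^ 2) := by gcongr; linarith
        have e2 : 2 * (C₁ + C₂) * ρ * ρ ≤ κ * ρ := by gcongr
        have e3 : 0 ≤ C₂ * ρ ^ 2 := by positivity
        linarith))
    (fun s a a' e e' ha ha' he he' => (hR₂ P φ ψ x₂ μ ε (α - α₀) ρ z₀ y₀ hμ hμε hε1 hρ0.le hρ3.le
      rfl (hP.mono_order (by omega)) (hφC.mono_order (by omega)) (hψC.mono_order (by omega))
      s a a' e e' ha ha' he he').trans (by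
        refine mul_le_mul_of_nonneg_right ?_ (by positivity)
        have e1 : C₂ * (ρ + ε) ≤ C₂ * (2 * ρ) := by gcongr; linarith
        have e3 : 0 ≤ C₁ * ρ := by positivity
        linarith))
  have hper' : ∀ s (m : Fin r → ℤ), u (s + fun j => (m j : ℝ)) = u s := fun s m =>
    (hper _ (fun s a e => graphRem_add_intCast hφ hψ s m a e) s).1
  have hu1 : CkBound (0 + 1) ρ u := hu.mono_order (by omega)
  have ht1 : CkBound (0 + 1) (M * ρ) t := ht.mono_order (by omega)
  have hφ1 : CkBound (0 + 1) (K * ε) φ := hφC.mono_order (by omega)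
  have hsurj : Function.Surjective fun s => s + (1 - 2 * χ) • ω + (μ * t s) • b := by
    refine surjective_add_of_lipschitz _ hρ5 fun s s' => ?_
    rw [← sub_smul, ← mul_sub, norm_smul, norm_mul, Real.norm_of_nonneg hμ.le]
    calc μ * ‖t s - t s'‖ * ‖b‖ ≤ 1 * (M * ρ * ‖s - s'‖) * ‖b‖ := by
          gcongr
          exact ht1.lipschitz s s'
      _ = _ := by ring
  refine ⟨torusEmbedding A Ω φ x₂ u, isInvariantTorus_torusEmbedding A
    (c := K * ε * (‖sliceCLM A‖ + ‖resonantDir A‖)) hℓ hφ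
    (hφC.1.of_le (by exact_mod_cast (by omega))) hper' hu.1 (fun s s' => ?_) ?_
    (image_torusSet_torusEmbedding hA hP1 hχ hμ.ne' hg hφ h hteq hueq hsurj)⟩
  · have h1 := hφ1.lipschitz (sliceCLM A s + (x₂ + u s) • resonantDir A)
      (sliceCLM A s' + (x₂ + u s') • resonantDir A)
    rw [Real.norm_eq_abs] at h1
    refine h1.trans ?_
    rw [mul_assoc (K * ε)]
    refine mul_le_mul_of_nonneg_left ?_ (by positivity)
    rw [show sliceCLM A s + (x₂ + u s) • resonantDir A -
      (sliceCLM A s' + (x₂ + u s') • resonantDir A) =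
      (sliceCLM A s - sliceCLM A s') + (u s - u s') • resonantDir A by module, ← map_sub]
    refine (norm_add_le _ _).trans ?_
    rw [norm_smul, add_mul, mul_comm ‖u s - u s'‖]
    gcongr
    · exact (sliceCLM A).le_opNorm _
    · refine (hu1.lipschitz s s').trans ?_
      exact mul_le_of_le_one_left (norm_nonneg _) hρ1.le
  · have e1 : Λ * ε ≤ Λ * ε₂ := by
      have : 0 ≤ Λ := by positivity
      gcongr
    calc _ = Λ * ε := by rw [hΛ]; ring
      _ < 1 := by linarith

end Torus

end FoliationTorus

end

theorem theorem2p2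
    (r : ℕ) (Ω : Fin (r + 1) → ℝ) (hΩ : FoliationTorus.IsIrrational Ω)
    -- the family of maps: `C^n` in `ε`, and `C^p` in `x` with `p` finite, `∞` or `ω`
    (n : ℕ) (p : WithTop ℕ∞) (ε₁ : ℝ) (hε₁ : 0 < ε₁) (f : ℝ → (Fin (r + 1) → ℝ) → ℝ)
    (hf : FoliationTorus.IsTorusFamily n p ε₁ f)
    -- `α₀ Ω` is resonant with Diophantine intrinsic frequency `ω`
    (α₀ : ℝ) (hα₀ : α₀ ≠ 0) (hres : FoliationTorus.IsResonant (α₀ • Ω))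
    (A : Matrix.SpecialLinearGroup (Fin (r + 1)) ℤ) (ω : Fin r → ℝ) (L : Fin (r + 1) → ℤ)
    (hA : FoliationTorus.IsIntrinsicFrequency A ω L (α₀ • Ω))
    (ν τ : ℝ) (hν : 0 < ν) (hτ : 0 < τ) (hω : FoliationTorus.IsDiophantine ν τ ω)
    -- `ℓ` is the regularity of the torus, `q` the loss in the averaging procedure
    (q ℓ : ℕ) (hℓ : 1 ≤ ℓ) (hq : (n : ℝ) * ((r + 1 : ℝ) + τ) ≤ q)
    (hp : ((q + ℓ + 4 : ℕ) : WithTop ℕ∞) ≤ p)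
    -- the resonant normal form has leading order `n` and is non-degenerate
    (hn : FoliationTorus.IsFirstOrder Ω f α₀ A ω n)
    (x₂ : ℝ) (hη : FoliationTorus.eta Ω f α₀ A ω L n x₂ = 0)
    (hη' : deriv (FoliationTorus.eta Ω f α₀ A ω L n) x₂ ≠ 0) :
    ∀ C : ℝ, 0 < C → ∃ ε₀ : ℝ, 0 < ε₀ ∧ ∀ α ε : ℝ, 0 < ε → ε < ε₀ →
      |α - α₀| ≤ C * ε ^ (n + 1) →
      ∃ K : (Fin r → ℝ) → (Fin (r + 1) → ℝ),
        FoliationTorus.IsInvariantTorus ℓ (FoliationTorus.F Ω f α ε) K := by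
  intro C hC
  obtain ⟨φ, hφper, ⟨C₁, hφ⟩, ⟨M, hP⟩, ⟨C₂, hψ⟩⟩ :=
    FoliationTorus.exists_resonant_normal_form hf hε₁ hA hν hτ hω hq hp hn
  set P := FoliationTorus.normalFormTerm Ω f α₀ A ω n with hP_def
  set β := FoliationTorus.act A Ω (Fin.last r) with hβ_def
  have hβ : α₀⁻¹ * (L (Fin.last r) : ℝ) = β := by
    rw [← hA.last, inv_mul_cancel_left₀ hα₀]
  have hη_eq : FoliationTorus.eta Ω f α₀ A ω L n = fun y => β * P y := by
    funext y
    rw [FoliationTorus.eta, hβ]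
  rw [hη_eq] at hη hη'
  rw [deriv_const_mul_field] at hη'
  have hβ0 : β ≠ 0 := left_ne_zero_of_mul hη'
  have hx₂ : P x₂ = 0 := (mul_eq_zero.1 hη).resolve_left hβ0
  -- the sign of `β P'(x₂)` decides between a repelling and an attracting torus
  obtain ⟨χ, hχ, hsign⟩ : ∃ χ : ℝ, (χ = 0 ∨ χ = 1) ∧ 0 < (1 - 2 * χ) * β * deriv P x₂ := by
    rcases lt_or_gt_of_ne hη' with h | h
    · exact ⟨1, Or.inr rfl, by linarith⟩
    · exact ⟨0, Or.inl rfl, by linarith⟩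
  set K := |C₁| + |C₂| + M + C with hK
  have hM := hP.nonneg
  obtain ⟨ε₂, hε₂, htorus⟩ := FoliationTorus.exists_isInvariantTorus_of_normalForm hA hℓ
    (hP.mono_const (N := K) (by rw [hK]; linarith [abs_nonneg C₁, abs_nonneg C₂]))
    (FoliationTorus.normalFormTerm_add_one n) hx₂ hχ hsign
  have hev := ((hφ.and hψ).and (FoliationTorus.eventually_pos_lt hε₂)).and
    ((FoliationTorus.eventually_pos_lt hε₁).and (FoliationTorus.eventually_pos_lt one_pos))
  obtain ⟨ε₀, hε₀, hsub⟩ := mem_nhdsGT_iff_exists_Ioo_subset.1 hev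
  refine ⟨ε₀, hε₀, fun α ε hε hεε₀ hα => ?_⟩
  obtain ⟨⟨⟨hφε, hψε⟩, -, hεε₂⟩, ⟨-, hεε₁⟩, -, hε1⟩ := hsub ⟨hε, hεε₀⟩
  have hmem : ε ∈ Set.Ico 0 ε₁ := ⟨hε.le, hεε₁⟩
  have hpow : ε ^ (n + 1) = ε * ε ^ n := pow_succ' ε n
  refine htorus ε (ε ^ n) α (f ε) (φ ε) _ (pow_pos hε n)
    (pow_le_of_le_one hε.le hε1.le (by have := hn.one_le; omega)) hεε₂ (hf.periodic ε hmem)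
    (hφper ε) ?_ (hφε.mono_const ?_) (hψε.mono_const ?_) (hα.trans ?_) fun x => ?_
  · intro x m
    have h1 := (hf.isPeriodic_conjugacyDefect (Ω := Ω) (α₀ := α₀) (hφper ε) hmem) x m
    have h2 : P (FoliationTorus.act A (fun i => x i + (m i : ℝ)) (Fin.last r)) =
        P (FoliationTorus.act A x (Fin.last r)) := by
      have h3 : FoliationTorus.act A (fun i => x i + (m i : ℝ)) =
          FoliationTorus.act A x + FoliationTorus.act A fun i => (m i : ℝ) :=
        FoliationTorus.act_add A x _
      have h4 : Function.Periodic P 1 := FoliationTorus.normalFormTerm_add_one n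
      rw [h3, FoliationTorus.act_intCast, Pi.add_apply]
      simpa using h4.int_mul _ _
    dsimp only
    rw [h1, h2]
  · rw [pow_one]
    gcongr
    linarith [le_abs_self C₁, abs_nonneg C₂]
  · rw [hpow, mul_assoc K]
    gcongr
    linarith [le_abs_self C₂, abs_nonneg C₁]
  · rw [hpow, mul_assoc K]
    gcongr
    linarith [abs_nonneg C₂, abs_nonneg C₁]
  · simp only [FoliationTorus.conjugacyDefect]
    ring
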